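/- Let $c\ge 1$ and $r=c$. For a matrix $M\in\mathbb R^{c\times r}$ and positive definite matrices $\Sigma_c\in\mathbb R^{c\times c}$, $\Sigma_r\in\mathbb R^{r\times r}$, let $X_1,\dots,X_N$ be independent random $c\times r$ matrices from the matrix-variate normal distribution $\mathcal N_{c,r}(M,\Sigma_c,\Sigma_r)$, that is, $\mathrm{vec}(X_n)\sim\mathcal N_{cr}(\mu,\Sigma)$ with $\mu=\mathrm{vec}(M)$ (columns stacked) and the Kronecker-structured covariance $\Sigma=\Sigma_r\otimes\Sigma_c$. Define the vector-based and the matrix-based Mahalanobis squared distances $$\Delta(x,\mu,\Sigma)=(x-\mu)^\top\Sigma^{-1}(x-\mu),\qquad \Delta_M(X,M,\Sigma_c,\Sigma_r)=\mathrm{tr}\{\Sigma_c^{-1}(X-M)\Sigma_r^{-1}(X-M)^\top\},$$ the sample mean and sample covariance $$\hat M=\frac1N\sum_{n=1}^N X_n,\qquad \hat\mu=\mathrm{vec}(\hat M),\qquad \hat\Sigma=\frac1{N-1}\sum_{n=1}^N(\mathrm{vec}(X_n)-\hat\mu)(\mathrm{vec}(X_n)-\hat\mu)^\top,$$ and call a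 pair $(\hat\Sigma_c,\hat\Sigma_r)$ of positive definite matrices flip-flop maximum likelihood estimates if $$\hat\Sigma_c=\frac1{Nr}\sum_{n=1}^N(X_n-\hat M)\hat\Sigma_r^{-1}(X_n-\hat M)^\top,\qquad \hat\Sigma_r=\frac1{Nc}\sum_{n=1}^N(X_n-\hat M)^\top\hat\Sigma_c^{-1}(X_n-\hat M).$$ Then, as $N\to\infty$, $$\Delta(\mathrm{vec}(X_n),\hat\mu,\hat\Sigma)=\Delta(\mathrm{vec}(X_n),\mu,\Sigma)+O_p\!\left(\frac{c^2}{\sqrt N}\right),\qquad \Delta_M(X_n,\hat M,\hat\Sigma_c,\hat\Sigma_r)=\Delta_M(X_n,M,\Sigma_c,\Sigma_r)+O_p\!\left(\frac{c}{\sqrt N}\right),$$ with constants that do not depend on $c$. Precisely: for every $\varepsilon>0$ there is $K>0$ such that for every $c\ge1$ there is $N_0$ such that for all $N\ge N_0$, all $M,\Sigma_c,\Sigma_r$, every such sample and every $n\in\{1,\dots,N\}$: 1. with probability at least $1-\varepsilon$, $\hat\Sigma$ is positive definite and $|\Delta(\mathrm{vec}(X_n),\hat\mu,\hat\Sigma)-\Delta(\mathrm{vec}(X_n),\mu,\Sigma)|\le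 K c^2/\sqrt N$; 2. with probability at least $1-\varepsilon$, flip-flop maximum likelihood estimates exist, and every pair $(\hat\Sigma_c,\hat\Sigma_r)$ of them satisfies $|\Delta_M(X_n,\hat M,\hat\Sigma_c,\hat\Sigma_r)-\Delta_M(X_n,M,\Sigma_c,\Sigma_r)|\le K c/\sqrt N$. (The probability of failure is understood as an outer probability where measurability is not known.) -/

import Mathlib

open MeasureTheory ProbabilityTheory
open scoped Matrix Kronecker

noncomputable section

namespace MatrixNormal

/-- Vector-based Mahalanobis squared distance `(x - μ)ᵀ S⁻¹ (x - μ)`. -/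
def vecMSD {ι : Type*} [Fintype ι] [DecidableEq ι]
    (x μ : ι → ℝ) (S : Matrix ι ι ℝ) : ℝ :=
  (x - μ) ⬝ᵥ (S⁻¹ *ᵥ (x - μ))

/-- Matrix-based Mahalanobis squared distance `tr (Sc⁻¹ (X - M) Sr⁻¹ (X - M)ᵀ)`. -/
def matMSD {c r : ℕ} (X M : Matrix (Fin c) (Fin r) ℝ)
    (Sc : Matrix (Fin c) (Fin c) ℝ) (Sr : Matrix (Fin r) (Fin r) ℝ) : ℝ :=
  (Sc⁻¹ * (X - M) * Sr⁻¹ * (X - M)ᵀ).trace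

/-- Sample mean of vectors. -/
def vecMean {ι : Type*} {N : ℕ} (x : Fin N → ι → ℝ) : ι → ℝ :=
  (N : ℝ)⁻¹ • ∑ n, x n

/-- Sample covariance matrix, with the normalization `1 / (N - 1)`. -/
def vecCov {ι : Type*} {N : ℕ} (x : Fin N → ι → ℝ) : Matrix ι ι ℝ :=
  ((N : ℝ) - 1)⁻¹ • ∑ n, Matrix.vecMulVec (x n - vecMean x) (x n - vecMean x)

/-- Sample mean of matrices. -/
def matMean {c r N : ℕ} (X : Fin N → Matrix (Fin c) (Fin r) ℝ) : Matrix (Fin c) (Fin r) ℝ :=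
  (N : ℝ)⁻¹ • ∑ n, X n

/-- One flip-flop update of the column covariance from the row covariance `Sr`. -/
def flipC {c r N : ℕ} (X : Fin N → Matrix (Fin c) (Fin r) ℝ)
    (Sr : Matrix (Fin r) (Fin r) ℝ) : Matrix (Fin c) (Fin c) ℝ :=
  ((N : ℝ) * r)⁻¹ • ∑ n, (X n - matMean X) * Sr⁻¹ * (X n - matMean X)ᵀ

/-- One flip-flop update of the row covariance from the column covariance `Sc`. -/
def flipR {c r N : ℕ} (X : Fin N → Matrix (Fin c) (Fin r) ℝ)
    (Sc : Matrix (Fin c) (Fin c) ℝ) : Matrix (Fin r) (Fin r) ℝ :=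
  ((N : ℝ) * c)⁻¹ • ∑ n, (X n - matMean X)ᵀ * Sc⁻¹ * (X n - matMean X)

/-- `(Sc, Sr)` is a flip-flop maximum likelihood estimate for the data `X`: a pair of positive
definite matrices that solves the two coupled likelihood equations, that is, at which the
alternating updates have converged. (The positive definite limits of the alternating scheme are
exactly these pairs.) Such a pair is determined only up to `(a • Sc, a⁻¹ • Sr)`, a change that
leaves `matMSD` as it is. -/
structure IsFlipFlopMLE {c r N : ℕ} (X : Fin N → Matrix (Fin c) (Fin r) ℝ)
    (Sc : Matrix (Fin c) (Fin c) ℝ) (Sr : Matrix (Fin r) (Fin r) ℝ) : Prop where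
  posDef_c : Sc.PosDef
  posDef_r : Sr.PosDef
  eq_c : Sc = flipC X Sr
  eq_r : Sr = flipR X Sc

/-- `X 0, …, X (N - 1)` is an independent sample from the matrix-variate normal distribution with
mean `M`, column covariance `Sc` and row covariance `Sr`: the vectorizations (columns stacked) are
independent with law `𝒩(vec M, Sr ⊗ Sc)`. -/
structure IsSample {Ω : Type*} [MeasurableSpace Ω] (P : Measure Ω) {c r N : ℕ}
    (X : Fin N → Ω → Matrix (Fin c) (Fin r) ℝ) (M : Matrix (Fin c) (Fin r) ℝ)
    (Sc : Matrix (Fin c) (Fin c) ℝ) (Sr : Matrix (Fin r) (Fin r) ℝ) : Prop where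
  hasLaw : ∀ n, HasLaw (fun ω => WithLp.toLp 2 (X n ω).vec)
    (multivariateGaussian (WithLp.toLp 2 M.vec) (Sr ⊗ₖ Sc)) P
  indep : iIndepFun (fun n ω => (WithLp.toLp 2 (X n ω).vec :
    EuclideanSpace ℝ (Fin r × Fin c))) P

end MatrixNormal

end

set_option linter.unusedSectionVars false

noncomputable section

namespace MatrixNormal

open scoped RealInnerProductSpace NNReal ENNReal

-- Moments of a standard Gaussian vector up to order four.

section GaussianMoments

-- Both distances and all estimates transform equivariantly under `X = M + L * Z * Rᵀ`, so the
-- sample may be taken standard Gaussian in dimension `c²` (`IsSample.exists_whitening`,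
-- `IsFlipFlopMLE.affine`). Let `x` be observation `n`, `y` the sample mean and `A` the deviation of
-- the uncentered second moment from the identity.
--
-- On an event of probability close to one (`IsControlled`), a deterministic expansion holds: each
-- distance equals `|x|²`, minus a linear functional `∑ q_a(x) A_a`, minus twice `x ⬝ y`, up to a
-- remainder `C / N` (`exists_vecMSD_expansion`, `exists_matMSD_expansion`). The constant `C`
-- depends on `c` without any control, but so may `N₀`, and for large `N` the remainder falls below
-- `1 / √N`. Hence the rate in `c` is decided by the two leading terms alone.
--
-- Removing observation `n` from `A` and `y` costs another `O(1 / N)` and makes the coefficients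
-- independent of what remains. The second moment of the linear term is then at most `2 E‖q(x)‖² /
-- N` in Frobenius norm, and Chebyshev's inequality applies (`integral_sq_sum_mul_sum`,
-- `measure_lt_abs_sum_mul_centeredProd`). For the vector distance `q = x xᵀ` and `E‖q‖²` is of
-- order `c⁴`. For the matrix distance `q` is `matWeight`, built from partial traces divided by `c`,
-- and `E‖q‖²` is only of order `c²` (`sum_integral_matWeight_sq_le`). This gives the rates `c²` and
-- `c`; the term `x ⬝ y` is of order `c / √N` in both cases.
--
-- In whitened coordinates the flip-flop equations for the inverses `p = Sr⁻¹`, `q = Sc⁻¹` are a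
-- small linear perturbation of `p⁻¹ = (tr q / c) • 1`, `q⁻¹ = (tr p / c) • 1`. Existence follows
-- from a contraction on matrices of fixed trace; the leftover scalar is forced to be one because
-- the two perturbations are adjoint (`exists_solution_coupled_equations`). Uniqueness is not
-- needed: a positive definite matrix is bounded by its trace, which places every solution, after
-- rescaling, near the identity and makes the expansion valid for all of them
-- (`exists_coupled_equations_expansion`).

lemma integral_pow_four_gaussianReal (v : ℝ≥0) :
    ∫ x, x ^ 4 ∂(gaussianReal 0 v) = 3 * (v : ℝ) ^ 2 := by
  have h0 : ∫ x, x ^ 4 ∂(gaussianReal 0 v)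
      = iteratedDeriv 4 (mgf (fun x ↦ x) (gaussianReal 0 v)) 0 := by
    rw [iteratedDeriv_mgf_zero] <;> simp
  -- Derivatives of the moment generating function `exp (v t² / 2)` stay polynomial times the same
  -- exponential, so the fourth derivative reduces to four steps of `p ↦ p' + v t p` starting from
  -- `1`.
  have key : ∀ (p p' : ℝ → ℝ), (∀ t, HasDerivAt p (p' t) t) →
      deriv (fun t ↦ p t * Real.exp (v * t ^ 2 / 2))
        = fun t ↦ (p' t + v * t * p t) * Real.exp (v * t ^ 2 / 2) := by
    intro p p' hp
    ext t
    have h1 : HasDerivAt (fun t : ℝ ↦ (v : ℝ) * t ^ 2 / 2) (v * t) t := by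
      have := ((hasDerivAt_pow 2 t).const_mul (v : ℝ)).div_const 2
      convert! this using 1
      simp; ring
    have := (hp t).mul h1.exp
    rw [HasDerivAt.deriv (f' := (p' t + v * t * p t) * Real.exp (v * t ^ 2 / 2))]
    convert! this using 1
    ring
  rw [h0, mgf_fun_id_gaussianReal]
  have e0 : (fun t : ℝ ↦ Real.exp (0 * t + v * t ^ 2 / 2))
      = fun t ↦ (fun _ ↦ (1 : ℝ)) t * Real.exp (v * t ^ 2 / 2) := by
    ext t; simp
  rw [e0, iteratedDeriv_succ', iteratedDeriv_succ', iteratedDeriv_succ', iteratedDeriv_one,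
    key _ (fun _ ↦ 0) (fun t ↦ hasDerivAt_const _ _),
    key _ (fun _ ↦ (v : ℝ)) ?_, key _ (fun t ↦ 2 * (v : ℝ) ^ 2 * t) ?_,
    key _ (fun t ↦ 3 * (v : ℝ) ^ 2 + 3 * (v : ℝ) ^ 3 * t ^ 2) ?_]
  · simp
  · intro t
    have := ((hasDerivAt_pow 3 t).const_mul ((v : ℝ) ^ 3)).add
      ((hasDerivAt_id t).const_mul (3 * (v : ℝ) ^ 2))
    convert! this using 1
    · ext s; simp; ring
    · simp; ring
  · intro t
    have := ((hasDerivAt_pow 2 t).const_mul ((v : ℝ) ^ 2)).const_add (v : ℝ)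
    convert! this using 1
    · ext s; simp; ring
    · simp; ring
  · intro t
    have := (hasDerivAt_id t).const_mul (v : ℝ)
    convert! this using 1
    · ext s; simp
    · simp

variable {Ω : Type*} [MeasurableSpace Ω] {P : Measure Ω} {ι : Type*} [Fintype ι]
  {g : Ω → EuclideanSpace ℝ ι}

lemma hasLaw_inner_stdGaussian (hg : HasLaw g (stdGaussian (EuclideanSpace ℝ ι)) P)
    (u : EuclideanSpace ℝ ι) :
    HasLaw (fun ω ↦ ⟪u, g ω⟫) (gaussianReal 0 (‖u‖₊ ^ 2)) P := by
  have h : HasLaw (innerSL ℝ u) (gaussianReal 0 (‖u‖₊ ^ 2)) (stdGaussian (EuclideanSpace ℝ ι)) := by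
    refine ⟨by fun_prop, ?_⟩
    rw [IsGaussian.map_eq_gaussianReal, integral_strongDual_stdGaussian,
      variance_dual_stdGaussian]
    congr 1
    ext
    simp [innerSL_apply_norm]
  exact h.comp hg

lemma memLp_inner_stdGaussian (hg : HasLaw g (stdGaussian (EuclideanSpace ℝ ι)) P)
    (u : EuclideanSpace ℝ ι) (p : ℝ≥0∞) (hp : p ≠ ∞) :
    MemLp (fun ω ↦ ⟪u, g ω⟫) p P := by
  have h := hasLaw_inner_stdGaussian hg u
  have := memLp_id_gaussianReal' (μ := 0) (v := ‖u‖₊ ^ 2) p hp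
  rw [← h.map_eq, memLp_map_measure_iff (by fun_prop) h.aemeasurable] at this
  exact this

lemma integral_inner_pow_four (hg : HasLaw g (stdGaussian (EuclideanSpace ℝ ι)) P)
    (u : EuclideanSpace ℝ ι) :
    ∫ ω, ⟪u, g ω⟫ ^ 4 ∂P = 3 * ⟪u, u⟫ ^ 2 := by
  have h := hasLaw_inner_stdGaussian hg u
  have := h.integral_comp (f := fun x ↦ x ^ 4) (by fun_prop)
  simp only [Function.comp_def] at this
  rw [this, integral_pow_four_gaussianReal, real_inner_self_eq_norm_sq]
  simp

lemma integral_inner_sq (hg : HasLaw g (stdGaussian (EuclideanSpace ℝ ι)) P)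
    (u : EuclideanSpace ℝ ι) :
    ∫ ω, ⟪u, g ω⟫ ^ 2 ∂P = ⟪u, u⟫ := by
  have h := hasLaw_inner_stdGaussian hg u
  have := h.integral_comp (f := fun x ↦ x ^ 2) (by fun_prop)
  simp only [Function.comp_def] at this
  have hv := variance_fun_id_gaussianReal (μ := 0) (v := ‖u‖₊ ^ 2)
  rw [variance_eq_integral (by fun_prop)] at hv
  simp only [integral_id_gaussianReal, sub_zero] at hv
  rw [this, hv, real_inner_self_eq_norm_sq]
  simp

lemma integral_inner (hg : HasLaw g (stdGaussian (EuclideanSpace ℝ ι)) P)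
    (u : EuclideanSpace ℝ ι) :
    ∫ ω, ⟪u, g ω⟫ ∂P = 0 := by
  rw [(hasLaw_inner_stdGaussian hg u).integral_eq, integral_id_gaussianReal]

lemma integral_inner_mul_inner (hg : HasLaw g (stdGaussian (EuclideanSpace ℝ ι)) P)
    (a b : EuclideanSpace ℝ ι) :
    ∫ ω, ⟪a, g ω⟫ * ⟪b, g ω⟫ ∂P = ⟪a, b⟫ := by
  have hi : ∀ u, Integrable (fun ω ↦ ⟪u, g ω⟫ ^ 2) P := fun u ↦
    (memLp_inner_stdGaussian hg u 2 (by simp)).integrable_sq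
  have e : (fun ω ↦ ⟪a, g ω⟫ * ⟪b, g ω⟫)
      = fun ω ↦ (1 / 4) * (⟪a + b, g ω⟫ ^ 2 - ⟪a - b, g ω⟫ ^ 2) := by
    ext ω
    simp only [inner_add_left, inner_sub_left]
    ring
  rw [e, integral_const_mul, integral_sub (hi _) (hi _), integral_inner_sq hg,
    integral_inner_sq hg]
  simp only [inner_add_left, inner_sub_left, inner_add_right, inner_sub_right,
    real_inner_comm a b]
  ring

/-- Isserlis' formula for the fourth moments of a standard Gaussian vector. -/
lemma integral_inner_mul_four (hg : HasLaw g (stdGaussian (EuclideanSpace ℝ ι)) P)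
    (a b c d : EuclideanSpace ℝ ι) :
    ∫ ω, (⟪a, g ω⟫ * ⟪b, g ω⟫) * (⟪c, g ω⟫ * ⟪d, g ω⟫) ∂P
      = ⟪a, b⟫ * ⟪c, d⟫ + ⟪a, c⟫ * ⟪b, d⟫ + ⟪a, d⟫ * ⟪b, c⟫ := by
  have hi : ∀ u, Integrable (fun ω ↦ ⟪u, g ω⟫ ^ 4) P := fun u ↦ by
    have := (memLp_inner_stdGaussian hg u 4 (by simp)).integrable_norm_pow (by simp)
    simpa [Even.pow_abs (by decide : Even 4)] using this
  -- Polarization of the quartic form over the eight sign choices with `a` fixed; `192 = 8 * 4!`.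
  have e : (fun ω ↦ (⟪a, g ω⟫ * ⟪b, g ω⟫) * (⟪c, g ω⟫ * ⟪d, g ω⟫))
      = fun ω ↦ (1 / 192) * (((⟪a + b + c + d, g ω⟫ ^ 4 - ⟪a + b + c - d, g ω⟫ ^ 4)
        - (⟪a + b - c + d, g ω⟫ ^ 4 - ⟪a + b - c - d, g ω⟫ ^ 4))
        - ((⟪a - b + c + d, g ω⟫ ^ 4 - ⟪a - b + c - d, g ω⟫ ^ 4)
        - (⟪a - b - c + d, g ω⟫ ^ 4 - ⟪a - b - c - d, g ω⟫ ^ 4))) := by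
    ext ω
    simp only [inner_add_left, inner_sub_left]
    ring
  have hs : ∀ u v, Integrable (fun ω ↦ ⟪u, g ω⟫ ^ 4 - ⟪v, g ω⟫ ^ 4) P :=
    fun u v ↦ (hi u).sub (hi v)
  have hss : ∀ u v u' v', Integrable (fun ω ↦ (⟪u, g ω⟫ ^ 4 - ⟪v, g ω⟫ ^ 4)
      - (⟪u', g ω⟫ ^ 4 - ⟪v', g ω⟫ ^ 4)) P := fun u v u' v' ↦ (hs u v).sub (hs u' v')
  rw [e, integral_const_mul, integral_sub (hss _ _ _ _) (hss _ _ _ _),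
    integral_sub (hs _ _) (hs _ _), integral_sub (hs _ _) (hs _ _)]
  simp only [integral_sub (hi _) (hi _), integral_inner_pow_four hg]
  simp only [inner_add_left, inner_sub_left, inner_add_right, inner_sub_right,
    real_inner_comm a b, real_inner_comm a c, real_inner_comm a d, real_inner_comm b c,
    real_inner_comm b d, real_inner_comm c d]
  ring

variable [DecidableEq ι]

lemma inner_single_eq (i : ι) (x : EuclideanSpace ℝ ι) :
    ⟪EuclideanSpace.single i (1 : ℝ), x⟫ = x i := by
  simp [EuclideanSpace.inner_single_left]

lemma euclideanSpace_single_one_apply (i j : ι) :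
    (EuclideanSpace.single j (1 : ℝ)) i = (1 : Matrix ι ι ℝ) i j := by
  rw [Matrix.one_apply]
  simp

lemma memLp_coord (hg : HasLaw g (stdGaussian (EuclideanSpace ℝ ι)) P) (i : ι)
    (p : ℝ≥0∞) (hp : p ≠ ∞) : MemLp (fun ω ↦ g ω i) p P := by
  simpa only [inner_single_eq] using memLp_inner_stdGaussian hg (EuclideanSpace.single i 1) p hp

lemma integral_coord (hg : HasLaw g (stdGaussian (EuclideanSpace ℝ ι)) P) (i : ι) :
    ∫ ω, g ω i ∂P = 0 := by
  simpa only [inner_single_eq] using integral_inner hg (EuclideanSpace.single i 1)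

lemma integral_coord_mul (hg : HasLaw g (stdGaussian (EuclideanSpace ℝ ι)) P) (i j : ι) :
    ∫ ω, g ω i * g ω j ∂P = (1 : Matrix ι ι ℝ) i j := by
  simpa only [inner_single_eq, euclideanSpace_single_one_apply] using
    integral_inner_mul_inner hg (EuclideanSpace.single i 1) (EuclideanSpace.single j 1)

lemma integral_coord_mul_four (hg : HasLaw g (stdGaussian (EuclideanSpace ℝ ι)) P)
    (i j k l : ι) :
    ∫ ω, (g ω i * g ω j) * (g ω k * g ω l) ∂P
      = (1 : Matrix ι ι ℝ) i j * (1 : Matrix ι ι ℝ) k l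
        + (1 : Matrix ι ι ℝ) i k * (1 : Matrix ι ι ℝ) j l
        + (1 : Matrix ι ι ℝ) i l * (1 : Matrix ι ι ℝ) j k := by
  have := integral_inner_mul_four hg (EuclideanSpace.single i 1) (EuclideanSpace.single j 1)
    (EuclideanSpace.single k 1) (EuclideanSpace.single l 1)
  simp only [inner_single_eq, euclideanSpace_single_one_apply] at this
  exact this

end GaussianMoments

-- Second moments of sums of independent centered variables.

section IndependentSums

lemma measure_lt_abs_le_of_integral_sq {Ω : Type*} [MeasurableSpace Ω] {P : Measure Ω}
    {f : Ω → ℝ} (hf : Integrable (fun ω ↦ f ω ^ 2) P) {s t : ℝ}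
    (hs : ∫ ω, f ω ^ 2 ∂P ≤ s) (ht : 0 < t) :
    P {ω | t < |f ω|} ≤ ENNReal.ofReal (s / t ^ 2) := by
  have h := meas_ge_le_lintegral_div (μ := P) (f := fun ω ↦ ENNReal.ofReal (f ω ^ 2))
    (hf.aestronglyMeasurable.aemeasurable.ennreal_ofReal) (ε := ENNReal.ofReal (t ^ 2))
    (by simp; positivity) (by simp)
  have hsub : {ω | t < |f ω|} ⊆ {ω | ENNReal.ofReal (t ^ 2) ≤ ENNReal.ofReal (f ω ^ 2)} := by
    intro ω hω
    apply ENNReal.ofReal_le_ofReal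
    rw [← sq_abs (f ω)]
    exact pow_le_pow_left₀ ht.le hω.le 2
  refine (measure_mono hsub).trans (h.trans ?_)
  rw [← ofReal_integral_eq_lintegral_ofReal hf (Filter.Eventually.of_forall fun ω ↦ sq_nonneg _),
    ← ENNReal.ofReal_div_of_pos (by positivity)]
  exact ENNReal.ofReal_le_ofReal (by gcongr)

variable {Ω : Type*} [MeasurableSpace Ω] {P : Measure Ω} [IsProbabilityMeasure P]
  {E : Type*} [MeasurableSpace E] {γ : Measure E} {N : ℕ} {z : Fin N → Ω → E}
  {κ : Type*} [Fintype κ] {φ q : κ → E → ℝ}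

lemma memLp_comp_hasLaw {g : Ω → E} (hg : HasLaw g γ P) {f : E → ℝ} {p : ℝ≥0∞}
    (hf : MemLp f p γ) : MemLp (fun ω ↦ f (g ω)) p P := by
  rw [← hg.map_eq] at hf
  exact hf.comp_of_map hg.aemeasurable

lemma integral_comp_hasLaw {g : Ω → E} (hg : HasLaw g γ P) {f : E → ℝ} (hf : Measurable f) :
    ∫ ω, f (g ω) ∂P = ∫ x, f x ∂γ :=
  hg.integral_comp (X := g) hf.aestronglyMeasurable

/-- Independence and centering kill the terms with distinct indices; only the diagonal survives. -/
lemma integral_sum_mul_sum (hz : ∀ m, HasLaw (z m) γ P) (hind : iIndepFun z P)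
    (hφm : ∀ a, Measurable (φ a)) (hφ2 : ∀ a, MemLp (φ a) 2 γ) (hφ0 : ∀ a, ∫ x, φ a x ∂γ = 0)
    (s : Finset (Fin N)) (a b : κ) :
    ∫ ω, (∑ m ∈ s, φ a (z m ω)) * (∑ m ∈ s, φ b (z m ω)) ∂P
      = s.card * ∫ x, φ a x * φ b x ∂γ := by
  have hL : ∀ m a, MemLp (fun ω ↦ φ a (z m ω)) 2 P := fun m a ↦ memLp_comp_hasLaw (hz m) (hφ2 a)
  have hint : ∀ m m', Integrable (fun ω ↦ φ a (z m ω) * φ b (z m' ω)) P :=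
    fun m m' ↦ (hL m a).integrable_mul (hL m' b)
  have hval : ∀ m m', ∫ ω, φ a (z m ω) * φ b (z m' ω) ∂P
      = if m = m' then ∫ x, φ a x * φ b x ∂γ else 0 := by
    intro m m'
    split_ifs with h
    · subst h
      exact integral_comp_hasLaw (hz m) (f := fun x ↦ φ a x * φ b x) ((hφm a).mul (hφm b))
    · have hI : IndepFun (fun ω ↦ φ a (z m ω)) (fun ω ↦ φ b (z m' ω)) P :=
        (hind.indepFun h).comp (hφm a) (hφm b)
      rw [hI.integral_fun_mul_eq_mul_integral (hL m a).aestronglyMeasurable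
        (hL m' b).aestronglyMeasurable, integral_comp_hasLaw (hz m) (hφm a), hφ0, zero_mul]
  simp_rw [Finset.sum_mul_sum]
  rw [integral_finsetSum _ fun m _ ↦ integrable_finsetSum _ fun m' _ ↦ hint m m']
  simp_rw [integral_finsetSum s fun m' _ ↦ hint _ m', hval]
  simp

lemma memLp_sum_comp (hz : ∀ m, HasLaw (z m) γ P) (hφ2 : ∀ a, MemLp (φ a) 2 γ)
    (s : Finset (Fin N)) (a : κ) : MemLp (fun ω ↦ ∑ m ∈ s, φ a (z m ω)) 2 P :=
  memLp_finsetSum s fun m _ ↦ memLp_comp_hasLaw (hz m) (hφ2 a)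

/-- The two functions read disjoint sets of observations. This is where leaving out observation `n`
pays off. -/
lemma indepFun_mul_sum_mul_sum (hz : ∀ m, HasLaw (z m) γ P) (hind : iIndepFun z P)
    (hφm : ∀ a, Measurable (φ a)) (hqm : ∀ a, Measurable (q a))
    {s : Finset (Fin N)} {n : Fin N} (hn : n ∉ s) (a b : κ) :
    IndepFun (fun ω ↦ q a (z n ω) * q b (z n ω))
      (fun ω ↦ (∑ m ∈ s, φ a (z m ω)) * (∑ m ∈ s, φ b (z m ω))) P := by
  have h := hind.indepFun_finset₀ {n} s (by simpa using hn) fun m ↦ (hz m).aemeasurable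
  have h1 : Measurable fun x : ({n} : Finset (Fin N)) → E ↦
      q a (x ⟨n, by simp⟩) * q b (x ⟨n, by simp⟩) :=
    ((hqm a).comp (measurable_pi_apply _)).mul ((hqm b).comp (measurable_pi_apply _))
  have h2 : ∀ a, Measurable fun x : s → E ↦ ∑ m : s, φ a (x m) := fun a ↦
    Finset.measurable_sum _ fun m _ ↦ (hφm a).comp (measurable_pi_apply m)
  have := h.comp h1 ((h2 a).mul (h2 b))
  convert! this using 1
  ext ω
  simp only [Function.comp_apply, Pi.mul_apply, Finset.univ_eq_attach]
  rw [Finset.sum_attach s fun m ↦ φ a (z m ω), Finset.sum_attach s fun m ↦ φ b (z m ω)]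

/-- Second moment of a linear statistic of an independent sum, with coefficients that depend on
an observation left out of the sum. -/
lemma integral_sq_sum_mul_sum (hz : ∀ m, HasLaw (z m) γ P) (hind : iIndepFun z P)
    (hφm : ∀ a, Measurable (φ a)) (hφ2 : ∀ a, MemLp (φ a) 2 γ) (hφ0 : ∀ a, ∫ x, φ a x ∂γ = 0)
    (hqm : ∀ a, Measurable (q a)) (hq2 : ∀ a, MemLp (q a) 2 γ)
    {s : Finset (Fin N)} {n : Fin N} (hn : n ∉ s) :
    Integrable (fun ω ↦ (∑ a, q a (z n ω) * ∑ m ∈ s, φ a (z m ω)) ^ 2) P ∧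
    ∫ ω, (∑ a, q a (z n ω) * ∑ m ∈ s, φ a (z m ω)) ^ 2 ∂P
      = s.card * ∑ a, ∑ b, (∫ x, q a x * q b x ∂γ) * ∫ x, φ a x * φ b x ∂γ := by
  have hqi : ∀ a b, Integrable (fun ω ↦ q a (z n ω) * q b (z n ω)) P := fun a b ↦
    (memLp_comp_hasLaw (hz n) (hq2 a)).integrable_mul (memLp_comp_hasLaw (hz n) (hq2 b))
  have hφi : ∀ a b, Integrable (fun ω ↦ (∑ m ∈ s, φ a (z m ω)) * (∑ m ∈ s, φ b (z m ω))) P :=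
    fun a b ↦ (memLp_sum_comp hz hφ2 s a).integrable_mul (memLp_sum_comp hz hφ2 s b)
  have hI := fun a b ↦ indepFun_mul_sum_mul_sum hz hind hφm hqm hn a b
  have hint : ∀ a b, Integrable (fun ω ↦ (q a (z n ω) * q b (z n ω))
      * ((∑ m ∈ s, φ a (z m ω)) * (∑ m ∈ s, φ b (z m ω)))) P := fun a b ↦
    (hI a b).integrable_mul (hqi a b) (hφi a b)
  have e : (fun ω ↦ (∑ a, q a (z n ω) * ∑ m ∈ s, φ a (z m ω)) ^ 2)
      = fun ω ↦ ∑ a, ∑ b, (q a (z n ω) * q b (z n ω))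
      * ((∑ m ∈ s, φ a (z m ω)) * (∑ m ∈ s, φ b (z m ω))) := by
    ext ω
    rw [sq, Finset.sum_mul_sum]
    refine Finset.sum_congr rfl fun a _ ↦ Finset.sum_congr rfl fun b _ ↦ by ring
  rw [e]
  refine ⟨integrable_finsetSum _ fun a _ ↦ integrable_finsetSum _ fun b _ ↦ hint a b, ?_⟩
  rw [integral_finsetSum _ fun a _ ↦ integrable_finsetSum _ fun b _ ↦ hint a b, Finset.mul_sum]
  refine Finset.sum_congr rfl fun a _ ↦ ?_
  rw [integral_finsetSum _ fun b _ ↦ hint a b, Finset.mul_sum]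
  refine Finset.sum_congr rfl fun b _ ↦ ?_
  rw [(hI a b).integral_fun_mul_eq_mul_integral (hqi a b).aestronglyMeasurable
    (hφi a b).aestronglyMeasurable, integral_sum_mul_sum hz hind hφm hφ2 hφ0,
    integral_comp_hasLaw (hz n) (f := fun x ↦ q a x * q b x) ((hqm a).mul (hqm b))]
  ring

end IndependentSums

-- Chebyshev bounds for linear statistics of a standard Gaussian sample.

section StdGaussianSample

variable {ι : Type*} [Fintype ι] [DecidableEq ι]

local notation "γ" => stdGaussian (EuclideanSpace ℝ ι)

lemma memLp_coord_mul (i j : ι) : MemLp (fun x : EuclideanSpace ℝ ι ↦ x i * x j) 2 γ := by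
  have h := fun i : ι ↦ memLp_coord (HasLaw.id (μ := γ)) i 4 (by simp)
  have : ENNReal.HolderTriple 4 4 2 := ⟨by
    rw [← ENNReal.toReal_eq_toReal_iff' (by simp) (by simp)]
    rw [ENNReal.toReal_add (by simp) (by simp)]
    norm_num⟩
  exact (h j).mul (h i)

lemma integrable_coord_mul_four (i j k l : ι) :
    Integrable (fun x : EuclideanSpace ℝ ι ↦ (x i * x j) * (x k * x l)) γ :=
  (memLp_coord_mul i j).integrable_mul (memLp_coord_mul k l)

/-- Centered products of two coordinates. -/
def centeredProd (a : ι × ι) (x : EuclideanSpace ℝ ι) : ℝ :=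
  x a.1 * x a.2 - (1 : Matrix ι ι ℝ) a.1 a.2

lemma measurable_centeredProd (a : ι × ι) : Measurable (centeredProd a) := by
  unfold centeredProd; fun_prop

lemma memLp_centeredProd (a : ι × ι) : MemLp (centeredProd a) 2 γ :=
  (memLp_coord_mul a.1 a.2).sub (memLp_const _)

lemma integral_centeredProd (a : ι × ι) : ∫ x, centeredProd a x ∂γ = 0 := by
  unfold centeredProd
  rw [integral_sub ((memLp_coord_mul a.1 a.2).integrable (by norm_num)) (integrable_const _)]
  have := integral_coord_mul (HasLaw.id (μ := γ)) a.1 a.2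
  simp only [id] at this
  rw [this]
  simp

/-- Centering removes the pairing `(i j)(k l)` from Isserlis' formula; the two cross pairings
remain. -/
lemma integral_centeredProd_mul (i j k l : ι) :
    ∫ x, centeredProd (i, j) x * centeredProd (k, l) x ∂γ
      = (1 : Matrix ι ι ℝ) i k * (1 : Matrix ι ι ℝ) j l
        + (1 : Matrix ι ι ℝ) i l * (1 : Matrix ι ι ℝ) j k := by
  have h4 := integral_coord_mul_four (HasLaw.id (μ := γ)) i j k l
  have h2 := fun i j ↦ integral_coord_mul (HasLaw.id (μ := γ)) i j
  simp only [id] at h4 h2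
  have hi := fun i j : ι ↦ (memLp_coord_mul i j).integrable (by norm_num)
  have e : (fun x : EuclideanSpace ℝ ι ↦ centeredProd (i, j) x * centeredProd (k, l) x)
      = fun x ↦ ((x i * x j) * (x k * x l) - (1 : Matrix ι ι ℝ) k l * (x i * x j))
        - ((1 : Matrix ι ι ℝ) i j * (x k * x l)
          - (1 : Matrix ι ι ℝ) i j * (1 : Matrix ι ι ℝ) k l) := by
    ext x; simp only [centeredProd]; ring
  rw [e, integral_sub, integral_sub, integral_sub, integral_const_mul, integral_const_mul,
    h4, h2, h2]
  · simp; ring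
  · exact (hi k l).const_mul _
  · exact integrable_const _
  · exact integrable_coord_mul_four i j k l
  · exact (hi i j).const_mul _
  · exact (integrable_coord_mul_four i j k l).sub ((hi i j).const_mul _)
  · exact ((hi k l).const_mul _).sub (integrable_const _)

variable {Ω : Type*} [MeasurableSpace Ω] {P : Measure Ω} [IsProbabilityMeasure P]
  {N : ℕ} {z : Fin N → Ω → EuclideanSpace ℝ ι}

lemma measure_lt_abs_sum_centeredProd (hz : ∀ m, HasLaw (z m) γ P) (hind : iIndepFun z P)
    (hN : 0 < N) (a : ι × ι) {t : ℝ} (ht : 0 < t) :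
    P {ω | t * √N < |∑ m, centeredProd a (z m ω)|} ≤ ENNReal.ofReal (2 / t ^ 2) := by
  have h := integral_sum_mul_sum hz hind measurable_centeredProd memLp_centeredProd
    integral_centeredProd Finset.univ a a
  have hi := (memLp_sum_comp hz memLp_centeredProd Finset.univ a).integrable_sq
  have hN' : (0 : ℝ) < N := by exact_mod_cast hN
  have hle : ∫ x, centeredProd a x * centeredProd a x ∂γ ≤ 2 := by
    rw [show a = (a.1, a.2) from rfl, integral_centeredProd_mul]
    simp only [Matrix.one_apply]
    split_ifs <;> norm_num
  have := measure_lt_abs_le_of_integral_sq (t := t * √N) (s := 2 * N) hi (by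
    simp only [sq]
    rw [h, Finset.card_univ, Fintype.card_fin]
    nlinarith) (by positivity)
  refine this.trans (ENNReal.ofReal_le_ofReal (le_of_eq ?_))
  rw [mul_pow, Real.sq_sqrt hN'.le]
  field_simp

lemma measure_lt_abs_sum_coord (hz : ∀ m, HasLaw (z m) γ P) (hind : iIndepFun z P)
    (hN : 0 < N) (i : ι) {t : ℝ} (ht : 0 < t) :
    P {ω | t * √N < |∑ m, z m ω i|} ≤ ENNReal.ofReal (1 / t ^ 2) := by
  have h2 : ∀ i : ι, MemLp (fun x : EuclideanSpace ℝ ι ↦ x i) 2 γ := fun i ↦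
    memLp_coord (HasLaw.id (μ := γ)) i 2 (by simp)
  have h := integral_sum_mul_sum (φ := fun (i : ι) (x : EuclideanSpace ℝ ι) ↦ x i) hz hind
    (fun i ↦ by fun_prop) h2
    (fun i ↦ integral_coord (HasLaw.id (μ := γ)) i) Finset.univ i i
  have hi := (memLp_sum_comp (φ := fun (i : ι) (x : EuclideanSpace ℝ ι) ↦ x i) hz h2
    Finset.univ i).integrable_sq
  have hN' : (0 : ℝ) < N := by exact_mod_cast hN
  have hm := integral_coord_mul (HasLaw.id (μ := γ)) i i
  simp only [id] at hm
  have := measure_lt_abs_le_of_integral_sq (t := t * √N) (s := N) hi (by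
    simp only [sq]
    rw [h, Finset.card_univ, Fintype.card_fin, hm]
    simp) (by positivity)
  refine this.trans (ENNReal.ofReal_le_ofReal (le_of_eq ?_))
  rw [mul_pow, Real.sq_sqrt hN'.le]
  field_simp

lemma measure_lt_abs_coord (hz : ∀ m, HasLaw (z m) γ P) (n : Fin N) (i : ι) {t : ℝ}
    (ht : 0 < t) : P {ω | t < |z n ω i|} ≤ ENNReal.ofReal (1 / t ^ 2) := by
  have h2 := memLp_coord (hz n) i 2 (by simp)
  refine measure_lt_abs_le_of_integral_sq h2.integrable_sq ?_ ht
  have := integral_coord_mul (hz n) i i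
  simp only [sq]
  rw [this]
  simp

lemma card_erase_le (n : Fin N) : ((Finset.univ.erase n).card : ℝ) ≤ N := by
  exact_mod_cast (Finset.card_le_univ _).trans_eq (Fintype.card_fin N)

/-- A linear statistic of the leave-one-out mean, with the left-out observation as its
coefficients, is of order `√(dim) * √N`. -/
lemma measure_lt_abs_sum_coord_mul (hz : ∀ m, HasLaw (z m) γ P) (hind : iIndepFun z P)
    (hN : 0 < N) (n : Fin N) {K b : ℝ} (hK : 0 < K) (hb : 0 < b)
    (hcard : (Fintype.card ι : ℝ) ≤ b ^ 2) :
    P {ω | K * b * √N < |∑ i, z n ω i * ∑ m ∈ Finset.univ.erase n, z m ω i|}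
      ≤ ENNReal.ofReal (1 / K ^ 2) := by
  have h2 : ∀ i : ι, MemLp (fun x : EuclideanSpace ℝ ι ↦ x i) 2 γ := fun i ↦
    memLp_coord (HasLaw.id (μ := γ)) i 2 (by simp)
  have hm : ∀ i : ι, Measurable (fun x : EuclideanSpace ℝ ι ↦ x i) := fun i ↦ by fun_prop
  obtain ⟨h1, h3⟩ := integral_sq_sum_mul_sum (φ := fun (i : ι) (x : EuclideanSpace ℝ ι) ↦ x i)
    (q := fun (i : ι) (x : EuclideanSpace ℝ ι) ↦ x i) hz hind hm h2
    (fun i ↦ integral_coord (HasLaw.id (μ := γ)) i) hm h2 (Finset.notMem_erase n Finset.univ)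
  have hN' : (0 : ℝ) < N := by exact_mod_cast hN
  have hmm := fun i j ↦ integral_coord_mul (HasLaw.id (μ := γ)) i j
  simp only [id] at hmm
  -- Coefficients and summands both have identity covariance, so the double sum counts the
  -- coordinates.
  have hval : ∑ i : ι, ∑ j : ι, (∫ x : EuclideanSpace ℝ ι, x i * x j ∂γ) *
      ∫ x : EuclideanSpace ℝ ι, x i * x j ∂γ = Fintype.card ι := by
    simp [hmm, Matrix.one_apply]
  rw [hval] at h3
  have := measure_lt_abs_le_of_integral_sq (t := K * b * √N) (s := N * b ^ 2) h1 (by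
    rw [h3]
    have := card_erase_le n
    gcongr) (by positivity)
  refine this.trans (ENNReal.ofReal_le_ofReal (le_of_eq ?_))
  rw [mul_pow, Real.sq_sqrt hN'.le, mul_pow]
  field_simp

/-- A linear statistic of the leave-one-out second moments, whose coefficients `q` are functions
of the left-out observation, is of order `b * √N` if the mean square of the Frobenius norm of `q`
is at most `b ^ 2`. -/
lemma measure_lt_abs_sum_mul_centeredProd (hz : ∀ m, HasLaw (z m) γ P) (hind : iIndepFun z P)
    (hN : 0 < N) (n : Fin N) {q : ι × ι → EuclideanSpace ℝ ι → ℝ}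
    (hqm : ∀ a, Measurable (q a)) (hq2 : ∀ a, MemLp (q a) 2 γ)
    (hqs : ∀ i j x, q (i, j) x = q (j, i) x) {K b : ℝ} (hK : 0 < K) (hb : 0 < b)
    (hqb : ∑ a, ∫ x, q a x ^ 2 ∂γ ≤ b ^ 2) :
    P {ω | K * b * √N < |∑ a, q a (z n ω) *
        ∑ m ∈ Finset.univ.erase n, centeredProd a (z m ω)|}
      ≤ ENNReal.ofReal (2 / K ^ 2) := by
  obtain ⟨h1, h3⟩ := integral_sq_sum_mul_sum hz hind measurable_centeredProd memLp_centeredProd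
    integral_centeredProd hqm hq2 (Finset.notMem_erase n Finset.univ)
  have hN' : (0 : ℝ) < N := by exact_mod_cast hN
  -- Each of the two cross pairings contributes the mean squared Frobenius norm of `q`; the second
  -- does so by the symmetry `hqs`.
  have hval : ∑ a : ι × ι, ∑ b : ι × ι, (∫ x, q a x * q b x ∂γ) *
      ∫ x, centeredProd a x * centeredProd b x ∂γ = 2 * ∑ a, ∫ x, q a x ^ 2 ∂γ := by
    rw [Finset.mul_sum]
    refine Finset.sum_congr rfl fun a _ ↦ ?_
    obtain ⟨i, j⟩ := a
    simp only [Fintype.sum_prod_type, integral_centeredProd_mul, mul_add, Finset.sum_add_distrib,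
      Matrix.one_apply]
    simp [hqs j i, sq, two_mul]
  rw [hval] at h3
  have := measure_lt_abs_le_of_integral_sq (t := K * b * √N) (s := N * (2 * b ^ 2)) h1 (by
    rw [h3]
    have := card_erase_le n
    gcongr) (by positivity)
  refine this.trans (ENNReal.ofReal_le_ofReal (le_of_eq ?_))
  rw [mul_pow, Real.sq_sqrt hN'.le, mul_pow]
  field_simp

end StdGaussianSample

-- The high-probability event and the leave-one-out leading terms.

section ControlledSamples

variable {ι : Type*} [Fintype ι] [DecidableEq ι] {N : ℕ}

/-- Deviation of the uncentered sample second moment from the identity. -/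
def secondDev (z : Fin N → ι → ℝ) : Matrix ι ι ℝ :=
  (N : ℝ)⁻¹ • ∑ m, Matrix.vecMulVec (z m) (z m) - 1

/-- The first two sample moments of `z` are within `t / √N` of those of a standard Gaussian vector
and observation `n` is bounded by `t`. -/
structure IsControlled (z : Fin N → ι → ℝ) (n : Fin N) (t : ℝ) : Prop where
  dev : ∀ i j, |secondDev z i j| ≤ t / √N
  mean : ∀ i, |vecMean z i| ≤ t / √N
  obs : ∀ i, |z n i| ≤ t

lemma secondDev_apply (hN : 0 < N) (z : Fin N → EuclideanSpace ℝ ι) (i j : ι) :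
    secondDev (fun m ↦ (z m).ofLp) i j = (N : ℝ)⁻¹ * ∑ m, centeredProd (i, j) (z m) := by
  have hN' : (N : ℝ) ≠ 0 := by positivity
  simp only [secondDev, centeredProd, Matrix.sub_apply, Matrix.smul_apply, Matrix.sum_apply,
    Matrix.vecMulVec_apply, smul_eq_mul, Finset.sum_sub_distrib, Finset.sum_const,
    Finset.card_univ, Fintype.card_fin, nsmul_eq_mul, mul_sub]
  rw [inv_mul_cancel_left₀ hN']

lemma vecMean_apply {κ : Type*} (z : Fin N → κ → ℝ) (i : κ) :
    vecMean z i = (N : ℝ)⁻¹ * ∑ m, z m i := by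
  simp [vecMean]

lemma lt_abs_inv_mul_iff (hN : 0 < N) (t x : ℝ) :
    t / √N < |(N : ℝ)⁻¹ * x| ↔ t * √N < |x| := by
  have hN' : (0 : ℝ) < N := by exact_mod_cast hN
  have hs : (√(N : ℝ)) * √N = N := Real.mul_self_sqrt hN'.le
  have hs0 : 0 < √(N : ℝ) := Real.sqrt_pos.2 hN'
  have e : t / √N * N = t * √N := by
    rw [div_mul_eq_mul_div, div_eq_iff hs0.ne', mul_assoc, hs]
  rw [abs_mul, abs_of_pos (inv_pos.2 hN'), ← div_eq_inv_mul, lt_div_iff₀ hN', e]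

/-- A union bound over all entries. The resulting `t` grows with the dimension, which is harmless
because it enters only remainders and thresholds on `N`. -/
lemma exists_forall_isControlled (ι : Type*) [Fintype ι] [DecidableEq ι] {ε : ℝ} (hε : 0 < ε) :
    ∃ t : ℝ, 1 ≤ t ∧ ∀ (N : ℕ), 0 < N → ∀ {Ω : Type*} [MeasurableSpace Ω] (P : Measure Ω)
      [IsProbabilityMeasure P] (z : Fin N → Ω → EuclideanSpace ℝ ι),
      (∀ m, HasLaw (z m) (stdGaussian (EuclideanSpace ℝ ι)) P) → iIndepFun z P → ∀ n : Fin N,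
      P {ω | ¬ IsControlled (fun m ↦ (z m ω).ofLp) n t} ≤ ENNReal.ofReal ε := by
  set d : ℝ := (Fintype.card ι : ℝ) with hd
  have hd0 : 0 ≤ d := by positivity
  -- The union bound totals `(2 d² + 2 d) / t²`; this `t` makes the numerator `ε (t - 1)`, which is
  -- at most `ε t²`.
  set t : ℝ := 1 + (2 * d ^ 2 + 2 * d) / ε with ht
  have hdiv : 0 ≤ (2 * d ^ 2 + 2 * d) / ε := by positivity
  have ht1 : 1 ≤ t := by linarith
  have ht0 : 0 < t := by linarith
  refine ⟨t, ht1, fun N hN Ω _ P _ z hz hind n ↦ ?_⟩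
  have hsub : {ω | ¬ IsControlled (fun m ↦ (z m ω).ofLp) n t} ⊆
      (⋃ a : ι × ι, {ω | t * √N < |∑ m, centeredProd a (z m ω)|}) ∪
      ((⋃ i : ι, {ω | t * √N < |∑ m, z m ω i|}) ∪ ⋃ i : ι, {ω | t < |z n ω i|}) := by
    intro ω hω
    by_contra hcon
    simp only [Set.mem_union, Set.mem_iUnion, Set.mem_ofPred_eq, not_or, not_exists,
      not_lt] at hcon
    refine hω ⟨fun i j ↦ ?_, fun i ↦ ?_, hcon.2.2⟩
    · rw [secondDev_apply hN]
      exact not_lt.1 fun h ↦ not_lt.2 (hcon.1 (i, j)) ((lt_abs_inv_mul_iff hN _ _).1 h)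
    · rw [vecMean_apply]
      exact not_lt.1 fun h ↦ not_lt.2 (hcon.2.1 i) ((lt_abs_inv_mul_iff hN _ _).1 h)
  have h1 : P (⋃ a : ι × ι, {ω | t * √N < |∑ m, centeredProd a (z m ω)|})
      ≤ ENNReal.ofReal (d ^ 2 * (2 / t ^ 2)) := by
    refine (measure_iUnion_fintype_le _ _).trans
      ((Finset.sum_le_sum fun a _ ↦ measure_lt_abs_sum_centeredProd hz hind hN a ht0).trans_eq ?_)
    rw [← ENNReal.ofReal_sum_of_nonneg fun _ _ ↦ by positivity]
    simp [hd, sq]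
  have h2 : P (⋃ i : ι, {ω | t * √N < |∑ m, z m ω i|}) ≤ ENNReal.ofReal (d * (1 / t ^ 2)) := by
    refine (measure_iUnion_fintype_le _ _).trans
      ((Finset.sum_le_sum fun a _ ↦ measure_lt_abs_sum_coord hz hind hN a ht0).trans_eq ?_)
    rw [← ENNReal.ofReal_sum_of_nonneg fun _ _ ↦ by positivity]
    simp [hd]
  have h3 : P (⋃ i : ι, {ω | t < |z n ω i|}) ≤ ENNReal.ofReal (d * (1 / t ^ 2)) := by
    refine (measure_iUnion_fintype_le _ _).trans
      ((Finset.sum_le_sum fun a _ ↦ measure_lt_abs_coord hz n a ht0).trans_eq ?_)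
    rw [← ENNReal.ofReal_sum_of_nonneg fun _ _ ↦ by positivity]
    simp [hd]
  refine (measure_mono hsub).trans ((measure_union_le _ _).trans
    ((add_le_add h1 ((measure_union_le _ _).trans (add_le_add h2 h3))).trans ?_))
  rw [← ENNReal.ofReal_add (by positivity) (by positivity),
    ← ENNReal.ofReal_add (by positivity) (by positivity)]
  apply ENNReal.ofReal_le_ofReal
  have e : d ^ 2 * (2 / t ^ 2) + (d * (1 / t ^ 2) + d * (1 / t ^ 2))
      = (2 * d ^ 2 + 2 * d) / t ^ 2 := by ring
  rw [e, div_le_iff₀ (by positivity)]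
  have h4 : 2 * d ^ 2 + 2 * d = ε * (t - 1) := by rw [ht]; field_simp; ring
  rw [h4]
  have : t - 1 ≤ t ^ 2 := by nlinarith
  gcongr

lemma exists_bound_of_continuous {f : EuclideanSpace ℝ ι → ℝ} (hf : Continuous f) (t : ℝ) :
    ∃ C : ℝ, 0 ≤ C ∧ ∀ x : EuclideanSpace ℝ ι, (∀ i, |x i| ≤ t) → |f x| ≤ C := by
  obtain ⟨C, hC⟩ := (isCompact_closedBall (0 : EuclideanSpace ℝ ι)
    (√(∑ _i : ι, t ^ 2))).exists_bound_of_continuousOn hf.continuousOn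
  refine ⟨max C 0, le_max_right _ _, fun x hx ↦ (hC x ?_).trans (le_max_left _ _)⟩
  rw [mem_closedBall_zero_iff, EuclideanSpace.norm_eq]
  refine Real.sqrt_le_sqrt (Finset.sum_le_sum fun i _ ↦ ?_)
  exact pow_le_pow_left₀ (norm_nonneg _) (hx i) 2

/-- Isolates the contribution of observation `n` to its own distance, the only part not independent
of the coefficients. -/
lemma sum_mul_sum_eq_erase {κ : Type*} [Fintype κ] (n : Fin N) (w : κ → ℝ)
    (f : κ → Fin N → ℝ) :
    ∑ a, w a * ((N : ℝ)⁻¹ * ∑ m, f a m)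
      = (N : ℝ)⁻¹ * (∑ a, w a * ∑ m ∈ Finset.univ.erase n, f a m)
        + (N : ℝ)⁻¹ * ∑ a, w a * f a n := by
  rw [← mul_add, ← Finset.sum_add_distrib, Finset.mul_sum]
  refine Finset.sum_congr rfl fun a _ ↦ ?_
  rw [← Finset.sum_erase_add _ _ (Finset.mem_univ n)]
  ring

/-- On the controlled event the self-term of observation `n` is a continuous function on a bounded
set, divided by `N`; it accounts for `C / N`. The leave-one-out sum accounts for `K * b / √N`. -/
lemma exists_measure_lt_abs_secondDev_le {q : ι × ι → EuclideanSpace ℝ ι → ℝ}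
    (hqc : ∀ a, Continuous (q a))
    (hq2 : ∀ a, MemLp (q a) 2 (stdGaussian (EuclideanSpace ℝ ι)))
    (hqs : ∀ i j x, q (i, j) x = q (j, i) x) {b : ℝ} (hb : 0 < b)
    (hqb : ∑ a, ∫ x, q a x ^ 2 ∂(stdGaussian (EuclideanSpace ℝ ι)) ≤ b ^ 2) (t : ℝ) :
    ∃ C : ℝ, 0 ≤ C ∧ ∀ (N : ℕ), 0 < N → ∀ {Ω : Type*} [MeasurableSpace Ω] (P : Measure Ω)
      [IsProbabilityMeasure P] (z : Fin N → Ω → EuclideanSpace ℝ ι),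
      (∀ m, HasLaw (z m) (stdGaussian (EuclideanSpace ℝ ι)) P) → iIndepFun z P → ∀ n : Fin N,
      ∀ K : ℝ, 0 < K →
      P {ω | IsControlled (fun m ↦ (z m ω).ofLp) n t ∧ K * b / √N + C / N
        < |∑ a, q a (z n ω) * secondDev (fun m ↦ (z m ω).ofLp) a.1 a.2|}
        ≤ ENNReal.ofReal (2 / K ^ 2) := by
  obtain ⟨C, hC0, hC⟩ := exists_bound_of_continuous
    (f := fun x : EuclideanSpace ℝ ι ↦ ∑ a, q a x * centeredProd a x) (by
      unfold centeredProd; fun_prop) t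
  refine ⟨C, hC0, fun N hN Ω _ P _ z hz hind n K hK ↦ ?_⟩
  refine (measure_mono ?_).trans (measure_lt_abs_sum_mul_centeredProd hz hind hN n
    (fun a ↦ (hqc a).measurable) hq2 hqs hK hb hqb)
  rintro ω ⟨hω, hlt⟩
  rw [Set.mem_ofPred_eq, ← lt_abs_inv_mul_iff hN]
  have hself := hC (z n ω) hω.obs
  simp_rw [secondDev_apply hN] at hlt
  rw [sum_mul_sum_eq_erase n] at hlt
  have h1 : |(N : ℝ)⁻¹ * ∑ a, q a (z n ω) * centeredProd a (z n ω)| ≤ C / N := by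
    rw [abs_mul, abs_of_nonneg (by positivity), div_eq_inv_mul]
    gcongr
  have h2 := hlt.trans_le (abs_add_le _ _)
  linarith

lemma exists_measure_lt_abs_vecMean_le {b : ℝ} (hb : 0 < b)
    (hcard : (Fintype.card ι : ℝ) ≤ b ^ 2) (t : ℝ) :
    ∃ C : ℝ, 0 ≤ C ∧ ∀ (N : ℕ), 0 < N → ∀ {Ω : Type*} [MeasurableSpace Ω] (P : Measure Ω)
      [IsProbabilityMeasure P] (z : Fin N → Ω → EuclideanSpace ℝ ι),
      (∀ m, HasLaw (z m) (stdGaussian (EuclideanSpace ℝ ι)) P) → iIndepFun z P → ∀ n : Fin N,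
      ∀ K : ℝ, 0 < K →
      P {ω | IsControlled (fun m ↦ (z m ω).ofLp) n t ∧ K * b / √N + C / N
        < |∑ i, z n ω i * vecMean (fun m ↦ (z m ω).ofLp) i|}
        ≤ ENNReal.ofReal (1 / K ^ 2) := by
  obtain ⟨C, hC0, hC⟩ := exists_bound_of_continuous
    (f := fun x : EuclideanSpace ℝ ι ↦ ∑ i, x i * x i) (by fun_prop) t
  refine ⟨C, hC0, fun N hN Ω _ P _ z hz hind n K hK ↦ ?_⟩
  refine (measure_mono ?_).trans (measure_lt_abs_sum_coord_mul hz hind hN n hK hb hcard)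
  rintro ω ⟨hω, hlt⟩
  rw [Set.mem_ofPred_eq, ← lt_abs_inv_mul_iff hN]
  have hself := hC (z n ω) hω.obs
  simp_rw [vecMean_apply] at hlt
  rw [sum_mul_sum_eq_erase n] at hlt
  have h1 : |(N : ℝ)⁻¹ * ∑ i, z n ω i * z n ω i| ≤ C / N := by
    rw [abs_mul, abs_of_nonneg (by positivity), div_eq_inv_mul]
    gcongr
  have h2 := hlt.trans_le (abs_add_le _ _)
  linarith

end ControlledSamples

-- Operator-norm estimates and inverses near the identity.

section MatrixNorm

open scoped Matrix.Norms.L2Operator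

variable {ι : Type*} [Fintype ι] [DecidableEq ι]

lemma abs_dotProduct_mulVec_le (A : Matrix ι ι ℝ) (u v : ι → ℝ) :
    |u ⬝ᵥ (A *ᵥ v)| ≤ ‖A‖ * (‖WithLp.toLp 2 u‖ * ‖WithLp.toLp 2 v‖) := by
  have h1 : u ⬝ᵥ (A *ᵥ v) = ⟪WithLp.toLp 2 u, WithLp.toLp 2 (A *ᵥ v)⟫ := by
    rw [PiLp.inner_apply]
    simp [dotProduct, mul_comm]
  rw [h1]
  refine (abs_real_inner_le_norm _ _).trans ?_
  have h2 := Matrix.l2_opNorm_mulVec A (WithLp.toLp 2 v)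
  have h3 : ‖WithLp.toLp 2 (A *ᵥ v)‖ ≤ ‖A‖ * ‖WithLp.toLp 2 v‖ := h2
  calc _ ≤ ‖WithLp.toLp 2 u‖ * (‖A‖ * ‖WithLp.toLp 2 v‖) := by gcongr
    _ = _ := by ring

lemma abs_dotProduct_le (u v : ι → ℝ) :
    |u ⬝ᵥ v| ≤ ‖WithLp.toLp 2 u‖ * ‖WithLp.toLp 2 v‖ := by
  have h1 : u ⬝ᵥ v = ⟪WithLp.toLp 2 u, WithLp.toLp 2 v⟫ := by
    rw [PiLp.inner_apply]
    simp [dotProduct, mul_comm]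
  rw [h1]
  exact abs_real_inner_le_norm _ _

lemma abs_entry_le_norm (A : Matrix ι ι ℝ) (i j : ι) : |A i j| ≤ ‖A‖ := by
  have := abs_dotProduct_mulVec_le A (Pi.single i 1) (Pi.single j 1)
  simpa using this

lemma norm_toLp_le {u : ι → ℝ} {s : ℝ} (hu : ∀ i, |u i| ≤ s) :
    ‖WithLp.toLp 2 u‖ ≤ Fintype.card ι * s := by
  have h : WithLp.toLp 2 u = ∑ i, u i • EuclideanSpace.single i (1 : ℝ) := by
    ext j
    simp [Pi.single_apply]
  rw [h]
  refine (norm_sum_le _ _).trans ?_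
  calc _ ≤ ∑ _i : ι, s := by
        refine Finset.sum_le_sum fun i _ ↦ ?_
        rw [norm_smul]
        simpa using hu i
    _ = _ := by simp

/-- The constant is crude and depends on the dimension; it is used only for remainders. -/
lemma exists_norm_le_of_entries (ι : Type*) [Fintype ι] [DecidableEq ι] :
    ∃ C : ℝ, 0 ≤ C ∧ ∀ (A : Matrix ι ι ℝ) (s : ℝ), (∀ i j, |A i j| ≤ s) → ‖A‖ ≤ C * s := by
  refine ⟨∑ i : ι, ∑ j : ι, ‖Matrix.single i j (1 : ℝ)‖, by positivity, fun A s hA ↦ ?_⟩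
  conv_lhs => rw [Matrix.matrix_eq_sum_single A]
  rw [Finset.sum_mul]
  refine (norm_sum_le _ _).trans (Finset.sum_le_sum fun i _ ↦ ?_)
  rw [Finset.sum_mul]
  refine (norm_sum_le _ _).trans (Finset.sum_le_sum fun j _ ↦ ?_)
  have : Matrix.single i j (A i j) = A i j • Matrix.single i j (1 : ℝ) := by simp
  rw [this, norm_smul, mul_comm]
  exact mul_le_mul_of_nonneg_left (hA i j) (norm_nonneg _)

lemma posDef_of_norm_sub_one_lt {A : Matrix ι ι ℝ} (hA : Aᵀ = A) (h : ‖A - 1‖ < 1) :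
    A.PosDef := by
  refine Matrix.PosDef.of_dotProduct_mulVec_pos (by
    rw [Matrix.IsHermitian, Matrix.conjTranspose_eq_transpose_of_trivial, hA]) fun x hx ↦ ?_
  have h1 := abs_dotProduct_mulVec_le (A - 1) x x
  have hx' : 0 < ‖WithLp.toLp 2 x‖ := by
    rw [norm_pos_iff]
    simpa using hx
  have h2 : x ⬝ᵥ x = ‖WithLp.toLp 2 x‖ * ‖WithLp.toLp 2 x‖ := by
    rw [← real_inner_self_eq_norm_mul_norm, PiLp.inner_apply]
    simp [dotProduct, sq]
  have h3 : x ⬝ᵥ (A *ᵥ x) = x ⬝ᵥ ((A - 1) *ᵥ x) + x ⬝ᵥ x := by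
    rw [Matrix.sub_mulVec, Matrix.one_mulVec, dotProduct_sub]
    ring
  rw [star_trivial, h3, h2]
  have h4 := neg_abs_le (x ⬝ᵥ ((A - 1) *ᵥ x))
  have h5 : ‖A - 1‖ * (‖WithLp.toLp 2 x‖ * ‖WithLp.toLp 2 x‖)
      < ‖WithLp.toLp 2 x‖ * ‖WithLp.toLp 2 x‖ := by
    have := mul_pos hx' hx'
    nlinarith
  linarith

variable [Nonempty ι]

lemma isUnit_one_add {E : Matrix ι ι ℝ} (hE : ‖E‖ ≤ 1 / 2) : IsUnit (1 + E) := by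
  have := isUnit_one_sub_of_norm_lt_one (x := -E) (by rw [norm_neg]; linarith)
  simpa using this

lemma one_add_mul_inv {E : Matrix ι ι ℝ} (hE : ‖E‖ ≤ 1 / 2) : (1 + E) * (1 + E)⁻¹ = 1 :=
  Matrix.mul_nonsing_inv _ ((Matrix.isUnit_iff_isUnit_det _).1 (isUnit_one_add hE))

lemma inv_add_mul_inv {E : Matrix ι ι ℝ} (hE : ‖E‖ ≤ 1 / 2) :
    (1 + E)⁻¹ + E * (1 + E)⁻¹ = 1 := by
  have h := one_add_mul_inv hE
  rwa [add_mul, one_mul] at h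

/-- From `(1 + E)⁻¹ = 1 - E (1 + E)⁻¹` the norm is at most one plus half of itself. -/
lemma norm_inv_one_add_le {E : Matrix ι ι ℝ} (hE : ‖E‖ ≤ 1 / 2) : ‖(1 + E)⁻¹‖ ≤ 2 := by
  have h1 : (1 + E)⁻¹ = 1 - E * (1 + E)⁻¹ := eq_sub_of_add_eq (inv_add_mul_inv hE)
  have h2 : ‖(1 + E)⁻¹‖ ≤ 1 + ‖E‖ * ‖(1 + E)⁻¹‖ := by
    conv_lhs => rw [h1]
    refine (norm_sub_le _ _).trans ?_
    rw [norm_one]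
    gcongr
    exact norm_mul_le _ _
  nlinarith [norm_nonneg (1 + E)⁻¹]

lemma norm_inv_one_add_sub_one_le {E : Matrix ι ι ℝ} (hE : ‖E‖ ≤ 1 / 2) :
    ‖(1 + E)⁻¹ - 1‖ ≤ 2 * ‖E‖ := by
  have h1 : (1 + E)⁻¹ - 1 = -(E * (1 + E)⁻¹) := by
    rw [sub_eq_iff_eq_add, neg_add_eq_sub]
    exact eq_sub_of_add_eq (inv_add_mul_inv hE)
  rw [h1, norm_neg]
  refine (norm_mul_le _ _).trans ?_
  nlinarith [norm_nonneg E, norm_inv_one_add_le hE]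

/-- The remainder is `-E ((1 + E)⁻¹ - 1)`, a product of two factors of first order. -/
lemma norm_inv_one_add_sub_one_add_le {E : Matrix ι ι ℝ} (hE : ‖E‖ ≤ 1 / 2) :
    ‖(1 + E)⁻¹ - 1 + E‖ ≤ 2 * ‖E‖ ^ 2 := by
  have h1 : (1 + E)⁻¹ - 1 + E = -(E * ((1 + E)⁻¹ - 1)) := by
    have := eq_sub_of_add_eq (inv_add_mul_inv hE)
    rw [mul_sub, mul_one, neg_sub, sub_add_eq_add_sub, sub_eq_iff_eq_add]
    nth_rw 1 [this]
    abel
  rw [h1, norm_neg]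
  refine (norm_mul_le _ _).trans ?_
  have := norm_inv_one_add_sub_one_le hE
  nlinarith [norm_nonneg E]

lemma norm_inv_one_add_sub_inv_one_add_le {E F : Matrix ι ι ℝ} (hE : ‖E‖ ≤ 1 / 2)
    (hF : ‖F‖ ≤ 1 / 2) : ‖(1 + E)⁻¹ - (1 + F)⁻¹‖ ≤ 4 * ‖E - F‖ := by
  have hE' : (1 + E)⁻¹ * (1 + E) = 1 :=
    Matrix.nonsing_inv_mul _ ((Matrix.isUnit_iff_isUnit_det _).1 (isUnit_one_add hE))
  have h1 : (1 + E)⁻¹ - (1 + F)⁻¹ = (1 + E)⁻¹ * (F - E) * (1 + F)⁻¹ := by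
    have : F - E = (1 + F) - (1 + E) := by abel
    rw [this, mul_sub, sub_mul, mul_assoc, one_add_mul_inv hF, hE', one_mul, mul_one]
  rw [h1]
  have h2 : ‖(1 + E)⁻¹ * (F - E) * (1 + F)⁻¹‖ ≤ ‖(1 + E)⁻¹‖ * ‖F - E‖ * ‖(1 + F)⁻¹‖ :=
    (norm_mul_le _ _).trans (by gcongr; exact norm_mul_le _ _)
  rw [norm_sub_rev F E] at h2
  have h3 := norm_inv_one_add_le hE
  have h4 := norm_inv_one_add_le hF
  calc _ ≤ _ := h2
    _ ≤ 2 * ‖E - F‖ * 2 := by gcongr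
    _ = _ := by ring

end MatrixNorm

-- First-order expansion of the vector-based distance.

section VectorExpansion

open scoped Matrix.Norms.L2Operator

variable {ι : Type*} [Fintype ι] [DecidableEq ι] {N : ℕ}

/-- Deviation of the centered sample second moment (normalized by `N`) from the identity. -/
def centeredDev (z : Fin N → ι → ℝ) : Matrix ι ι ℝ :=
  secondDev z - Matrix.vecMulVec (vecMean z) (vecMean z)

lemma sum_vecMulVec_sub_vecMean (hN : 0 < N) (z : Fin N → ι → ℝ) :
    ∑ m, Matrix.vecMulVec (z m - vecMean z) (z m - vecMean z)
      = (N : ℝ) • (1 + centeredDev z) := by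
  have hN' : (N : ℝ) ≠ 0 := by positivity
  ext i j
  have hm : ∀ i, ∑ m, z m i = N * vecMean z i := fun i ↦ by
    rw [vecMean_apply, mul_inv_cancel_left₀ hN']
  simp only [Matrix.sum_apply, Matrix.vecMulVec_apply, Pi.sub_apply, centeredDev, secondDev,
    Matrix.smul_apply, Matrix.add_apply, Matrix.sub_apply, smul_eq_mul, sub_mul, mul_sub,
    Finset.sum_sub_distrib, ← Finset.mul_sum, ← Finset.sum_mul, hm, Finset.sum_const,
    Finset.card_univ, Fintype.card_fin, nsmul_eq_mul, mul_add]
  rw [mul_inv_cancel_left₀ hN']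
  ring

lemma vecCov_eq (hN : 0 < N) (z : Fin N → ι → ℝ) :
    vecCov z = ((N : ℝ) / (N - 1)) • (1 + centeredDev z) := by
  rw [vecCov, sum_vecMulVec_sub_vecMean hN, smul_smul, div_eq_inv_mul]

lemma vecCov_posSemidef (hN : 1 < N) (z : Fin N → ι → ℝ) : (vecCov z).PosSemidef := by
  have hN' : (1 : ℝ) < N := by exact_mod_cast hN
  refine Matrix.PosSemidef.smul (Matrix.posSemidef_sum _ fun m _ ↦ ?_)
    (inv_nonneg.2 (by linarith))
  simpa using Matrix.posSemidef_vecMulVec_self_star (z m - vecMean z)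

lemma norm_vecMulVec_self_entries {y : ι → ℝ} {s : ℝ} (hy : ∀ i, |y i| ≤ s) (i j : ι) :
    |Matrix.vecMulVec y y i j| ≤ s * s := by
  rw [Matrix.vecMulVec_apply, abs_mul]
  exact mul_le_mul (hy i) (hy j) (abs_nonneg _) ((abs_nonneg _).trans (hy i))

lemma IsControlled.centeredDev_le {z : Fin N → ι → ℝ} {n : Fin N} {t : ℝ}
    (h : IsControlled z n t) (hN : 0 < N) (ht : 1 ≤ t) (i j : ι) :
    |centeredDev z i j| ≤ 2 * t ^ 2 / √N := by
  have hs1 : 1 ≤ √(N : ℝ) := by rw [Real.one_le_sqrt]; exact_mod_cast hN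
  have h1 := h.dev i j
  have h2 := norm_vecMulVec_self_entries h.mean i j
  have h3 : t / √N * (t / √N) ≤ t ^ 2 / √N := by
    rw [div_mul_div_comm, ← sq]
    gcongr
    nlinarith
  have h4 : t / √N ≤ t ^ 2 / √N := by gcongr; nlinarith
  rw [centeredDev, Matrix.sub_apply]
  refine (abs_sub _ _).trans ?_
  have : 2 * t ^ 2 / √N = t ^ 2 / √N + t ^ 2 / √N := by ring
  linarith

lemma dotProduct_mulVec_eq_sum (x : ι → ℝ) (A : Matrix ι ι ℝ) :
    x ⬝ᵥ (A *ᵥ x) = ∑ a : ι × ι, (x a.1 * x a.2) * A a.1 a.2 := by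
  rw [Fintype.sum_prod_type]
  simp only [dotProduct, Matrix.mulVec, Finset.mul_sum]
  refine Finset.sum_congr rfl fun i _ ↦ Finset.sum_congr rfl fun j _ ↦ by ring

/-- First-order expansion of a shifted and perturbed quadratic form. -/
lemma abs_quadForm_expansion_le [Nonempty ι] {x y : ι → ℝ} {A : Matrix ι ι ℝ} {X B h : ℝ}
    (hh0 : 0 ≤ h) (hh1 : h ≤ 1)
    (hx : ‖WithLp.toLp 2 x‖ ≤ X) (hy : ‖WithLp.toLp 2 y‖ ≤ X * h)
    (hA : ‖A‖ ≤ B * h) (hD : ‖A - Matrix.vecMulVec y y‖ ≤ B * h) (hB : B * h ≤ 1 / 2) :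
    |(1 - h ^ 2) * ((x - y) ⬝ᵥ ((1 + (A - Matrix.vecMulVec y y))⁻¹ *ᵥ (x - y)))
        - (x ⬝ᵥ x - x ⬝ᵥ (A *ᵥ x) - 2 * (x ⬝ᵥ y))|
      ≤ (8 * B ^ 2 * X ^ 2 + 8 * X ^ 2 + X ^ 2 + 3 * B * X ^ 2 + 4 * X ^ 4) * h ^ 2 := by
  set D := A - Matrix.vecMulVec y y with hDdef
  set w := x - y with hw
  have hX0 : 0 ≤ X := (norm_nonneg _).trans hx
  have hBh0 : 0 ≤ B * h := (norm_nonneg _).trans hA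
  have hwn : ‖WithLp.toLp 2 w‖ ≤ 2 * X := by
    have : WithLp.toLp 2 w = WithLp.toLp 2 x - WithLp.toLp 2 y := rfl
    rw [this]
    refine (norm_sub_le _ _).trans ?_
    nlinarith
  have hDle : ‖D‖ ≤ 1 / 2 := hD.trans hB
  -- Separates the second-order part of the inverse; `e2` and `e3` then rewrite the rest in terms of
  -- `x`, `y` and `A`.
  have e1 : w ⬝ᵥ ((1 + D)⁻¹ *ᵥ w)
      = w ⬝ᵥ (((1 + D)⁻¹ - 1 + D) *ᵥ w) + w ⬝ᵥ w - w ⬝ᵥ (D *ᵥ w) := by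
    simp only [Matrix.add_mulVec, Matrix.sub_mulVec, Matrix.one_mulVec, dotProduct_add,
      dotProduct_sub]
    ring
  have e2 : w ⬝ᵥ w = x ⬝ᵥ x - 2 * (x ⬝ᵥ y) + y ⬝ᵥ y := by
    simp only [hw, sub_dotProduct, dotProduct_sub, dotProduct_comm y x]
    ring
  have e3 : w ⬝ᵥ (D *ᵥ w) = x ⬝ᵥ (A *ᵥ x) - x ⬝ᵥ (A *ᵥ y) - y ⬝ᵥ (A *ᵥ x) + y ⬝ᵥ (A *ᵥ y)
      - (w ⬝ᵥ y) ^ 2 := by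
    have : w ⬝ᵥ (Matrix.vecMulVec y y *ᵥ w) = (w ⬝ᵥ y) ^ 2 := by
      rw [Matrix.vecMulVec_mulVec, sq, dotProduct_comm w y]
      simp [dotProduct_comm]
    rw [hDdef, Matrix.sub_mulVec, dotProduct_sub, this, hw]
    simp only [Matrix.mulVec_sub, dotProduct_sub, sub_dotProduct]
    ring
  have b1 : |w ⬝ᵥ (((1 + D)⁻¹ - 1 + D) *ᵥ w)| ≤ 8 * B ^ 2 * X ^ 2 * h ^ 2 := by
    refine (abs_dotProduct_mulVec_le _ _ _).trans ?_
    have := norm_inv_one_add_sub_one_add_le hDle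
    calc _ ≤ 2 * (B * h) ^ 2 * ((2 * X) * (2 * X)) := by
          refine mul_le_mul (this.trans ?_) ?_ (by positivity) (by positivity)
          · gcongr
          · gcongr
      _ = _ := by ring
  have b2 : |y ⬝ᵥ y| ≤ X ^ 2 * h ^ 2 := by
    refine (abs_dotProduct_le _ _).trans ?_
    calc _ ≤ (X * h) * (X * h) := by gcongr
      _ = _ := by ring
  have b3 : |x ⬝ᵥ (A *ᵥ y)| ≤ B * X ^ 2 * h ^ 2 := by
    refine (abs_dotProduct_mulVec_le _ _ _).trans ?_
    calc _ ≤ (B * h) * (X * (X * h)) := by gcongr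
      _ = _ := by ring
  have b4 : |y ⬝ᵥ (A *ᵥ x)| ≤ B * X ^ 2 * h ^ 2 := by
    refine (abs_dotProduct_mulVec_le _ _ _).trans ?_
    calc _ ≤ (B * h) * ((X * h) * X) := by gcongr
      _ = _ := by ring
  have b5 : |y ⬝ᵥ (A *ᵥ y)| ≤ B * X ^ 2 * h ^ 2 := by
    refine (abs_dotProduct_mulVec_le _ _ _).trans ?_
    -- This term is cubic in `h`; one factor is dropped using `h ≤ 1`.
    calc _ ≤ (B * h) * ((X * h) * (X * 1)) := by gcongr; exact hy.trans (by gcongr)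
      _ = _ := by ring
  have b6 : |(w ⬝ᵥ y) ^ 2| ≤ 4 * X ^ 4 * h ^ 2 := by
    rw [abs_pow]
    calc _ ≤ ((2 * X) * (X * h)) ^ 2 := by
          gcongr
          exact (abs_dotProduct_le _ _).trans (by gcongr)
      _ = _ := by ring
  have b7 : |h ^ 2 * (w ⬝ᵥ ((1 + D)⁻¹ *ᵥ w))| ≤ 8 * X ^ 2 * h ^ 2 := by
    rw [abs_mul, abs_of_nonneg (by positivity)]
    have : |w ⬝ᵥ ((1 + D)⁻¹ *ᵥ w)| ≤ 2 * ((2 * X) * (2 * X)) := by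
      refine (abs_dotProduct_mulVec_le _ _ _).trans ?_
      have := norm_inv_one_add_le hDle
      gcongr
    calc _ ≤ h ^ 2 * (2 * ((2 * X) * (2 * X))) := by gcongr
      _ = _ := by ring
  -- All first-order terms cancel; each term left is at least quadratic in `h`.
  have e4 : (1 - h ^ 2) * (w ⬝ᵥ ((1 + D)⁻¹ *ᵥ w))
        - (x ⬝ᵥ x - x ⬝ᵥ (A *ᵥ x) - 2 * (x ⬝ᵥ y))
      = w ⬝ᵥ (((1 + D)⁻¹ - 1 + D) *ᵥ w) + y ⬝ᵥ y + x ⬝ᵥ (A *ᵥ y) + y ⬝ᵥ (A *ᵥ x)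
        - y ⬝ᵥ (A *ᵥ y) + (w ⬝ᵥ y) ^ 2 - h ^ 2 * (w ⬝ᵥ ((1 + D)⁻¹ *ᵥ w)) := by
    rw [sub_mul, one_mul]
    nth_rw 1 [e1]
    rw [e2, e3]
    ring
  rw [e4]
  rw [abs_le] at b1 b2 b3 b4 b5 b6 b7 ⊢
  constructor <;> linarith [b1.1, b1.2, b2.1, b2.2, b3.1, b3.2, b4.1, b4.2, b5.1, b5.2, b6.1,
    b6.2, b7.1, b7.2]

lemma exists_vecMSD_expansion (ι : Type*) [Fintype ι] [DecidableEq ι] [Nonempty ι] {t : ℝ}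
    (ht : 1 ≤ t) :
    ∃ (C : ℝ) (N₀ : ℕ), 0 ≤ C ∧ ∀ N, N₀ ≤ N → ∀ (z : Fin N → ι → ℝ) (n : Fin N),
      IsControlled z n t → (vecCov z).PosDef ∧
      |vecMSD (z n) (vecMean z) (vecCov z) - (z n ⬝ᵥ z n
        - (∑ a : ι × ι, (z n a.1 * z n a.2) * secondDev z a.1 a.2)
        - 2 * ∑ i, z n i * vecMean z i)| ≤ C / N := by
  obtain ⟨C₁, hC₁, hnorm⟩ := exists_norm_le_of_entries ι
  set X : ℝ := (Fintype.card ι : ℝ) * t with hX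
  set B : ℝ := C₁ * (2 * t ^ 2) with hB
  have hX0 : 0 ≤ X := by positivity
  have hB0 : 0 ≤ B := by positivity
  refine ⟨8 * B ^ 2 * X ^ 2 + 8 * X ^ 2 + X ^ 2 + 3 * B * X ^ 2 + 4 * X ^ 4,
    -- `2 ≤ N` makes `N - 1` positive; `2 * B ≤ √N` keeps the perturbation within norm `1 / 2`.
    max 2 ⌈(2 * B) ^ 2⌉₊, by positivity, fun N hN z n h ↦ ?_⟩
  have hN2 : 2 ≤ N := (le_max_left _ _).trans hN
  have hNpos : 0 < N := by omega
  have hN' : (1 : ℝ) < N := by exact_mod_cast (by omega : 1 < N)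
  have hs0 : 0 < √(N : ℝ) := Real.sqrt_pos.2 (by linarith)
  have hs1 : 1 ≤ √(N : ℝ) := by rw [Real.one_le_sqrt]; linarith
  have hsB : 2 * B ≤ √(N : ℝ) := by
    refine Real.le_sqrt_of_sq_le ?_
    exact (Nat.le_ceil _).trans (by exact_mod_cast (le_max_right _ _).trans hN)
  set η : ℝ := (√(N : ℝ))⁻¹ with hη
  have hη2 : η ^ 2 = (N : ℝ)⁻¹ := by rw [hη, inv_pow, Real.sq_sqrt (by linarith)]
  have hη0 : 0 ≤ η := by positivity
  have hη1 : η ≤ 1 := inv_le_one_of_one_le₀ hs1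
  have hBη : B * η ≤ 1 / 2 := by
    rw [hη, ← div_eq_mul_inv, div_le_iff₀ hs0]; linarith
  have hA : ‖secondDev z‖ ≤ B * η := by
    refine (hnorm _ (2 * t ^ 2 * η) fun i j ↦ (h.dev i j).trans ?_).trans_eq (by rw [hB]; ring)
    rw [div_eq_mul_inv]
    gcongr
    nlinarith
  have hD : ‖centeredDev z‖ ≤ B * η := by
    refine (hnorm _ (2 * t ^ 2 * η) fun i j ↦ ?_).trans_eq (by rw [hB]; ring)
    exact (h.centeredDev_le hNpos ht i j).trans_eq (div_eq_mul_inv _ _)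
  have hx : ‖WithLp.toLp 2 (z n)‖ ≤ X := norm_toLp_le h.obs
  have hy : ‖WithLp.toLp 2 (vecMean z)‖ ≤ X * η := by
    refine (norm_toLp_le h.mean).trans_eq ?_
    rw [hX, hη, div_eq_mul_inv]; ring
  have hunit : IsUnit (1 + centeredDev z) := isUnit_one_add (hD.trans hBη)
  have hne : (N : ℝ) / (N - 1) ≠ 0 := div_ne_zero (by linarith) (by linarith)
  refine ⟨?_, ?_⟩
  · rw [(vecCov_posSemidef hN2 z).posDef_iff_isUnit, vecCov_eq hNpos]
    exact hunit.smul (Units.mk0 _ hne)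
  -- Since `η² = 1 / N`, the factor `1 - η²` is `(N - 1) / N`, which undoes the normalization by `N
  -- - 1`.
  · have hinv : (vecCov z)⁻¹ = (1 - η ^ 2) • (1 + centeredDev z)⁻¹ := by
      rw [vecCov_eq hNpos]
      apply Matrix.inv_eq_right_inv
      rw [Matrix.smul_mul, Matrix.mul_smul, smul_smul, one_add_mul_inv (hD.trans hBη), hη2]
      have : (N : ℝ) / (N - 1) * (1 - (N : ℝ)⁻¹) = 1 := by
        have : (N : ℝ) - 1 ≠ 0 := by linarith
        field_simp
      rw [this, one_smul]
    have := abs_quadForm_expansion_le hη0 hη1 hx hy hA hD hBη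
    rw [vecMSD, hinv, Matrix.smul_mulVec, dotProduct_smul, smul_eq_mul,
      ← dotProduct_mulVec_eq_sum, div_eq_mul_inv, ← hη2]
    exact this

end VectorExpansion

-- Existence for the perturbed coupled equations.

section CoupledEquations

open scoped Matrix.Norms.L2Operator

variable {c : ℕ} [NeZero c]

local notation "R" => Matrix (Fin c) (Fin c) ℝ

lemma abs_trace_div_le (x : R) : |x.trace / c| ≤ ‖x‖ := by
  have hc : (0 : ℝ) < c := by exact_mod_cast Nat.pos_of_ne_zero (NeZero.ne c)
  rw [abs_div, abs_of_pos hc, div_le_iff₀ hc, Matrix.trace]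
  refine (Finset.abs_sum_le_sum_abs _ _).trans ?_
  refine (Finset.sum_le_sum fun i _ ↦ abs_entry_le_norm x i i).trans ?_
  simp [mul_comm]

lemma abs_trace_le (x : R) : |x.trace| ≤ c * ‖x‖ := by
  have hc : (0 : ℝ) < c := by exact_mod_cast Nat.pos_of_ne_zero (NeZero.ne c)
  have := abs_trace_div_le x
  rwa [abs_div, abs_of_pos hc, div_le_iff₀ hc, mul_comm] at this

lemma norm_smul_one_le (a : ℝ) : ‖a • (1 : R)‖ ≤ |a| := by
  rw [norm_smul, norm_one, mul_one, Real.norm_eq_abs]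

/-- A small perturbation of the pair of equations `P⁻¹ = (tr Q / c) • 1`, `Q⁻¹ = (tr P / c) • 1` by
mutually adjoint linear terms has a symmetric solution near `(1, 1)`. -/
theorem exists_solution_coupled_equations (Ec Er : R →ₗ[ℝ] R) {δ : ℝ} (hδ0 : 0 ≤ δ)
    (hδ : δ ≤ 1 / 1000) (hEc : ∀ x, ‖Ec x‖ ≤ δ * ‖x‖) (hEr : ∀ x, ‖Er x‖ ≤ δ * ‖x‖)
    (hEcs : ∀ x : R, xᵀ = x → (Ec x)ᵀ = Ec x) (hErs : ∀ x : R, xᵀ = x → (Er x)ᵀ = Er x)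
    (hadj : ∀ x y : R, xᵀ = x → yᵀ = y → (Ec x * y).trace = (x * Er y).trace) :
    ∃ p q : R, pᵀ = p ∧ qᵀ = q ∧ ‖p - 1‖ ≤ 1 / 2 ∧ ‖q - 1‖ ≤ 1 / 2 ∧
      p⁻¹ = (q.trace / c) • (1 : R) + Er q ∧ q⁻¹ = (p.trace / c) • (1 : R) + Ec p := by
  have hc : (0 : ℝ) < c := by exact_mod_cast Nat.pos_of_ne_zero (NeZero.ne c)
  have htr1 : (1 : R).trace = c := by simp
  -- With `tr q = c` the first equation determines `p` from `q`; `v` is what the second then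
  -- requires of `q⁻¹`, and `g` rescales `v⁻¹` back to trace `c`. The rescaling removes the neutral
  -- direction `(a • p, a⁻¹ • q)`, along which the plain iteration would not contract.
  set p : R → R := fun q ↦ (1 + Er q)⁻¹ with hp
  set v : R → R := fun q ↦ ((p q).trace / c) • (1 : R) + Ec (p q) with hv
  set f : R → R := fun q ↦ (v q)⁻¹ with hf
  set τ : R → ℝ := fun q ↦ (f q).trace / c with hτ
  set g : R → R := fun q ↦ (τ q)⁻¹ • f q with hg
  set s : Set R := {q | qᵀ = q ∧ q.trace = c ∧ ‖q - 1‖ ≤ 1 / 2} with hs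
  have hEq : ∀ q ∈ s, ‖Er q‖ ≤ 2 * δ := by
    intro q hq
    have : ‖q‖ ≤ 2 := by
      have h1 : q = 1 + (q - 1) := by abel
      rw [h1]
      refine (norm_add_le _ _).trans ?_
      rw [norm_one]
      linarith [hq.2.2]
    refine (hEr q).trans ?_
    nlinarith
  have hEq2 : ∀ q ∈ s, ‖Er q‖ ≤ 1 / 2 := fun q hq ↦ (hEq q hq).trans (by linarith)
  have hp1 : ∀ q ∈ s, ‖p q - 1‖ ≤ 4 * δ := fun q hq ↦ by
    have := norm_inv_one_add_sub_one_le (hEq2 q hq)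
    have := hEq q hq
    simp only [hp]
    linarith
  have hplip : ∀ q ∈ s, ∀ q' ∈ s, ‖p q - p q'‖ ≤ 4 * δ * ‖q - q'‖ := by
    intro q hq q' hq'
    have h1 := norm_inv_one_add_sub_inv_one_add_le (hEq2 q hq) (hEq2 q' hq')
    have h2 := hEr (q - q')
    rw [map_sub] at h2
    simp only [hp]
    linarith
  have hlin : ∀ x : R, ‖(x.trace / c) • (1 : R) + Ec x‖ ≤ 2 * ‖x‖ := by
    intro x
    refine (norm_add_le _ _).trans ?_
    have h1 := (norm_smul_one_le (c := c) (x.trace / c)).trans (abs_trace_div_le x)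
    have h2 := hEc x
    nlinarith [norm_nonneg x]
  have hv1 : ∀ q ∈ s, ‖v q - 1‖ ≤ 9 * δ := by
    intro q hq
    have e : v q - 1 = (((p q - 1).trace / c) • (1 : R) + Ec (p q - 1)) + Ec 1 := by
      have : (c : ℝ) / c = 1 := div_self hc.ne'
      simp only [hv, map_sub, Matrix.trace_sub, htr1, sub_div, sub_smul, this, one_smul]
      abel
    rw [e]
    refine (norm_add_le _ _).trans ?_
    have h1 := hlin (p q - 1)
    have h2 := hEc 1
    rw [norm_one] at h2
    have h3 := hp1 q hq
    linarith
  have hv2 : ∀ q ∈ s, ‖v q - 1‖ ≤ 1 / 2 := fun q hq ↦ (hv1 q hq).trans (by linarith)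
  have hvlip : ∀ q ∈ s, ∀ q' ∈ s, ‖v q - v q'‖ ≤ 8 * δ * ‖q - q'‖ := by
    intro q hq q' hq'
    have e : v q - v q' = ((p q - p q').trace / c) • (1 : R) + Ec (p q - p q') := by
      simp only [hv, map_sub, Matrix.trace_sub, sub_div, sub_smul]
      abel
    rw [e]
    have := hlin (p q - p q')
    have := hplip q hq q' hq'
    linarith
  have hfeq : ∀ q, f q = (1 + (v q - 1))⁻¹ := fun q ↦ by simp [hf]
  have hf1 : ∀ q ∈ s, ‖f q - 1‖ ≤ 18 * δ := fun q hq ↦ by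
    have := norm_inv_one_add_sub_one_le (hv2 q hq)
    have := hv1 q hq
    rw [hfeq]
    linarith
  have hf2 : ∀ q ∈ s, ‖f q‖ ≤ 2 := fun q hq ↦ by
    rw [hfeq]
    exact norm_inv_one_add_le (hv2 q hq)
  have hflip : ∀ q ∈ s, ∀ q' ∈ s, ‖f q - f q'‖ ≤ 32 * δ * ‖q - q'‖ := by
    intro q hq q' hq'
    have h1 := norm_inv_one_add_sub_inv_one_add_le (hv2 q hq) (hv2 q' hq')
    have h2 := hvlip q hq q' hq'
    rw [hfeq, hfeq]
    have : v q - 1 - (v q' - 1) = v q - v q' := by abel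
    rw [this] at h1
    linarith
  have hτ1 : ∀ q ∈ s, |τ q - 1| ≤ 18 * δ := by
    intro q hq
    have : τ q - 1 = (f q - 1).trace / c := by
      simp only [hτ, Matrix.trace_sub, htr1, sub_div, div_self hc.ne']
    rw [this]
    exact (abs_trace_div_le _).trans (hf1 q hq)
  have hτlip : ∀ q ∈ s, ∀ q' ∈ s, |τ q' - τ q| ≤ 32 * δ * ‖q - q'‖ := by
    intro q hq q' hq'
    have : τ q' - τ q = (f q' - f q).trace / c := by
      simp only [hτ, Matrix.trace_sub, sub_div]
    rw [this]
    refine (abs_trace_div_le _).trans ?_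
    rw [norm_sub_rev]
    exact hflip q hq q' hq'
  have hτlow : ∀ q ∈ s, 1 / 2 ≤ τ q ∧ τ q ≤ 3 / 2 := fun q hq ↦ by
    have := abs_le.1 (hτ1 q hq)
    constructor <;> linarith [this.1, this.2]
  have hτinv : ∀ q ∈ s, |(τ q)⁻¹| ≤ 2 := fun q hq ↦ by
    have := (hτlow q hq).1
    rw [abs_of_pos (by positivity)]
    calc (τ q)⁻¹ ≤ (1 / 2)⁻¹ := by gcongr
      _ = 2 := by norm_num
  have hτpos : ∀ q ∈ s, 0 < τ q := fun q hq ↦ by linarith [(hτlow q hq).1]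
  have hgs : ∀ q, (q : R) ∈ s → g q ∈ s := by
    intro q hq
    refine ⟨?_, ?_, ?_⟩
    · have h1 : (p q)ᵀ = p q := by
        simp only [hp, Matrix.transpose_nonsing_inv, Matrix.transpose_add, Matrix.transpose_one,
          hErs q hq.1]
      have h2 : (v q)ᵀ = v q := by
        simp only [hv, Matrix.transpose_add, Matrix.transpose_smul, Matrix.transpose_one,
          hEcs _ h1]
      simp only [hg, hf, Matrix.transpose_smul, Matrix.transpose_nonsing_inv, h2]
    · have := (hτpos q hq).ne'
      simp only [hg, Matrix.trace_smul, smul_eq_mul]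
      have h1 : (f q).trace = τ q * c := by simp only [hτ]; field_simp
      rw [h1]
      field_simp
    · have e : g q - 1 = (τ q)⁻¹ • ((f q - 1) - (τ q - 1) • (1 : R)) := by
        simp only [hg, smul_sub, sub_smul, smul_smul, inv_mul_cancel₀ (hτpos q hq).ne', one_smul]
        abel
      rw [e, norm_smul, Real.norm_eq_abs]
      have h1 : ‖(f q - 1) - (τ q - 1) • (1 : R)‖ ≤ 36 * δ := by
        refine (norm_sub_le _ _).trans ?_
        have := (norm_smul_one_le (c := c) (τ q - 1)).trans (hτ1 q hq)
        linarith [hf1 q hq]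
      calc _ ≤ 2 * (36 * δ) := by gcongr; exact hτinv q hq
        _ ≤ _ := by linarith
  have hglip : ∀ q ∈ s, ∀ q' ∈ s, ‖g q - g q'‖ ≤ 1 / 2 * ‖q - q'‖ := by
    intro q hq q' hq'
    have e : g q - g q' = ((τ q)⁻¹ * (τ q')⁻¹) •
        (τ q' • (f q - f q') + (τ q' - τ q) • f q') := by
      have h1 := (hτpos q hq).ne'
      have h2 := (hτpos q' hq').ne'
      have e1 : (τ q)⁻¹ * (τ q')⁻¹ * τ q' = (τ q)⁻¹ := by field_simp
      have e2 : (τ q)⁻¹ * (τ q')⁻¹ * τ q = (τ q')⁻¹ := by field_simp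
      simp only [hg, smul_add, smul_sub, sub_smul, smul_smul, e1, e2]
      abel
    rw [e, norm_smul, norm_mul, Real.norm_eq_abs, Real.norm_eq_abs]
    have h1 : ‖τ q' • (f q - f q') + (τ q' - τ q) • f q'‖ ≤ 112 * δ * ‖q - q'‖ := by
      refine (norm_add_le _ _).trans ?_
      rw [norm_smul, norm_smul, Real.norm_eq_abs, Real.norm_eq_abs]
      have h3 : |τ q'| * ‖f q - f q'‖ ≤ 3 / 2 * (32 * δ * ‖q - q'‖) := by
        gcongr
        · rw [abs_of_pos (hτpos q' hq')]; exact (hτlow q' hq').2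
        · exact hflip q hq q' hq'
      have h4 : |τ q' - τ q| * ‖f q'‖ ≤ (32 * δ * ‖q - q'‖) * 2 := by
        gcongr
        · exact hτlip q hq q' hq'
        · exact hf2 q' hq'
      linarith
    -- The bound `δ ≤ 1 / 1000` is chosen so that this Lipschitz constant `448 * δ` is at most `1 /
    -- 2`.
    calc _ ≤ 2 * 2 * (112 * δ * ‖q - q'‖) := by
          gcongr
          · exact hτinv q hq
          · exact hτinv q' hq'
      _ = (448 * δ) * ‖q - q'‖ := by ring
      _ ≤ _ := by gcongr; linarith
  have hclosed : IsClosed s := by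
    have h1 : IsClosed {q : R | qᵀ = q} := isClosed_eq (by fun_prop) continuous_id
    have h2 : IsClosed {q : R | q.trace = c} := isClosed_eq (by fun_prop) continuous_const
    have h3 : IsClosed {q : R | ‖q - 1‖ ≤ 1 / 2} := isClosed_le (by fun_prop) continuous_const
    exact h1.inter (h2.inter h3)
  have hone : (1 : R) ∈ s := ⟨by simp, htr1, by simp⟩
  have hmaps : Set.MapsTo g s s := hgs
  have hcontr : ContractingWith (1 / 2) (hmaps.restrict g s s) := by
    refine ⟨by
      rw [← NNReal.coe_lt_coe]; norm_num, LipschitzWith.of_dist_le_mul fun x y ↦ ?_⟩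
    rw [Subtype.dist_eq, Subtype.dist_eq, dist_eq_norm, dist_eq_norm]
    simpa using hglip x x.2 y y.2
  obtain ⟨q, hq, hfix, -⟩ := hcontr.exists_fixedPoint' hclosed.isComplete hmaps hone
    (edist_ne_top _ _)
  have hfix' : (τ q)⁻¹ • f q = q := hfix
  have hps : (p q)ᵀ = p q := by
    simp only [hp, Matrix.transpose_nonsing_inv, Matrix.transpose_add, Matrix.transpose_one,
      hErs q hq.1]
  have hpu : p q * (1 + Er q) = 1 := Matrix.nonsing_inv_mul _
    ((Matrix.isUnit_iff_isUnit_det _).1 (isUnit_one_add (hEq2 q hq)))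
  have hvf : v q * f q = 1 := by
    have := one_add_mul_inv (hv2 q hq)
    rw [← hfeq] at this
    simpa using this
  -- A fixed point of `g` solves the second equation only up to the scalar `τ q`. Adjointness moves
  -- `Ec` from `p` onto `q` as `Er`, so the trace equals that of `p (1 + Er q) = 1`. As `v q * q` is
  -- also `(τ q)⁻¹ • 1`, the scalar is one.
  have htr : (v q * q).trace = c := by
    have h1 : (v q * q).trace = (p q).trace + (Ec (p q) * q).trace := by
      simp only [hv, add_mul, Matrix.trace_add, Matrix.smul_mul, one_mul, Matrix.trace_smul,
        smul_eq_mul, hq.2.1]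
      field_simp
    rw [h1, hadj _ _ hps hq.1, ← Matrix.trace_add]
    nth_rw 1 [← mul_one (p q)]
    rw [← mul_add, hpu, htr1]
  have hτone : τ q = 1 := by
    have h1 : v q * q = (τ q)⁻¹ • (1 : R) := by
      nth_rw 2 [← hfix']
      rw [Matrix.mul_smul, hvf]
    rw [h1, Matrix.trace_smul, htr1, smul_eq_mul] at htr
    have h2 := (hτpos q hq).ne'
    field_simp at htr
    linarith
  have hfq : f q = q := by
    rw [hτone, inv_one, one_smul] at hfix'
    exact hfix'
  refine ⟨p q, q, hps, hq.1, (hp1 q hq).trans (by linarith), hq.2.2, ?_, ?_⟩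
  · rw [hq.2.1, div_self hc.ne', one_smul]
    exact Matrix.inv_eq_right_inv hpu
  · have : q⁻¹ = v q := by
      apply Matrix.inv_eq_left_inv
      rwa [hfq] at hvf
    rw [this]

end CoupledEquations

-- Expansion of an arbitrary positive definite solution.

section CoupledExpansion

open scoped Matrix.Norms.L2Operator

variable {c : ℕ}

local notation "R" => Matrix (Fin c) (Fin c) ℝ

/-- Testing the form on `e_i ± e_j` gives `2 |A i j| ≤ A i i + A j j`. It supplies an a priori bound
for solutions not known to be near the identity. -/
lemma abs_entry_le_trace {A : R} (hA : A.PosSemidef) (i j : Fin c) :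
    |A i j| ≤ A.trace := by
  have hd : ∀ i, A i i ≤ A.trace := fun i ↦
    Finset.single_le_sum (f := fun i ↦ A i i) (fun k _ ↦ hA.diag_nonneg) (Finset.mem_univ i)
  have hs : A j i = A i j := by
    have := hA.isHermitian.apply i j
    simpa using this
  have h1 := hA.dotProduct_mulVec_nonneg (Pi.single i 1 + Pi.single j 1)
  have h2 := hA.dotProduct_mulVec_nonneg (Pi.single i 1 - Pi.single j 1)
  simp [Matrix.mulVec_add, Matrix.mulVec_sub, add_dotProduct, sub_dotProduct, hs] at h1 h2
  rw [abs_le]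
  constructor <;> linarith [hd i, hd j]

/-- Every positive definite solution of the perturbed coupled equations is, after rescaling, given
by an explicit first-order expansion. -/
theorem exists_coupled_equations_expansion (c : ℕ) [NeZero c] :
    ∃ κ : ℝ, 1 ≤ κ ∧ ∀ (Ec Er : Matrix (Fin c) (Fin c) ℝ →ₗ[ℝ] Matrix (Fin c) (Fin c) ℝ) (δ : ℝ),
      0 ≤ δ → 4 * κ * δ ≤ 1 / 2 → (∀ x, ‖Ec x‖ ≤ δ * ‖x‖) → (∀ x, ‖Er x‖ ≤ δ * ‖x‖) →
      ∀ p q : Matrix (Fin c) (Fin c) ℝ, p.PosDef → q.PosDef →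
      p⁻¹ = (q.trace / c) • (1 : Matrix (Fin c) (Fin c) ℝ) + Er q →
      q⁻¹ = (p.trace / c) • (1 : Matrix (Fin c) (Fin c) ℝ) + Ec p →
      ∃ α β : Matrix (Fin c) (Fin c) ℝ, (∃ a : ℝ, a ≠ 0 ∧ q = a • (1 + α) ∧ p = a⁻¹ • (1 + β)) ∧
        ‖α‖ ≤ 8 * κ * δ ∧ ‖β‖ ≤ 8 * κ * δ ∧
        ‖α + Ec 1‖ ≤ 44 * κ ^ 2 * δ ^ 2 ∧
        ‖β + Er 1 - ((Ec 1).trace / c) • (1 : Matrix (Fin c) (Fin c) ℝ)‖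
          ≤ 44 * κ ^ 2 * δ ^ 2 := by
  obtain ⟨C₁, hC₁, hnorm⟩ := exists_norm_le_of_entries (Fin c)
  have hc : (0 : ℝ) < c := by exact_mod_cast Nat.pos_of_ne_zero (NeZero.ne c)
  refine ⟨max 1 (C₁ * c), le_max_left _ _, ?_⟩
  set κ := max 1 (C₁ * c) with hκ
  have hκ1 : 1 ≤ κ := le_max_left _ _
  intro Ec Er δ hδ0 hδ hEc hEr p q hp hq hpq hqp
  -- The equations are invariant under `(p, q) ↦ (a⁻¹ • p, a • q)`; this choice gives the rescaled
  -- `p` trace `c`.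
  set a : ℝ := p.trace / c with ha
  have ha0 : 0 < a := div_pos hp.trace_pos hc
  set β : Matrix (Fin c) (Fin c) ℝ := a⁻¹ • p - 1 with hβ
  set α : Matrix (Fin c) (Fin c) ℝ := a • q - 1 with hα
  have hp1 : a⁻¹ • p = 1 + β := by rw [hβ]; abel
  have hq1 : a • q = 1 + α := by rw [hα]; abel
  have hpn : ‖1 + β‖ ≤ κ := by
    rw [← hp1]
    refine (hnorm _ c fun i j ↦ ?_).trans (le_max_right _ _)
    refine (abs_entry_le_trace (hp.posSemidef.smul (inv_nonneg.2 ha0.le)) i j).trans_eq ?_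
    rw [Matrix.trace_smul, smul_eq_mul, ha]
    have := hp.trace_pos.ne'
    field_simp
  have hpne : p = a • (1 + β) := by rw [← hp1, smul_smul, mul_inv_cancel₀ ha0.ne', one_smul]
  have hqne : q = a⁻¹ • (1 + α) := by rw [← hq1, smul_smul, inv_mul_cancel₀ ha0.ne', one_smul]
  have hEβ : ‖Ec (1 + β)‖ ≤ κ * δ := (hEc _).trans (by nlinarith)
  have hEβ2 : ‖Ec (1 + β)‖ ≤ 1 / 2 := hEβ.trans (by nlinarith)
  -- Boundedness of `1 + β` suffices to make `α` small here; feeding that into the other equation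
  -- then makes `β` small.
  have hαeq : 1 + α = (1 + Ec (1 + β))⁻¹ := by
    have h1 : (1 + Ec (1 + β)) = a⁻¹ • q⁻¹ := by
      rw [hqp, ← hp1, map_smul, smul_add, smul_smul, inv_mul_cancel₀ ha0.ne', one_smul]
    rw [h1, ← hq1]
    symm
    apply Matrix.inv_eq_right_inv
    rw [Matrix.smul_mul, Matrix.mul_smul, smul_smul, inv_mul_cancel₀ ha0.ne', one_smul,
      Matrix.nonsing_inv_mul _ ((Matrix.isUnit_iff_isUnit_det _).1 hq.isUnit)]
  have hαn : ‖α‖ ≤ 2 * (κ * δ) := by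
    have h1 : α = (1 + Ec (1 + β))⁻¹ - 1 := by rw [← hαeq]; abel
    rw [h1]
    exact (norm_inv_one_add_sub_one_le hEβ2).trans (by linarith)
  have hαn' : ‖1 + α‖ ≤ 2 := by rw [hαeq]; exact norm_inv_one_add_le hEβ2
  set F : Matrix (Fin c) (Fin c) ℝ := (α.trace / c) • (1 : Matrix (Fin c) (Fin c) ℝ) + Er (1 + α) with hF
  have hβeq : 1 + β = (1 + F)⁻¹ := by
    have htr : ((1 : Matrix (Fin c) (Fin c) ℝ) + α).trace / c = 1 + α.trace / c := by
      rw [Matrix.trace_add, add_div]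
      simp
    have h1 : 1 + F = a • p⁻¹ := by
      rw [hpq, smul_add, smul_smul, ← map_smul, hq1]
      have : a * (q.trace / c) = 1 + α.trace / c := by
        rw [← htr, ← hq1, Matrix.trace_smul, smul_eq_mul]
        ring
      rw [this, add_smul, one_smul, hF]
      abel
    rw [h1, ← hp1]
    symm
    apply Matrix.inv_eq_right_inv
    rw [Matrix.smul_mul, Matrix.mul_smul, smul_smul, mul_inv_cancel₀ ha0.ne', one_smul,
      Matrix.nonsing_inv_mul _ ((Matrix.isUnit_iff_isUnit_det _).1 hp.isUnit)]
  have hκδ : δ ≤ κ * δ := by nlinarith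
  have hFn : ‖F‖ ≤ 4 * (κ * δ) := by
    refine (norm_add_le _ _).trans ?_
    have h1 := (norm_smul_one_le (c := c) (α.trace / c)).trans (abs_trace_div_le α)
    have h2 := hEr (1 + α)
    nlinarith
  have hF2 : ‖F‖ ≤ 1 / 2 := hFn.trans (by linarith)
  have hβF : β = (1 + F)⁻¹ - 1 := by rw [← hβeq]; abel
  have hβn : ‖β‖ ≤ 8 * (κ * δ) := by
    rw [hβF]
    exact (norm_inv_one_add_sub_one_le hF2).trans (by linarith)
  have hα1 : ‖α + Ec 1‖ ≤ 10 * (κ * δ) ^ 2 := by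
    have e : α + Ec 1 = ((1 + Ec (1 + β))⁻¹ - 1 + Ec (1 + β)) - Ec β := by
      rw [← hαeq, map_add]; abel
    rw [e]
    refine (norm_sub_le _ _).trans ?_
    have h1 := norm_inv_one_add_sub_one_add_le hEβ2
    have h2 := hEc β
    have h3 : ‖Ec (1 + β)‖ ^ 2 ≤ (κ * δ) ^ 2 := by gcongr
    have h4 : δ * ‖β‖ ≤ (κ * δ) * (8 * (κ * δ)) := by gcongr
    nlinarith
  have hβ1 : ‖β + Er 1 - ((Ec 1).trace / c) • (1 : Matrix (Fin c) (Fin c) ℝ)‖ ≤ 44 * (κ * δ) ^ 2 := by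
    -- To first order `β` is `-F`, and the trace of `α` inside `F` may be replaced by that of `-Ec
    -- 1`; this produces the scalar correction.
    have e : β + Er 1 - ((Ec 1).trace / c) • (1 : Matrix (Fin c) (Fin c) ℝ)
        = ((1 + F)⁻¹ - 1 + F) - ((α + Ec 1).trace / c) • (1 : Matrix (Fin c) (Fin c) ℝ) - Er α := by
      rw [← hβF, hF, Matrix.trace_add, add_div, add_smul, map_add]; abel
    rw [e]
    refine (norm_sub_le _ _).trans ?_
    have h0 := norm_sub_le ((1 + F)⁻¹ - 1 + F) (((α + Ec 1).trace / c) • (1 : Matrix (Fin c) (Fin c) ℝ))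
    have h1 := norm_inv_one_add_sub_one_add_le hF2
    have h2 := (norm_smul_one_le (c := c) ((α + Ec 1).trace / c)).trans
      (abs_trace_div_le (α + Ec 1))
    have h3 : ‖F‖ ^ 2 ≤ (4 * (κ * δ)) ^ 2 := by gcongr
    have h4 := hEr α
    have h5 : δ * ‖α‖ ≤ (κ * δ) * (2 * (κ * δ)) := by gcongr
    nlinarith
  refine ⟨α, β, ⟨a⁻¹, inv_ne_zero ha0.ne', hqne, by rw [inv_inv]; exact hpne⟩,
    by nlinarith, by linarith, ?_, ?_⟩
  · calc _ ≤ _ := hα1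
      _ ≤ 44 * (κ * δ) ^ 2 := by gcongr; norm_num
      _ = _ := by ring
  · calc _ ≤ _ := hβ1
      _ = _ := by ring

end CoupledExpansion

-- The flip-flop updates as partial contractions of the sample covariance.

section PartialContractions

open scoped Matrix.Norms.L2Operator

variable {c N : ℕ}

/-- Contraction of the row indices of a `c² × c²` matrix against a `c × c` matrix, divided by
`c`. -/
def partC (D : Matrix (Fin c × Fin c) (Fin c × Fin c) ℝ) :
    Matrix (Fin c) (Fin c) ℝ →ₗ[ℝ] Matrix (Fin c) (Fin c) ℝ where
  toFun p := Matrix.of fun i k ↦ (c : ℝ)⁻¹ * ∑ j, ∑ l, p j l * D (j, i) (l, k)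
  map_add' p q := by
    ext i k
    simp only [Matrix.of_apply, Matrix.add_apply, add_mul, Finset.sum_add_distrib, mul_add]
  map_smul' a p := by
    ext i k
    simp only [Matrix.of_apply, Matrix.smul_apply, smul_eq_mul, RingHom.id_apply, mul_assoc,
      ← Finset.mul_sum]
    ring

/-- Contraction of the column indices of a `c² × c²` matrix against a `c × c` matrix, divided by
`c`. -/
def partR (D : Matrix (Fin c × Fin c) (Fin c × Fin c) ℝ) :
    Matrix (Fin c) (Fin c) ℝ →ₗ[ℝ] Matrix (Fin c) (Fin c) ℝ :=
  partC (D.submatrix Prod.swap Prod.swap)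

lemma partC_apply (D : Matrix (Fin c × Fin c) (Fin c × Fin c) ℝ) (p : Matrix (Fin c) (Fin c) ℝ)
    (i k : Fin c) :
    partC D p i k = (c : ℝ)⁻¹ * ∑ j, ∑ l, p j l * D (j, i) (l, k) := rfl

lemma partR_apply (D : Matrix (Fin c × Fin c) (Fin c × Fin c) ℝ) (q : Matrix (Fin c) (Fin c) ℝ)
    (j l : Fin c) :
    partR D q j l = (c : ℝ)⁻¹ * ∑ i, ∑ k, q i k * D (j, i) (l, k) := rfl

lemma partC_sub (D D' : Matrix (Fin c × Fin c) (Fin c × Fin c) ℝ)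
    (p : Matrix (Fin c) (Fin c) ℝ) : partC (D - D') p = partC D p - partC D' p := by
  ext i k
  simp only [partC_apply, Matrix.sub_apply, mul_sub, Finset.sum_sub_distrib]

lemma partR_sub (D D' : Matrix (Fin c × Fin c) (Fin c × Fin c) ℝ)
    (p : Matrix (Fin c) (Fin c) ℝ) : partR (D - D') p = partR D p - partR D' p :=
  partC_sub _ _ p

lemma exists_norm_partC_le (c : ℕ) : ∃ C : ℝ, 0 ≤ C ∧
    ∀ (D : Matrix (Fin c × Fin c) (Fin c × Fin c) ℝ) (s : ℝ), 0 ≤ s → (∀ a b, |D a b| ≤ s) →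
      ∀ p, ‖partC D p‖ ≤ C * s * ‖p‖ := by
  obtain ⟨C₁, hC₁, hnorm⟩ := exists_norm_le_of_entries (Fin c)
  refine ⟨C₁ * ((c : ℝ)⁻¹ * (c * c)), by positivity, fun D s hs hD p ↦ ?_⟩
  refine (hnorm _ ((c : ℝ)⁻¹ * (c * c) * (s * ‖p‖)) fun i k ↦ ?_).trans_eq (by ring)
  rw [partC_apply, abs_mul, abs_of_nonneg (by positivity), mul_assoc]
  gcongr
  refine (Finset.abs_sum_le_sum_abs _ _).trans ?_
  have h1 : ∀ j : Fin c, |∑ l, p j l * D (j, i) (l, k)| ≤ c * (s * ‖p‖) := fun j ↦ by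
    refine (Finset.abs_sum_le_sum_abs _ _).trans ?_
    calc _ ≤ ∑ _l : Fin c, s * ‖p‖ := by
          refine Finset.sum_le_sum fun l _ ↦ ?_
          rw [abs_mul, mul_comm]
          exact mul_le_mul (hD _ _) (abs_entry_le_norm p j l) (abs_nonneg _) hs
      _ = _ := by simp
  calc _ ≤ ∑ _j : Fin c, c * (s * ‖p‖) := Finset.sum_le_sum fun j _ ↦ h1 j
    _ = _ := by simp [mul_assoc]

lemma partC_transpose {D : Matrix (Fin c × Fin c) (Fin c × Fin c) ℝ} (hD : Dᵀ = D)
    {p : Matrix (Fin c) (Fin c) ℝ} (hp : pᵀ = p) : (partC D p)ᵀ = partC D p := by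
  ext i k
  rw [Matrix.transpose_apply, partC_apply, partC_apply, Finset.sum_comm]
  congr 1
  refine Finset.sum_congr rfl fun j _ ↦ Finset.sum_congr rfl fun l _ ↦ ?_
  rw [← Matrix.transpose_apply D, hD, ← Matrix.transpose_apply p, hp]

lemma partR_transpose {D : Matrix (Fin c × Fin c) (Fin c × Fin c) ℝ} (hD : Dᵀ = D)
    {p : Matrix (Fin c) (Fin c) ℝ} (hp : pᵀ = p) : (partR D p)ᵀ = partR D p :=
  partC_transpose (by rw [Matrix.transpose_submatrix, hD]) hp

/-- Both sides contract `D` against `p` in the row indices and `q` in the column indices. This is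
the adjointness used to solve the coupled equations. -/
lemma trace_partC_mul (D : Matrix (Fin c × Fin c) (Fin c × Fin c) ℝ)
    {p q : Matrix (Fin c) (Fin c) ℝ} (hp : pᵀ = p) (hq : qᵀ = q) :
    (partC D p * q).trace = (p * partR D q).trace := by
  have hp' : ∀ j l, p l j = p j l := fun j l ↦ by rw [← Matrix.transpose_apply p, hp]
  have hq' : ∀ j l, q l j = q j l := fun j l ↦ by rw [← Matrix.transpose_apply q, hq]
  have e1 : (partC D p * q).trace
      = (c : ℝ)⁻¹ * ∑ i, ∑ k, ∑ j, ∑ l, p j l * q i k * D (j, i) (l, k) := by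
    simp only [Matrix.trace, Matrix.diag, Matrix.mul_apply, partC_apply, Finset.mul_sum,
      Finset.sum_mul]
    refine Finset.sum_congr rfl fun i _ ↦ Finset.sum_congr rfl fun k _ ↦
      Finset.sum_congr rfl fun j _ ↦ Finset.sum_congr rfl fun l _ ↦ ?_
    rw [hq' i k]; ring
  have e2 : (p * partR D q).trace
      = (c : ℝ)⁻¹ * ∑ j, ∑ l, ∑ i, ∑ k, p j l * q i k * D (j, i) (l, k) := by
    rw [Matrix.trace_mul_comm]
    simp only [Matrix.trace, Matrix.diag, Matrix.mul_apply, partR_apply, Finset.mul_sum,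
      Finset.sum_mul]
    refine Finset.sum_congr rfl fun j _ ↦ Finset.sum_congr rfl fun l _ ↦
      Finset.sum_congr rfl fun i _ ↦ Finset.sum_congr rfl fun k _ ↦ ?_
    rw [hp' j l]; ring
  rw [e1, e2]
  congr 1
  have e3 : ∀ i, ∑ k, ∑ j, ∑ l, p j l * q i k * D (j, i) (l, k)
      = ∑ j, ∑ l, ∑ k, p j l * q i k * D (j, i) (l, k) := fun i ↦ by
    rw [Finset.sum_comm]
    exact Finset.sum_congr rfl fun j _ ↦ Finset.sum_comm
  simp_rw [e3]
  rw [Finset.sum_comm]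
  exact Finset.sum_congr rfl fun j _ ↦ Finset.sum_comm

lemma matMean_vec (Z : Fin N → Matrix (Fin c) (Fin c) ℝ) :
    (matMean Z).vec = vecMean fun m ↦ (Z m).vec := by
  rw [matMean, vecMean, Matrix.vec_smul, Matrix.vec_sum]

lemma centeredDev_transpose {ι : Type*} [Fintype ι] [DecidableEq ι] (z : Fin N → ι → ℝ) :
    (centeredDev z)ᵀ = centeredDev z := by
  simp only [centeredDev, secondDev, Matrix.transpose_sub, Matrix.transpose_smul,
    Matrix.transpose_sum, Matrix.transpose_vecMulVec, Matrix.transpose_one]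

lemma sum_mul_sub_matMean (hN : 0 < N) (Z : Fin N → Matrix (Fin c) (Fin c) ℝ)
    (i j k l : Fin c) :
    ∑ m, (Z m - matMean Z) i j * (Z m - matMean Z) k l
      = N * ((1 : Matrix _ _ ℝ) (j, i) (l, k) + centeredDev (fun m ↦ (Z m).vec) (j, i) (l, k)) := by
  have := congrFun (congrFun (sum_vecMulVec_sub_vecMean hN fun m ↦ (Z m).vec) (j, i)) (l, k)
  rw [← matMean_vec] at this
  simp only [Matrix.sum_apply, Matrix.vecMulVec_apply, Pi.sub_apply, Matrix.smul_apply,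
    Matrix.add_apply, smul_eq_mul, Matrix.vec] at this
  simpa only [Matrix.sub_apply] using this

/-- The update contracts the centered second moments `1 + D` against `Sr⁻¹`: the identity yields the
trace term and `D` the perturbation. -/
lemma flipC_eq [NeZero c] (hN : 0 < N) (Z : Fin N → Matrix (Fin c) (Fin c) ℝ)
    (Sr : Matrix (Fin c) (Fin c) ℝ) :
    flipC Z Sr = ((Sr⁻¹).trace / c) • (1 : Matrix (Fin c) (Fin c) ℝ)
      + partC (centeredDev fun m ↦ (Z m).vec) Sr⁻¹ := by
  have hN' : (N : ℝ) ≠ 0 := by positivity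
  have hc : (c : ℝ) ≠ 0 := by exact_mod_cast NeZero.ne c
  set p := Sr⁻¹ with hp
  ext i k
  have e1 : flipC Z Sr i k = ((N : ℝ) * c)⁻¹ * ∑ j, ∑ l, p j l *
      ∑ m, (Z m - matMean Z) i j * (Z m - matMean Z) k l := by
    rw [flipC, Matrix.smul_apply, Matrix.sum_apply, smul_eq_mul, ← hp]
    congr 1
    simp only [Matrix.mul_apply (M := _ * _), Matrix.mul_apply (N := p), Matrix.transpose_apply,
      Finset.sum_mul, Finset.mul_sum]
    rw [Finset.sum_comm]
    symm
    rw [Finset.sum_comm]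
    refine Finset.sum_congr rfl fun l _ ↦ ?_
    symm
    rw [Finset.sum_comm]
    refine Finset.sum_congr rfl fun j _ ↦ Finset.sum_congr rfl fun m _ ↦ ?_
    ring
  rw [e1]
  simp only [sum_mul_sub_matMean hN, Matrix.add_apply, partC_apply, Matrix.smul_apply,
    smul_eq_mul, Matrix.trace, Matrix.diag]
  have e2 : ∀ j l, p j l * ((N : ℝ) * ((1 : Matrix _ _ ℝ) (j, i) (l, k)
      + centeredDev (fun m ↦ (Z m).vec) (j, i) (l, k)))
      = N * (p j l * (if j = l then (1 : Matrix (Fin c) (Fin c) ℝ) i k else 0))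
        + N * (p j l * centeredDev (fun m ↦ (Z m).vec) (j, i) (l, k)) := fun j l ↦ by
    have : (1 : Matrix (Fin c × Fin c) (Fin c × Fin c) ℝ) (j, i) (l, k)
        = if j = l then (1 : Matrix (Fin c) (Fin c) ℝ) i k else 0 := by
      simp only [Matrix.one_apply, Prod.mk.injEq]
      split_ifs <;> simp_all
    rw [this]; ring
  simp only [e2, Finset.sum_add_distrib, ← Finset.mul_sum]
  have e3 : ∑ j, ∑ l, p j l * (if j = l then (1 : Matrix (Fin c) (Fin c) ℝ) i k else 0)
      = (∑ j, p j j) * (1 : Matrix (Fin c) (Fin c) ℝ) i k := by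
    simp [Finset.sum_mul]
  rw [e3]
  field_simp

/-- Transposing the data exchanges the two updates, so facts about `flipR` follow from those about
`flipC`. -/
lemma flipR_eq_flipC_transpose (Z : Fin N → Matrix (Fin c) (Fin c) ℝ)
    (Sc : Matrix (Fin c) (Fin c) ℝ) : flipR Z Sc = flipC (fun m ↦ (Z m)ᵀ) Sc := by
  have : matMean (fun m ↦ (Z m)ᵀ) = (matMean Z)ᵀ := by
    rw [matMean, matMean, Matrix.transpose_smul, Matrix.transpose_sum]
  simp only [flipR, flipC, this, ← Matrix.transpose_sub, Matrix.transpose_transpose]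

lemma centeredDev_transpose_data (Z : Fin N → Matrix (Fin c) (Fin c) ℝ) :
    centeredDev (fun m ↦ ((Z m)ᵀ).vec)
      = (centeredDev fun m ↦ (Z m).vec).submatrix Prod.swap Prod.swap := by
  ext a b
  simp only [centeredDev, secondDev, Matrix.sub_apply, Matrix.smul_apply, Matrix.sum_apply,
    Matrix.vecMulVec_apply, Matrix.submatrix_apply, vecMean_apply, Matrix.vec_transpose,
    Function.comp_apply, Matrix.one_apply, Prod.swap_inj]

lemma flipR_eq [NeZero c] (hN : 0 < N) (Z : Fin N → Matrix (Fin c) (Fin c) ℝ)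
    (Sc : Matrix (Fin c) (Fin c) ℝ) :
    flipR Z Sc = ((Sc⁻¹).trace / c) • (1 : Matrix (Fin c) (Fin c) ℝ)
      + partR (centeredDev fun m ↦ (Z m).vec) Sc⁻¹ := by
  rw [flipR_eq_flipC_transpose, flipC_eq hN, centeredDev_transpose_data, partR]

end PartialContractions

-- First-order expansion of the trace form.

section MatrixExpansion

open scoped Matrix.Norms.L2Operator

variable {c N : ℕ}

/-- Coefficients of the first-order term of the matrix-based distance at flip-flop estimates, as a
linear functional of the deviation of the sample second moments. -/
def matWeight (x : Fin c × Fin c → ℝ) (a : (Fin c × Fin c) × (Fin c × Fin c)) : ℝ :=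
  (c : ℝ)⁻¹ * ((1 : Matrix (Fin c) (Fin c) ℝ) a.1.1 a.2.1 * ∑ j, x (j, a.1.2) * x (j, a.2.2))
    + (c : ℝ)⁻¹ * ((1 : Matrix (Fin c) (Fin c) ℝ) a.1.2 a.2.2 * ∑ i, x (a.1.1, i) * x (a.2.1, i))
    - (c : ℝ)⁻¹ ^ 2 * ((1 : Matrix (Fin c) (Fin c) ℝ) a.1.1 a.2.1
      * (1 : Matrix (Fin c) (Fin c) ℝ) a.1.2 a.2.2 * ∑ b, x b * x b)

lemma trace_mul_transpose_eq (Z : Matrix (Fin c) (Fin c) ℝ) :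
    (Z * Zᵀ).trace = ∑ b, Z.vec b * Z.vec b := by
  rw [Matrix.trace_mul_comm, ← Matrix.vec_dotProduct_vec]
  rfl

lemma partC_one_apply (A : Matrix (Fin c × Fin c) (Fin c × Fin c) ℝ) (i k : Fin c) :
    partC A 1 i k = (c : ℝ)⁻¹ * ∑ j, A (j, i) (j, k) := by
  rw [partC_apply]
  congr 1
  refine Finset.sum_congr rfl fun j _ ↦ ?_
  rw [Finset.sum_eq_single j]
  · simp
  · intro l _ hl
    simp [Matrix.one_apply_ne hl.symm]
  · simp

lemma partR_one_apply (A : Matrix (Fin c × Fin c) (Fin c × Fin c) ℝ) (j l : Fin c) :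
    partR A 1 j l = (c : ℝ)⁻¹ * ∑ i, A (j, i) (l, i) :=
  partC_one_apply _ j l

lemma sum_one_fst_mul (g : Fin c × Fin c → Fin c × Fin c → ℝ) :
    ∑ a : (Fin c × Fin c) × (Fin c × Fin c),
      (1 : Matrix (Fin c) (Fin c) ℝ) a.1.1 a.2.1 * g a.1 a.2 = ∑ i, ∑ k, ∑ j, g (j, i) (j, k) := by
  simp only [Fintype.sum_prod_type]
  rw [Finset.sum_comm]
  refine Finset.sum_congr rfl fun i _ ↦ ?_
  rw [Finset.sum_comm]
  symm
  rw [Finset.sum_comm]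
  symm
  rw [Finset.sum_comm]
  refine Finset.sum_congr rfl fun j _ ↦ ?_
  rw [Finset.sum_eq_single j]
  · simp
  · intro l _ hl
    simp [Matrix.one_apply_ne hl.symm]
  · simp

lemma sum_one_snd_mul (g : Fin c × Fin c → Fin c × Fin c → ℝ) :
    ∑ a : (Fin c × Fin c) × (Fin c × Fin c),
      (1 : Matrix (Fin c) (Fin c) ℝ) a.1.2 a.2.2 * g a.1 a.2 = ∑ j, ∑ l, ∑ i, g (j, i) (l, i) := by
  simp only [Fintype.sum_prod_type]
  refine Finset.sum_congr rfl fun j _ ↦ ?_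
  rw [Finset.sum_comm]
  refine Finset.sum_congr rfl fun l _ ↦ ?_
  refine Finset.sum_congr rfl fun i _ ↦ ?_
  rw [Finset.sum_eq_single i]
  · simp
  · intro l _ hl
    simp [Matrix.one_apply_ne hl.symm]
  · simp

/-- The right side is the first-order effect of `α ≈ -partC A 1` and `β ≈ -(partR A 1 - (tr (partC A
1) / c) • 1)` on the trace form; the three summands of `matWeight` are its coefficients. -/
lemma sum_matWeight_mul (Z : Matrix (Fin c) (Fin c) ℝ)
    (A : Matrix (Fin c × Fin c) (Fin c × Fin c) ℝ) :
    ∑ a, matWeight Z.vec a * A a.1 a.2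
      = (partC A 1 * (Z * Zᵀ)).trace
        + (Z * (partR A 1 - ((partC A 1).trace / c) • (1 : Matrix (Fin c) (Fin c) ℝ)) * Zᵀ).trace := by
  have e1 : (partC A 1 * (Z * Zᵀ)).trace = ∑ a : (Fin c × Fin c) × (Fin c × Fin c),
      (1 : Matrix (Fin c) (Fin c) ℝ) a.1.1 a.2.1 *
        ((c : ℝ)⁻¹ * (∑ j, Z.vec (j, a.1.2) * Z.vec (j, a.2.2)) * A a.1 a.2) := by
    rw [sum_one_fst_mul fun u v ↦ (c : ℝ)⁻¹ * (∑ j, Z.vec (j, u.2) * Z.vec (j, v.2)) * A u v]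
    simp only [Matrix.trace, Matrix.diag, Matrix.mul_apply (M := partC A 1), partC_one_apply]
    refine Finset.sum_congr rfl fun i _ ↦ Finset.sum_congr rfl fun k _ ↦ ?_
    have : (Z * Zᵀ) k i = ∑ x, Z.vec (x, i) * Z.vec (x, k) := by
      rw [Matrix.mul_apply]
      exact Finset.sum_congr rfl fun x _ ↦ mul_comm _ _
    rw [this, ← Finset.mul_sum]
    ring
  have e2 : (Z * partR A 1 * Zᵀ).trace = ∑ a : (Fin c × Fin c) × (Fin c × Fin c),
      (1 : Matrix (Fin c) (Fin c) ℝ) a.1.2 a.2.2 *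
        ((c : ℝ)⁻¹ * (∑ i, Z.vec (a.1.1, i) * Z.vec (a.2.1, i)) * A a.1 a.2) := by
    rw [sum_one_snd_mul fun u v ↦ (c : ℝ)⁻¹ * (∑ i, Z.vec (u.1, i) * Z.vec (v.1, i)) * A u v,
      Matrix.trace_mul_comm, ← mul_assoc, Matrix.trace_mul_comm]
    simp only [Matrix.trace, Matrix.diag, Matrix.mul_apply (M := partR A 1), partR_one_apply]
    refine Finset.sum_congr rfl fun j _ ↦ Finset.sum_congr rfl fun l _ ↦ ?_
    have : (Zᵀ * Z) l j = ∑ x, Z.vec (j, x) * Z.vec (l, x) := by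
      rw [Matrix.mul_apply]
      exact Finset.sum_congr rfl fun x _ ↦ mul_comm _ _
    rw [this, ← Finset.mul_sum]
    ring
  have e3 : ((partC A 1).trace / c) * (Z * Zᵀ).trace
      = ∑ a : (Fin c × Fin c) × (Fin c × Fin c), (1 : Matrix (Fin c) (Fin c) ℝ) a.1.1 a.2.1 *
      ((c : ℝ)⁻¹ ^ 2 * ((1 : Matrix (Fin c) (Fin c) ℝ) a.1.2 a.2.2
        * ∑ b, Z.vec b * Z.vec b) * A a.1 a.2) := by
    rw [trace_mul_transpose_eq]
    generalize ∑ b, Z.vec b * Z.vec b = S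
    rw [sum_one_fst_mul fun u v ↦ (c : ℝ)⁻¹ ^ 2 *
      ((1 : Matrix (Fin c) (Fin c) ℝ) u.2 v.2 * S) * A u v]
    simp only [Matrix.trace, Matrix.diag, partC_one_apply]
    rw [Finset.sum_div, Finset.sum_mul]
    refine Finset.sum_congr rfl fun i _ ↦ ?_
    symm
    rw [Finset.sum_eq_single i]
    · simp only [Matrix.one_apply_eq, one_mul]
      rw [← Finset.mul_sum]
      ring
    · intro k _ hk
      simp [Matrix.one_apply_ne hk.symm]
    · simp
  rw [mul_sub, sub_mul, Matrix.trace_sub, e1, e2, Matrix.mul_smul, Matrix.smul_mul,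
    Matrix.trace_smul, smul_eq_mul, mul_one, e3, ← add_sub_assoc, ← Finset.sum_add_distrib,
    ← Finset.sum_sub_distrib]
  refine Finset.sum_congr rfl fun a _ ↦ ?_
  rw [matWeight]
  ring

lemma norm_transpose_eq (Z : Matrix (Fin c) (Fin c) ℝ) : ‖Zᵀ‖ = ‖Z‖ := by
  rw [← Matrix.conjTranspose_eq_transpose_of_trivial, Matrix.l2_opNorm_conjTranspose]

/-- First-order expansion of a shifted trace form with perturbed coefficients. -/
lemma abs_traceForm_expansion_le [NeZero c] {Z Y α β e r : Matrix (Fin c) (Fin c) ℝ}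
    {X a b h : ℝ} (hh1 : h ≤ 1) (hZ : ‖Z‖ ≤ X) (hY : ‖Y‖ ≤ X * h)
    (hα : ‖α‖ ≤ a * h) (hβ : ‖β‖ ≤ a * h) (he : ‖e‖ ≤ a * h) (hr : ‖r‖ ≤ a * h)
    (hαe : ‖α + e‖ ≤ b * h ^ 2) (hβr : ‖β + r‖ ≤ b * h ^ 2) :
    |((1 + α) * (Z - Y) * (1 + β) * (Z - Y)ᵀ).trace
        - ((Z * Zᵀ).trace - ((e * (Z * Zᵀ)).trace + (Z * r * Zᵀ).trace) - 2 * (Z * Yᵀ).trace)|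
      ≤ c * X ^ 2 * (1 + 8 * b + 6 * a + 4 * a ^ 2) * h ^ 2 := by
  set W := Z - Y with hW
  have hX0 : 0 ≤ X := (norm_nonneg _).trans hZ
  have hah : 0 ≤ a * h := (norm_nonneg _).trans hα
  have hbh : 0 ≤ b * h ^ 2 := (norm_nonneg _).trans hαe
  have hWn : ‖W‖ ≤ 2 * X := by
    refine (norm_sub_le _ _).trans ?_
    nlinarith
  have hm3 : ∀ (x y w : Matrix (Fin c) (Fin c) ℝ) (x' y' w' : ℝ), ‖x‖ ≤ x' → ‖y‖ ≤ y' →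
      ‖w‖ ≤ w' → |(x * y * wᵀ).trace| ≤ c * (x' * y' * w') := by
    intro x y w x' y' w' hx hy hw
    have hx0 := (norm_nonneg _).trans hx
    have hy0 := (norm_nonneg _).trans hy
    refine (abs_trace_le _).trans ?_
    gcongr
    refine (norm_mul_le _ _).trans ?_
    rw [norm_transpose_eq]
    gcongr
    exact (norm_mul_le _ _).trans (by gcongr)
  have htY : (Y * Zᵀ).trace = (Z * Yᵀ).trace := by
    rw [← Matrix.trace_transpose, Matrix.transpose_mul, Matrix.transpose_transpose]
  -- An exact identity whose right side contains only terms of second order: each has two small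
  -- factors or one of `α + e`, `β + r`.
  have key : ((1 + α) * W * (1 + β) * Wᵀ).trace
        - ((Z * Zᵀ).trace - ((e * (Z * Zᵀ)).trace + (Z * r * Zᵀ).trace) - 2 * (Z * Yᵀ).trace)
      = (1 * Y * Yᵀ).trace + ((α + e) * W * Wᵀ).trace + (e * W * Yᵀ).trace + (e * Y * Zᵀ).trace
        + (W * (β + r) * Wᵀ).trace + (W * r * Yᵀ).trace + (Y * r * Zᵀ).trace
        + ((α * W) * β * Wᵀ).trace := by
    have h1 : (Z * r * Zᵀ).trace = (W * r * Wᵀ).trace + (W * r * Yᵀ).trace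
        + (Y * r * Zᵀ).trace := by
      rw [← Matrix.trace_add, ← Matrix.trace_add, hW, Matrix.transpose_sub]
      congr 1
      noncomm_ring
    have h2 : (e * (Z * Zᵀ)).trace = (e * W * Wᵀ).trace + (e * W * Yᵀ).trace
        + (e * Y * Zᵀ).trace := by
      rw [← Matrix.trace_add, ← Matrix.trace_add, hW, Matrix.transpose_sub]
      congr 1
      noncomm_ring
    have h3 : (W * Wᵀ).trace = (Z * Zᵀ).trace - (Z * Yᵀ).trace - (Y * Zᵀ).trace
        + (Y * Yᵀ).trace := by
      rw [← Matrix.trace_sub, ← Matrix.trace_sub, ← Matrix.trace_add, hW, Matrix.transpose_sub]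
      congr 1
      noncomm_ring
    rw [h1, h2]
    simp only [add_mul, mul_add, one_mul, mul_one, Matrix.trace_add, h3, htY]
    ring
  rw [key]
  have b1 := hm3 1 Y Y 1 _ _ (norm_one (α := Matrix (Fin c) (Fin c) ℝ)).le hY hY
  have b2 := hm3 (α + e) W W _ _ _ hαe hWn hWn
  have b3 := hm3 e W Y _ _ _ he hWn hY
  have b4 := hm3 e Y Z _ _ _ he hY hZ
  have b5 := hm3 W (β + r) W _ _ _ hWn hβr hWn
  have b6 := hm3 W r Y _ _ _ hWn hr hY
  have b7 := hm3 Y r Z _ _ _ hY hr hZ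
  have b8 := hm3 (α * W) β W ((a * h) * (2 * X)) _ _
    ((norm_mul_le _ _).trans (by gcongr)) hβ hWn
  have e : c * X ^ 2 * (1 + 8 * b + 6 * a + 4 * a ^ 2) * h ^ 2
      = c * (1 * (X * h) * (X * h)) + c * (b * h ^ 2 * (2 * X) * (2 * X))
        + c * (a * h * (2 * X) * (X * h)) + c * (a * h * (X * h) * X)
        + c * (2 * X * (b * h ^ 2) * (2 * X)) + c * (2 * X * (a * h) * (X * h))
        + c * (X * h * (a * h) * X) + c * (a * h * (2 * X) * (a * h) * (2 * X)) := by ring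
  rw [e]
  refine (abs_add_le _ _).trans (add_le_add ((abs_add_le _ _).trans (add_le_add
    ((abs_add_le _ _).trans (add_le_add ((abs_add_le _ _).trans (add_le_add
    ((abs_add_le _ _).trans (add_le_add ((abs_add_le _ _).trans (add_le_add
    ((abs_add_le _ _).trans (add_le_add b1 b2)) b3)) b4)) b5)) b6)) b7)) b8)

end MatrixExpansion

-- Existence and expansion of flip-flop estimates in whitened coordinates.

section FlipFlopExpansion

open scoped Matrix.Norms.L2Operator

variable {c N : ℕ}

/-- The coupled equations are solved for the inverses of the estimates; a symmetric solution within
`1 / 2` of the identity is positive definite. -/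
lemma exists_isFlipFlopMLE [NeZero c] (hN : 0 < N) (Z : Fin N → Matrix (Fin c) (Fin c) ℝ)
    {δ : ℝ} (hδ0 : 0 ≤ δ) (hδ : δ ≤ 1 / 1000)
    (hC : ∀ x, ‖partC (centeredDev fun m ↦ (Z m).vec) x‖ ≤ δ * ‖x‖)
    (hR : ∀ x, ‖partR (centeredDev fun m ↦ (Z m).vec) x‖ ≤ δ * ‖x‖) :
    ∃ Sc Sr, IsFlipFlopMLE Z Sc Sr := by
  have hD := centeredDev_transpose fun m ↦ (Z m).vec
  obtain ⟨p, q, hp, hq, hp1, hq1, hpq, hqp⟩ := exists_solution_coupled_equations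
    (partC (centeredDev fun m ↦ (Z m).vec)) (partR (centeredDev fun m ↦ (Z m).vec)) hδ0 hδ hC hR
    (fun x hx ↦ partC_transpose hD hx) (fun x hx ↦ partR_transpose hD hx)
    (fun x y hx hy ↦ trace_partC_mul _ hx hy)
  have hpd := posDef_of_norm_sub_one_lt hp (hp1.trans_lt (by norm_num))
  have hqd := posDef_of_norm_sub_one_lt hq (hq1.trans_lt (by norm_num))
  have hpi : p⁻¹⁻¹ = p :=
    Matrix.nonsing_inv_nonsing_inv _ ((Matrix.isUnit_iff_isUnit_det _).1 hpd.isUnit)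
  have hqi : q⁻¹⁻¹ = q :=
    Matrix.nonsing_inv_nonsing_inv _ ((Matrix.isUnit_iff_isUnit_det _).1 hqd.isUnit)
  refine ⟨q⁻¹, p⁻¹, hqd.inv, hpd.inv, ?_, ?_⟩
  · rw [flipC_eq hN, hpi, hqp]
  · rw [flipR_eq hN, hqi, hpq]

set_option maxHeartbeats 800000 in
theorem exists_matMSD_expansion (c : ℕ) [NeZero c] {t : ℝ} (ht : 1 ≤ t) :
    ∃ (C : ℝ) (N₀ : ℕ), 0 ≤ C ∧ ∀ N, N₀ ≤ N →
      ∀ (Z : Fin N → Matrix (Fin c) (Fin c) ℝ) (n : Fin N),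
      IsControlled (fun m ↦ (Z m).vec) n t → (∃ Sc Sr, IsFlipFlopMLE Z Sc Sr) ∧
      ∀ Sc Sr, IsFlipFlopMLE Z Sc Sr →
      |matMSD (Z n) (matMean Z) Sc Sr - ((Z n * (Z n)ᵀ).trace
        - (∑ a, matWeight (Z n).vec a * secondDev (fun m ↦ (Z m).vec) a.1 a.2)
        - 2 * ∑ i, (Z n).vec i * vecMean (fun m ↦ (Z m).vec) i)| ≤ C / N := by
  obtain ⟨C₁, hC₁, hnorm⟩ := exists_norm_le_of_entries (Fin c)
  obtain ⟨C₂, hC₂, hpart⟩ := exists_norm_partC_le c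
  obtain ⟨κ, hκ, hexp⟩ := exists_coupled_equations_expansion c
  set B : ℝ := C₂ * (2 * t ^ 2) with hB
  have hB0 : 0 ≤ B := by positivity
  have ht0 : 0 < t := by linarith
  set X : ℝ := C₁ * t with hX
  have hX0 : 0 ≤ X := by positivity
  set a : ℝ := 8 * κ * B + 2 * B with ha
  set b : ℝ := 44 * κ ^ 2 * B ^ 2 + 2 * (C₂ * t ^ 2) with hb
  have ha0 : 0 ≤ a := by positivity
  have hb0 : 0 ≤ b := by positivity
  -- With `1000 * κ * B ≤ √N` the perturbation size `δ = B * η` meets both smallness conditions: `1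
  -- / 1000` for existence and `4 * κ * δ ≤ 1 / 2` for the expansion.
  refine ⟨c * X ^ 2 * (1 + 8 * b + 6 * a + 4 * a ^ 2), max 1 ⌈(1000 * κ * B) ^ 2⌉₊,
    by positivity, fun N hN Z n h ↦ ?_⟩
  have hNpos : 0 < N := (le_max_left _ _).trans hN
  have hN' : (1 : ℝ) ≤ N := by exact_mod_cast hNpos
  have hs1 : 1 ≤ √(N : ℝ) := by rw [Real.one_le_sqrt]; linarith
  have hs0 : 0 < √(N : ℝ) := by linarith
  have hsB : 1000 * κ * B ≤ √(N : ℝ) := by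
    refine Real.le_sqrt_of_sq_le ?_
    exact (Nat.le_ceil _).trans (by exact_mod_cast (le_max_right _ _).trans hN)
  set η : ℝ := (√(N : ℝ))⁻¹ with hη
  have hη2 : η ^ 2 = (N : ℝ)⁻¹ := by rw [hη, inv_pow, Real.sq_sqrt (by linarith)]
  have hη0 : 0 ≤ η := by positivity
  have hη1 : η ≤ 1 := inv_le_one_of_one_le₀ hs1
  have hκB : 1000 * κ * (B * η) ≤ 1 := by
    rw [← mul_assoc, hη, ← div_eq_mul_inv, div_le_iff₀ hs0]; linarith
  set D := centeredDev fun m ↦ (Z m).vec with hD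
  set A := secondDev fun m ↦ (Z m).vec with hA
  set y := vecMean fun m ↦ (Z m).vec with hy
  have hDA : D = A - Matrix.vecMulVec y y := rfl
  have hDle : ∀ u v, |D u v| ≤ 2 * t ^ 2 * η := fun u v ↦
    (h.centeredDev_le hNpos ht u v).trans_eq (div_eq_mul_inv _ _)
  have hAle : ∀ u v, |A u v| ≤ 2 * t ^ 2 * η := fun u v ↦ (h.dev u v).trans (by
    rw [div_eq_mul_inv]
    gcongr
    nlinarith)
  have hyle : ∀ u v, |Matrix.vecMulVec y y u v| ≤ t ^ 2 * η ^ 2 := fun u v ↦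
    (norm_vecMulVec_self_entries h.mean u v).trans_eq (by rw [div_eq_mul_inv]; ring)
  have hCD : ∀ x, ‖partC D x‖ ≤ B * η * ‖x‖ := fun x ↦
    (hpart D _ (by positivity) hDle x).trans_eq (by rw [hB]; ring)
  have hRD : ∀ x, ‖partR D x‖ ≤ B * η * ‖x‖ := fun x ↦
    (hpart _ _ (by positivity) (fun u v ↦ hDle u.swap v.swap) x).trans_eq (by rw [hB]; ring)
  have hCA : ‖partC A 1‖ ≤ B * η :=
    (hpart A _ (by positivity) hAle 1).trans_eq (by rw [hB, norm_one]; ring)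
  have hRA : ‖partR A 1‖ ≤ B * η :=
    (hpart _ _ (by positivity) (fun u v ↦ hAle u.swap v.swap) 1).trans_eq
      (by rw [hB, norm_one]; ring)
  -- Passing from the centered `D` to the uncentered `A`, which is linear in the observations'
  -- products, costs only the square of the mean.
  have hCy : ‖partC A 1 - partC D 1‖ ≤ C₂ * t ^ 2 * η ^ 2 := by
    rw [← partC_sub, hDA, sub_sub_cancel]
    exact (hpart _ _ (by positivity) hyle 1).trans_eq (by rw [norm_one]; ring)
  have hRy : ‖partR A 1 - partR D 1‖ ≤ C₂ * t ^ 2 * η ^ 2 := by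
    rw [← partR_sub, hDA, sub_sub_cancel]
    exact (hpart _ _ (by positivity) (fun u v ↦ hyle u.swap v.swap) 1).trans_eq
      (by rw [norm_one]; ring)
  have hBη0 : 0 ≤ B * η := by positivity
  refine ⟨exists_isFlipFlopMLE hNpos Z hBη0 (by nlinarith) hCD hRD, fun Sc Sr hS ↦ ?_⟩
  have hSci : Sc⁻¹⁻¹ = Sc :=
    Matrix.nonsing_inv_nonsing_inv _ ((Matrix.isUnit_iff_isUnit_det _).1 hS.posDef_c.isUnit)
  have hSri : Sr⁻¹⁻¹ = Sr :=
    Matrix.nonsing_inv_nonsing_inv _ ((Matrix.isUnit_iff_isUnit_det _).1 hS.posDef_r.isUnit)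
  obtain ⟨α, β, ⟨l, hl, hq, hp⟩, hα, hβ, hα1, hβ1⟩ := hexp (partC D) (partR D) (B * η) hBη0
    (by nlinarith) hCD hRD Sr⁻¹ Sc⁻¹ hS.posDef_r.inv hS.posDef_c.inv
    (by rw [hSri, ← flipR_eq hNpos]; exact hS.eq_r)
    (by rw [hSci, ← flipC_eq hNpos]; exact hS.eq_c)
  -- The undetermined scale `l` cancels against its inverse.
  have hmsd : matMSD (Z n) (matMean Z) Sc Sr
      = ((1 + α) * (Z n - matMean Z) * (1 + β) * (Z n - matMean Z)ᵀ).trace := by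
    rw [matMSD, hq, hp, Matrix.smul_mul, Matrix.smul_mul, Matrix.mul_smul, smul_smul,
      mul_inv_cancel₀ hl, one_smul]
  set r := partR A 1 - ((partC A 1).trace / c) • (1 : Matrix (Fin c) (Fin c) ℝ) with hr
  have hrn : ‖r‖ ≤ a * η := by
    refine (norm_sub_le _ _).trans ?_
    have := (norm_smul_one_le (c := c) ((partC A 1).trace / c)).trans (abs_trace_div_le _)
    have : 0 ≤ κ * (B * η) := by positivity
    have e : a * η = 8 * (κ * (B * η)) + B * η + B * η := by rw [ha]; ring
    linarith
  have hαe : ‖α + partC A 1‖ ≤ b * η ^ 2 := by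
    have e : α + partC A 1 = (α + partC D 1) + (partC A 1 - partC D 1) := by abel
    rw [e]
    refine (norm_add_le _ _).trans ((add_le_add hα1 hCy).trans ?_)
    have : 0 ≤ C₂ * t ^ 2 * η ^ 2 := by positivity
    have e' : b * η ^ 2 = 44 * κ ^ 2 * (B * η) ^ 2 + C₂ * t ^ 2 * η ^ 2 + C₂ * t ^ 2 * η ^ 2 := by
      rw [hb]; ring
    linarith
  have hβr : ‖β + r‖ ≤ b * η ^ 2 := by
    have e : β + r = (β + partR D 1 - ((partC D 1).trace / c) • (1 : Matrix (Fin c) (Fin c) ℝ))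
        + ((partR A 1 - partR D 1)
          - ((partC A 1 - partC D 1).trace / c) • (1 : Matrix (Fin c) (Fin c) ℝ)) := by
      rw [hr, Matrix.trace_sub, sub_div, sub_smul]; abel
    rw [e]
    have h1 := (norm_smul_one_le (c := c) ((partC A 1 - partC D 1).trace / c)).trans
      ((abs_trace_div_le _).trans hCy)
    have h2 := norm_sub_le (partR A 1 - partR D 1)
      (((partC A 1 - partC D 1).trace / c) • (1 : Matrix (Fin c) (Fin c) ℝ))
    exact (norm_add_le _ _).trans ((add_le_add hβ1 (h2.trans (add_le_add hRy h1))).trans_eq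
      (by rw [hb]; ring))
  have hZn : ‖Z n‖ ≤ X := hnorm _ t fun i j ↦ h.obs (j, i)
  have hYn : ‖matMean Z‖ ≤ X * η := by
    refine (hnorm _ (t * η) fun i j ↦ ?_).trans_eq (by rw [hX]; ring)
    have h1 := h.mean (j, i)
    rw [← matMean_vec, div_eq_mul_inv] at h1
    exact h1
  have haη : a * η = 8 * κ * (B * η) + 2 * (B * η) := by rw [ha]; ring
  have haκ : 8 * κ * (B * η) ≤ a * η := by linarith
  have haB : B * η ≤ a * η := by
    have : 0 ≤ 8 * κ * (B * η) := by positivity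
    linarith
  have hfin := abs_traceForm_expansion_le hη1 hZn hYn (hα.trans haκ) (hβ.trans haκ)
    (hCA.trans haB) hrn hαe hβr
  have hcross : (Z n * (matMean Z)ᵀ).trace = ∑ i, (Z n).vec i * y i := by
    rw [hy, ← matMean_vec, ← Matrix.trace_transpose, Matrix.transpose_mul,
      Matrix.transpose_transpose, Matrix.trace_mul_comm, ← Matrix.vec_dotProduct_vec]
    rfl
  rw [hmsd, sum_matWeight_mul, ← hcross]
  exact hfin.trans_eq (by rw [hη2, div_eq_mul_inv])

end FlipFlopExpansion

-- Mean squared size of the first-order coefficients.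

section WeightMoments

variable {ι : Type*} [Fintype ι] [DecidableEq ι]

lemma integral_coord_mul_four' (i j k l : ι) :
    ∫ x : EuclideanSpace ℝ ι, (x i * x j) * (x k * x l) ∂(stdGaussian (EuclideanSpace ℝ ι))
      = (1 : Matrix ι ι ℝ) i j * (1 : Matrix ι ι ℝ) k l
        + (1 : Matrix ι ι ℝ) i k * (1 : Matrix ι ι ℝ) j l
        + (1 : Matrix ι ι ℝ) i l * (1 : Matrix ι ι ℝ) j k :=
  integral_coord_mul_four (HasLaw.id (μ := stdGaussian (EuclideanSpace ℝ ι))) i j k l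

lemma integrable_sq_sum_coord_mul {κ : Type*} (s : Finset κ) (u v : κ → ι) :
    Integrable (fun x : EuclideanSpace ℝ ι ↦ (∑ k ∈ s, x (u k) * x (v k)) ^ 2)
      (stdGaussian (EuclideanSpace ℝ ι)) :=
  (memLp_finsetSum s fun k _ ↦ memLp_coord_mul (u k) (v k)).integrable_sq

lemma integral_sq_sum_coord_mul {κ : Type*} (s : Finset κ) (u v : κ → ι) :
    ∫ x : EuclideanSpace ℝ ι, (∑ k ∈ s, x (u k) * x (v k)) ^ 2
      ∂(stdGaussian (EuclideanSpace ℝ ι))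
      = ∑ k ∈ s, ∑ l ∈ s, ((1 : Matrix ι ι ℝ) (u k) (v k) * (1 : Matrix ι ι ℝ) (u l) (v l)
        + (1 : Matrix ι ι ℝ) (u k) (u l) * (1 : Matrix ι ι ℝ) (v k) (v l)
        + (1 : Matrix ι ι ℝ) (u k) (v l) * (1 : Matrix ι ι ℝ) (v k) (u l)) := by
  simp_rw [sq, Finset.sum_mul_sum]
  have hi := fun k l ↦ integrable_coord_mul_four (u k) (v k) (u l) (v l)
  rw [integral_finsetSum _ fun k _ ↦ integrable_finsetSum _ fun l _ ↦ hi k l]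
  refine Finset.sum_congr rfl fun k _ ↦ ?_
  rw [integral_finsetSum _ fun l _ ↦ hi k l]
  exact Finset.sum_congr rfl fun l _ ↦ integral_coord_mul_four' _ _ _ _

lemma integral_sq_sum_sq_le [Nonempty ι] :
    ∫ x : EuclideanSpace ℝ ι, (∑ k, x k * x k) ^ 2 ∂(stdGaussian (EuclideanSpace ℝ ι))
      ≤ 3 * (Fintype.card ι : ℝ) ^ 2 := by
  rw [integral_sq_sum_coord_mul Finset.univ (fun k : ι ↦ k) fun k ↦ k]
  calc _ ≤ ∑ _k : ι, ∑ _l : ι, (3 : ℝ) := by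
        refine Finset.sum_le_sum fun k _ ↦ Finset.sum_le_sum fun l _ ↦ ?_
        simp only [Matrix.one_apply]
        split_ifs <;> norm_num
    _ = _ := by simp; ring

lemma sum_integral_coord_mul_sq_le [Nonempty ι] :
    ∑ a : ι × ι, ∫ x : EuclideanSpace ℝ ι, (x a.1 * x a.2) ^ 2
      ∂(stdGaussian (EuclideanSpace ℝ ι)) ≤ 3 * (Fintype.card ι : ℝ) ^ 2 := by
  calc _ ≤ ∑ _a : ι × ι, (3 : ℝ) := by
        refine Finset.sum_le_sum fun a _ ↦ ?_
        simp only [sq, integral_coord_mul_four', Matrix.one_apply]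
        split_ifs <;> norm_num
    _ = _ := by simp; ring

variable {c : ℕ}

lemma continuous_matWeight (a : (Fin c × Fin c) × (Fin c × Fin c)) :
    Continuous fun x : EuclideanSpace ℝ (Fin c × Fin c) ↦ matWeight x.ofLp a := by
  unfold matWeight
  fun_prop

lemma memLp_matWeight (a : (Fin c × Fin c) × (Fin c × Fin c)) :
    MemLp (fun x : EuclideanSpace ℝ (Fin c × Fin c) ↦ matWeight x.ofLp a) 2
      (stdGaussian (EuclideanSpace ℝ (Fin c × Fin c))) := by
  have h : ∀ {κ : Type} [Fintype κ] (u v : κ → Fin c × Fin c),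
      MemLp (fun x : EuclideanSpace ℝ (Fin c × Fin c) ↦ ∑ k, x (u k) * x (v k)) 2
        (stdGaussian (EuclideanSpace ℝ (Fin c × Fin c))) := fun u v ↦
    memLp_finsetSum Finset.univ fun k _ ↦ memLp_coord_mul (u k) (v k)
  exact ((((h (fun j ↦ (j, a.1.2)) fun j ↦ (j, a.2.2)).const_mul _).const_mul _).add
    (((h (fun i ↦ (a.1.1, i)) fun i ↦ (a.2.1, i)).const_mul _).const_mul _)).sub
    (((h (fun b ↦ b) fun b ↦ b).const_mul _).const_mul _)

lemma matWeight_swap (x : Fin c × Fin c → ℝ) (u v : Fin c × Fin c) :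
    matWeight x (u, v) = matWeight x (v, u) := by
  simp only [matWeight]
  have h1 : ∀ i k : Fin c, (1 : Matrix (Fin c) (Fin c) ℝ) i k = (1 : Matrix (Fin c) (Fin c) ℝ) k i :=
    fun i k ↦ by simp only [Matrix.one_apply, eq_comm]
  rw [h1 u.1 v.1, h1 u.2 v.2]
  simp only [mul_comm (x (_, u.2)) (x (_, v.2)), mul_comm (x (u.1, _)) (x (v.1, _))]

lemma one_prod_apply (j i l k : Fin c) :
    (1 : Matrix (Fin c × Fin c) (Fin c × Fin c) ℝ) (j, i) (l, k)
      = if j = l ∧ i = k then 1 else 0 := by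
  simp only [Matrix.one_apply, Prod.mk.injEq]

lemma sum_four_le :
    ∑ i : Fin c, ∑ k : Fin c, ∑ j : Fin c, ∑ l : Fin c,
      ((if i = k then (1 : ℝ) else 0) + 2 * if j = l then 1 else 0) = 3 * (c : ℝ) ^ 3 := by
  simp [Finset.sum_add_distrib]
  ring

/-- By Isserlis' formula the term of the pair `(j, l)` is at most `[i = k] + 2 [j = l]`;
off-diagonal Gram entries thus have mean square of order `c`, not `c²`. This keeps the total at
order `c³`. -/
lemma sum_integral_sq_rows_le :
    ∑ i : Fin c, ∑ k : Fin c, ∫ x : EuclideanSpace ℝ (Fin c × Fin c),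
      (∑ j, x (j, i) * x (j, k)) ^ 2 ∂(stdGaussian (EuclideanSpace ℝ (Fin c × Fin c)))
      ≤ 3 * (c : ℝ) ^ 3 := by
  rw [← sum_four_le]
  refine Finset.sum_le_sum fun i _ ↦ Finset.sum_le_sum fun k _ ↦ ?_
  rw [integral_sq_sum_coord_mul Finset.univ (fun j ↦ (j, i)) fun j ↦ (j, k)]
  refine Finset.sum_le_sum fun j _ ↦ Finset.sum_le_sum fun l _ ↦ ?_
  simp only [one_prod_apply]
  by_cases h1 : i = k <;> by_cases h2 : j = l <;> simp [h1, h2] <;> norm_num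

lemma sum_integral_sq_cols_le :
    ∑ i : Fin c, ∑ k : Fin c, ∫ x : EuclideanSpace ℝ (Fin c × Fin c),
      (∑ j, x (i, j) * x (k, j)) ^ 2 ∂(stdGaussian (EuclideanSpace ℝ (Fin c × Fin c)))
      ≤ 3 * (c : ℝ) ^ 3 := by
  rw [← sum_four_le]
  refine Finset.sum_le_sum fun i _ ↦ Finset.sum_le_sum fun k _ ↦ ?_
  rw [integral_sq_sum_coord_mul Finset.univ (fun j ↦ (i, j)) fun j ↦ (k, j)]
  refine Finset.sum_le_sum fun j _ ↦ Finset.sum_le_sum fun l _ ↦ ?_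
  simp only [one_prod_apply]
  by_cases h1 : i = k <;> by_cases h2 : j = l <;> simp [h1, h2] <;> norm_num

/-- Each Kronecker delta in a summand of `matWeight` removes one free index, so summing over it
gives back only one factor `c` against the squared prefactor. -/
lemma sum_matWeight_sq_le [NeZero c] (x : Fin c × Fin c → ℝ) :
    ∑ a, matWeight x a ^ 2 ≤ 3 * (c : ℝ)⁻¹ * (∑ i, ∑ k, (∑ j, x (j, i) * x (j, k)) ^ 2)
      + 3 * (c : ℝ)⁻¹ * (∑ i, ∑ k, (∑ j, x (i, j) * x (k, j)) ^ 2)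
      + 3 * (c : ℝ)⁻¹ ^ 2 * (∑ b, x b * x b) ^ 2 := by
  have hc : (c : ℝ) ≠ 0 := by exact_mod_cast NeZero.ne c
  have h01 : ∀ i k : Fin c, (1 : Matrix (Fin c) (Fin c) ℝ) i k ^ 2
      = (1 : Matrix (Fin c) (Fin c) ℝ) i k := fun i k ↦ by
    simp only [Matrix.one_apply]; split_ifs <;> norm_num
  have h3 : ∀ p q r : ℝ, (p + q - r) ^ 2 ≤ 3 * p ^ 2 + 3 * q ^ 2 + 3 * r ^ 2 := fun p q r ↦ by
    nlinarith [sq_nonneg (p - q), sq_nonneg (p + r), sq_nonneg (q + r)]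
  have e1 : ∑ a : (Fin c × Fin c) × (Fin c × Fin c), (1 : Matrix (Fin c) (Fin c) ℝ) a.1.1 a.2.1
      * (3 * (c : ℝ)⁻¹ ^ 2 * (∑ j, x (j, a.1.2) * x (j, a.2.2)) ^ 2)
      = 3 * (c : ℝ)⁻¹ * (∑ i, ∑ k, (∑ j, x (j, i) * x (j, k)) ^ 2) := by
    rw [sum_one_fst_mul fun u v ↦ 3 * (c : ℝ)⁻¹ ^ 2 * (∑ j, x (j, u.2) * x (j, v.2)) ^ 2]
    simp only [Finset.sum_const, Finset.card_univ, Fintype.card_fin, nsmul_eq_mul,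
      ← Finset.mul_sum]
    field_simp
  have e2 : ∑ a : (Fin c × Fin c) × (Fin c × Fin c), (1 : Matrix (Fin c) (Fin c) ℝ) a.1.2 a.2.2
      * (3 * (c : ℝ)⁻¹ ^ 2 * (∑ i, x (a.1.1, i) * x (a.2.1, i)) ^ 2)
      = 3 * (c : ℝ)⁻¹ * (∑ i, ∑ k, (∑ j, x (i, j) * x (k, j)) ^ 2) := by
    rw [sum_one_snd_mul fun u v ↦ 3 * (c : ℝ)⁻¹ ^ 2 * (∑ i, x (u.1, i) * x (v.1, i)) ^ 2]
    simp only [Finset.sum_const, Finset.card_univ, Fintype.card_fin, nsmul_eq_mul,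
      ← Finset.mul_sum]
    field_simp
  have e3 : ∑ a : (Fin c × Fin c) × (Fin c × Fin c), (1 : Matrix (Fin c) (Fin c) ℝ) a.1.1 a.2.1
      * ((1 : Matrix (Fin c) (Fin c) ℝ) a.1.2 a.2.2 * (3 * (c : ℝ)⁻¹ ^ 4 * (∑ b, x b * x b) ^ 2))
      = 3 * (c : ℝ)⁻¹ ^ 2 * (∑ b, x b * x b) ^ 2 := by
    rw [sum_one_fst_mul fun u v ↦ (1 : Matrix (Fin c) (Fin c) ℝ) u.2 v.2
      * (3 * (c : ℝ)⁻¹ ^ 4 * (∑ b, x b * x b) ^ 2)]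
    generalize (∑ b, x b * x b) ^ 2 = S
    simp only [Finset.sum_const, Finset.card_univ, Fintype.card_fin, nsmul_eq_mul,
      Matrix.one_apply, ite_mul, one_mul, zero_mul, mul_ite, mul_zero, Finset.sum_ite_eq,
      Finset.mem_univ, if_true]
    field_simp
  rw [← e1, ← e2, ← e3, ← Finset.sum_add_distrib, ← Finset.sum_add_distrib]
  refine Finset.sum_le_sum fun a _ ↦ ?_
  rw [matWeight]
  refine (h3 _ _ _).trans_eq ?_
  simp only [mul_pow, h01]
  ring

/-- The gain over the vector case: the three parts contribute `9 c²` each, whereas the products `x i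
* x j` give order `c⁴`. -/
lemma sum_integral_matWeight_sq_le [NeZero c] :
    ∑ a, ∫ x : EuclideanSpace ℝ (Fin c × Fin c), matWeight x.ofLp a ^ 2
      ∂(stdGaussian (EuclideanSpace ℝ (Fin c × Fin c))) ≤ 27 * (c : ℝ) ^ 2 := by
  have hc : (c : ℝ) ≠ 0 := by exact_mod_cast NeZero.ne c
  have hc0 : (0 : ℝ) < c := by positivity
  have i1 : ∀ i k : Fin c, Integrable (fun x : EuclideanSpace ℝ (Fin c × Fin c) ↦
      (∑ j, x (j, i) * x (j, k)) ^ 2) (stdGaussian (EuclideanSpace ℝ (Fin c × Fin c))) :=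
    fun i k ↦ integrable_sq_sum_coord_mul Finset.univ (fun j ↦ (j, i)) fun j ↦ (j, k)
  have i2 : ∀ i k : Fin c, Integrable (fun x : EuclideanSpace ℝ (Fin c × Fin c) ↦
      (∑ j, x (i, j) * x (k, j)) ^ 2) (stdGaussian (EuclideanSpace ℝ (Fin c × Fin c))) :=
    fun i k ↦ integrable_sq_sum_coord_mul Finset.univ (fun j ↦ (i, j)) fun j ↦ (k, j)
  have i3 : Integrable (fun x : EuclideanSpace ℝ (Fin c × Fin c) ↦
      (∑ b, x b * x b) ^ 2) (stdGaussian (EuclideanSpace ℝ (Fin c × Fin c))) :=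
    integrable_sq_sum_coord_mul Finset.univ (fun b ↦ b) fun b ↦ b
  have I1 := (integrable_finsetSum Finset.univ fun i _ ↦ integrable_finsetSum Finset.univ
    fun k _ ↦ i1 i k).const_mul (3 * (c : ℝ)⁻¹)
  have I2 := (integrable_finsetSum Finset.univ fun i _ ↦ integrable_finsetSum Finset.univ
    fun k _ ↦ i2 i k).const_mul (3 * (c : ℝ)⁻¹)
  have I3 := i3.const_mul (3 * (c : ℝ)⁻¹ ^ 2)
  rw [← integral_finsetSum _ fun a _ ↦ (memLp_matWeight a).integrable_sq]
  refine (integral_mono (integrable_finsetSum _ fun a _ ↦ (memLp_matWeight a).integrable_sq)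
    ((I1.add I2).add I3) fun x ↦ sum_matWeight_sq_le x.ofLp).trans ?_
  rw [integral_add' (I1.add I2) I3, integral_add' I1 I2, integral_const_mul, integral_const_mul,
    integral_const_mul,
    integral_finsetSum _ fun i _ ↦ integrable_finsetSum Finset.univ fun k _ ↦ i1 i k,
    integral_finsetSum _ fun i _ ↦ integrable_finsetSum Finset.univ fun k _ ↦ i2 i k]
  simp only [integral_finsetSum _ fun k _ ↦ i1 _ k, integral_finsetSum _ fun k _ ↦ i2 _ k]
  have h1 := sum_integral_sq_rows_le (c := c)
  have h2 := sum_integral_sq_cols_le (c := c)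
  have h3 := integral_sq_sum_sq_le (ι := Fin c × Fin c)
  rw [Fintype.card_prod, Fintype.card_fin] at h3
  calc _ ≤ 3 * (c : ℝ)⁻¹ * (3 * (c : ℝ) ^ 3) + 3 * (c : ℝ)⁻¹ * (3 * (c : ℝ) ^ 3)
        + 3 * (c : ℝ)⁻¹ ^ 2 * (3 * ((c * c : ℕ) : ℝ) ^ 2) := by gcongr
    _ = _ := by push_cast; field_simp; ring

end WeightMoments

-- From expansions to bounds in probability.

section ProbabilityBound

variable {ι : Type*} [Fintype ι] [DecidableEq ι]

/-- Transfer of a first-order expansion, valid for controlled samples, to a bound in probability. -/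
theorem exists_forall_measure_not_le (Good : ∀ N : ℕ, (Fin N → ι → ℝ) → Fin N → ℝ → Prop)
    {q : ι × ι → (ι → ℝ) → ℝ}
    (hqc : ∀ a, Continuous fun x : EuclideanSpace ℝ ι ↦ q a x.ofLp)
    (hq2 : ∀ a, MemLp (fun x : EuclideanSpace ℝ ι ↦ q a x.ofLp) 2
      (stdGaussian (EuclideanSpace ℝ ι)))
    (hqs : ∀ i j x, q (i, j) x = q (j, i) x) {b b' : ℝ} (hb : 0 < b) (hb' : 0 < b')
    (hqb : ∑ a, ∫ x : EuclideanSpace ℝ ι, q a x.ofLp ^ 2 ∂(stdGaussian (EuclideanSpace ℝ ι))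
      ≤ b ^ 2) (hcard : (Fintype.card ι : ℝ) ≤ b' ^ 2)
    (hGood : ∀ t : ℝ, 1 ≤ t → ∃ (C : ℝ) (N₀ : ℕ), 0 ≤ C ∧ ∀ N, N₀ ≤ N →
      ∀ (z : Fin N → ι → ℝ) (n : Fin N), IsControlled z n t → ∀ B : ℝ,
        C / N + |∑ a, q a (z n) * secondDev z a.1 a.2| + 2 * |∑ i, z n i * vecMean z i| ≤ B →
        Good N z n B)
    {ε : ℝ} (hε : 0 < ε) :
    ∃ N₀ : ℕ, ∀ N, N₀ ≤ N → ∀ {Ω : Type*} [MeasurableSpace Ω] (P : Measure Ω)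
      [IsProbabilityMeasure P] (z : Fin N → Ω → EuclideanSpace ℝ ι),
      (∀ m, HasLaw (z m) (stdGaussian (EuclideanSpace ℝ ι)) P) → iIndepFun z P → ∀ n : Fin N,
      P {ω | ¬ Good N (fun m ↦ (z m ω).ofLp) n
        ((√(6 / ε) * b + 2 * (√(6 / ε) * b') + 1) / √N)} ≤ ENNReal.ofReal ε := by
  obtain ⟨t, ht, hctrl⟩ := exists_forall_isControlled ι (ε := ε / 3) (by positivity)
  obtain ⟨C, N₁, hC, hexp⟩ := hGood t ht
  obtain ⟨C₁, hC₁, hlead⟩ := exists_measure_lt_abs_secondDev_le (q := fun a x ↦ q a x.ofLp)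
    hqc hq2 (fun i j x ↦ hqs i j _) hb hqb t
  obtain ⟨C₂, hC₂, hmean⟩ := exists_measure_lt_abs_vecMean_le (ι := ι) hb' hcard t
  set T : ℝ := C + C₁ + 2 * C₂ with hT
  -- `T` collects all dimension-dependent constants; `T ≤ √N` turns `T / N` into the final `+ 1` of
  -- the bound.
  refine ⟨max N₁ (max 1 ⌈T ^ 2⌉₊), fun N hN Ω _ P _ z hz hind n ↦ ?_⟩
  have hN₁ : N₁ ≤ N := (le_max_left _ _).trans hN
  have hNpos : 0 < N := ((le_max_left _ _).trans (le_max_right _ _)).trans hN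
  have hN' : (0 : ℝ) < N := by exact_mod_cast hNpos
  have hs0 : 0 < √(N : ℝ) := Real.sqrt_pos.2 hN'
  have hsT : T ≤ √(N : ℝ) := Real.le_sqrt_of_sq_le ((Nat.le_ceil _).trans
    (by exact_mod_cast ((le_max_right _ _).trans (le_max_right _ _)).trans hN))
  have hTN : T / N ≤ 1 / √N := by
    rw [div_le_div_iff₀ hN' hs0, one_mul]
    calc T * √N ≤ √N * √N := by gcongr
      _ = N := Real.mul_self_sqrt hN'.le
  -- Chosen so that `2 / K² = ε / 3`: each of the three bad events gets a third of `ε`.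
  set K := √(6 / ε) with hK
  have hK0 : 0 < K := Real.sqrt_pos.2 (by positivity)
  have hK2 : K ^ 2 = 6 / ε := Real.sq_sqrt (by positivity)
  have h1 := hctrl N hNpos P z hz hind n
  have h2 := hlead N hNpos P z hz hind n K hK0
  have h3 := hmean N hNpos P z hz hind n K hK0
  have e2 : 2 / K ^ 2 = ε / 3 := by rw [hK2]; field_simp; norm_num
  have e3 : 1 / K ^ 2 ≤ ε / 3 := by rw [← e2]; gcongr; norm_num
  rw [e2] at h2
  replace h3 := h3.trans (ENNReal.ofReal_le_ofReal e3)
  have hsub : {ω | ¬ Good N (fun m ↦ (z m ω).ofLp) n ((K * b + 2 * (K * b') + 1) / √N)} ⊆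
      {ω | ¬ IsControlled (fun m ↦ (z m ω).ofLp) n t} ∪
      ({ω | IsControlled (fun m ↦ (z m ω).ofLp) n t ∧ K * b / √N + C₁ / N
        < |∑ a, q a (z n ω).ofLp * secondDev (fun m ↦ (z m ω).ofLp) a.1 a.2|} ∪
      {ω | IsControlled (fun m ↦ (z m ω).ofLp) n t ∧ K * b' / √N + C₂ / N
        < |∑ i, z n ω i * vecMean (fun m ↦ (z m ω).ofLp) i|}) := by
    intro ω hω
    by_contra hcon
    simp only [Set.mem_union, Set.mem_ofPred_eq, not_or, not_not, not_and, not_lt] at hcon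
    obtain ⟨g1, g2, g3⟩ := hcon
    refine hω (hexp N hN₁ _ n g1 _ ?_)
    have g2 := g2 g1
    have g3 := g3 g1
    have e : (K * b + 2 * (K * b') + 1) / √N = K * b / √N + 2 * (K * b' / √N) + 1 / √N := by
      ring
    have e' : T / N = C / N + C₁ / N + 2 * (C₂ / N) := by rw [hT]; ring
    rw [e]
    linarith
  refine (measure_mono hsub).trans ((measure_union_le _ _).trans
    ((add_le_add h1 ((measure_union_le _ _).trans (add_le_add h2 h3))).trans_eq ?_))
  rw [← ENNReal.ofReal_add (by positivity) (by positivity),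
    ← ENNReal.ofReal_add (by positivity) (by positivity)]
  congr 1
  ring

end ProbabilityBound

-- Behavior of estimates and distances under affine maps.

section Equivariance

variable {N : ℕ}

lemma vecMean_add_mulVec {ι : Type*} [Fintype ι] (hN : 0 < N) (μ : ι → ℝ) (K : Matrix ι ι ℝ)
    (z : Fin N → ι → ℝ) :
    vecMean (fun m ↦ μ + K *ᵥ z m) = μ + K *ᵥ vecMean z := by
  have hN' : (N : ℝ) ≠ 0 := by positivity
  simp only [vecMean, Finset.sum_add_distrib, smul_add, Matrix.mulVec_smul, Finset.sum_const,
    Finset.card_univ, Fintype.card_fin]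
  rw [← Nat.cast_smul_eq_nsmul ℝ, smul_smul, inv_mul_cancel₀ hN', one_smul, Matrix.mulVec_sum]

lemma vecCov_add_mulVec {ι : Type*} [Fintype ι] (hN : 0 < N) (μ : ι → ℝ) (K : Matrix ι ι ℝ)
    (z : Fin N → ι → ℝ) :
    vecCov (fun m ↦ μ + K *ᵥ z m) = K * vecCov z * Kᵀ := by
  simp only [vecCov, vecMean_add_mulVec hN, add_sub_add_left_eq_sub, ← Matrix.mulVec_sub]
  rw [Matrix.mul_smul, Matrix.smul_mul, Finset.mul_sum, Finset.sum_mul]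
  congr 1
  refine Finset.sum_congr rfl fun m _ ↦ ?_
  rw [Matrix.mul_vecMulVec, Matrix.vecMulVec_mul, Matrix.vecMul_transpose]

lemma vecMSD_add_mulVec {ι : Type*} [Fintype ι] [DecidableEq ι] (μ : ι → ℝ) {K : Matrix ι ι ℝ}
    (hK : IsUnit K) (x y : ι → ℝ) (S : Matrix ι ι ℝ) :
    vecMSD (μ + K *ᵥ x) (μ + K *ᵥ y) (K * S * Kᵀ) = vecMSD x y S := by
  have hKi : K⁻¹ * K = 1 := Matrix.nonsing_inv_mul _ ((Matrix.isUnit_iff_isUnit_det _).1 hK)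
  have hKt : Kᵀ * Kᵀ⁻¹ = 1 := by
    rw [← Matrix.transpose_nonsing_inv, ← Matrix.transpose_mul, hKi, Matrix.transpose_one]
  rw [vecMSD, vecMSD, add_sub_add_left_eq_sub, ← Matrix.mulVec_sub, Matrix.mul_inv_rev,
    Matrix.mul_inv_rev, Matrix.mulVec_mulVec, mul_assoc, mul_assoc, hKi, mul_one,
    dotProduct_comm, Matrix.dotProduct_mulVec, ← Matrix.mulVec_transpose, Matrix.mulVec_mulVec,
    ← mul_assoc, hKt, one_mul, dotProduct_comm]

variable {c : ℕ}

lemma matMean_affine (hN : 0 < N) (M L R : Matrix (Fin c) (Fin c) ℝ)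
    (Z : Fin N → Matrix (Fin c) (Fin c) ℝ) :
    matMean (fun m ↦ M + L * Z m * Rᵀ) = M + L * matMean Z * Rᵀ := by
  have hN' : (N : ℝ) ≠ 0 := by positivity
  simp only [matMean, Finset.sum_add_distrib, smul_add, Finset.sum_const,
    Finset.card_univ, Fintype.card_fin]
  rw [← Nat.cast_smul_eq_nsmul ℝ, smul_smul, inv_mul_cancel₀ hN', one_smul, Matrix.mul_smul,
    Matrix.smul_mul, Finset.mul_sum, Finset.sum_mul]

lemma nonsing_inv_conj {L S : Matrix (Fin c) (Fin c) ℝ} :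
    (L * S * Lᵀ)⁻¹ = L⁻¹ᵀ * S⁻¹ * L⁻¹ := by
  rw [Matrix.mul_inv_rev, Matrix.mul_inv_rev, Matrix.transpose_nonsing_inv, mul_assoc]

lemma transpose_mul_transpose_inv {L : Matrix (Fin c) (Fin c) ℝ} (hL : IsUnit L) :
    Lᵀ * L⁻¹ᵀ = 1 := by
  rw [← Matrix.transpose_mul,
    Matrix.nonsing_inv_mul _ ((Matrix.isUnit_iff_isUnit_det _).1 hL), Matrix.transpose_one]

lemma matMSD_affine (M : Matrix (Fin c) (Fin c) ℝ) {L R : Matrix (Fin c) (Fin c) ℝ}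
    (hL : IsUnit L) (hR : IsUnit R) (X Y Sc Sr : Matrix (Fin c) (Fin c) ℝ) :
    matMSD (M + L * X * Rᵀ) (M + L * Y * Rᵀ) (L * Sc * Lᵀ) (R * Sr * Rᵀ) = matMSD X Y Sc Sr := by
  have hLi : L⁻¹ * L = 1 := Matrix.nonsing_inv_mul _ ((Matrix.isUnit_iff_isUnit_det _).1 hL)
  have hRi : R⁻¹ * R = 1 := Matrix.nonsing_inv_mul _ ((Matrix.isUnit_iff_isUnit_det _).1 hR)
  have hLt := transpose_mul_transpose_inv hL
  have hRt := transpose_mul_transpose_inv hR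
  have e : M + L * X * Rᵀ - (M + L * Y * Rᵀ) = L * (X - Y) * Rᵀ := by noncomm_ring
  rw [matMSD, matMSD, e, nonsing_inv_conj, nonsing_inv_conj]
  have e2 : L⁻¹ᵀ * Sc⁻¹ * L⁻¹ * (L * (X - Y) * Rᵀ) * (R⁻¹ᵀ * Sr⁻¹ * R⁻¹) * (L * (X - Y) * Rᵀ)ᵀ
      = L⁻¹ᵀ * (Sc⁻¹ * (L⁻¹ * L) * (X - Y) * (Rᵀ * R⁻¹ᵀ) * Sr⁻¹ * (R⁻¹ * R) * (X - Y)ᵀ * Lᵀ) := by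
    simp only [Matrix.transpose_mul, Matrix.transpose_transpose, mul_assoc]
  rw [e2, hLi, hRi, hRt, Matrix.trace_mul_comm]
  simp only [mul_one]
  rw [mul_assoc _ Lᵀ, hLt, mul_one]

lemma flipC_affine (hN : 0 < N) (M L : Matrix (Fin c) (Fin c) ℝ) {R : Matrix (Fin c) (Fin c) ℝ}
    (hR : IsUnit R) (Z : Fin N → Matrix (Fin c) (Fin c) ℝ) (Sr : Matrix (Fin c) (Fin c) ℝ) :
    flipC (fun m ↦ M + L * Z m * Rᵀ) (R * Sr * Rᵀ) = L * flipC Z Sr * Lᵀ := by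
  have hRi : R⁻¹ * R = 1 := Matrix.nonsing_inv_mul _ ((Matrix.isUnit_iff_isUnit_det _).1 hR)
  have hRt := transpose_mul_transpose_inv hR
  simp only [flipC]
  rw [matMean_affine hN, Matrix.mul_smul, Matrix.smul_mul, Finset.mul_sum, Finset.sum_mul,
    nonsing_inv_conj]
  congr 1
  refine Finset.sum_congr rfl fun m _ ↦ ?_
  have e : M + L * Z m * Rᵀ - (M + L * matMean Z * Rᵀ) = L * (Z m - matMean Z) * Rᵀ := by
    noncomm_ring
  rw [e]
  have e2 : L * (Z m - matMean Z) * Rᵀ * (R⁻¹ᵀ * Sr⁻¹ * R⁻¹) * (L * (Z m - matMean Z) * Rᵀ)ᵀ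
      = L * (Z m - matMean Z) * (Rᵀ * R⁻¹ᵀ) * Sr⁻¹ * (R⁻¹ * R) * (Z m - matMean Z)ᵀ * Lᵀ := by
    simp only [Matrix.transpose_mul, Matrix.transpose_transpose, mul_assoc]
  rw [e2, hRi, hRt]
  simp only [mul_one, mul_assoc]

lemma flipR_affine (hN : 0 < N) (M R : Matrix (Fin c) (Fin c) ℝ) {L : Matrix (Fin c) (Fin c) ℝ}
    (hL : IsUnit L) (Z : Fin N → Matrix (Fin c) (Fin c) ℝ) (Sc : Matrix (Fin c) (Fin c) ℝ) :
    flipR (fun m ↦ M + L * Z m * Rᵀ) (L * Sc * Lᵀ) = R * flipR Z Sc * Rᵀ := by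
  have e : (fun m ↦ (M + L * Z m * Rᵀ)ᵀ) = fun m ↦ Mᵀ + R * (Z m)ᵀ * Lᵀ := by
    ext m
    simp only [Matrix.transpose_add, Matrix.transpose_mul, Matrix.transpose_transpose, mul_assoc]
  rw [flipR_eq_flipC_transpose, flipR_eq_flipC_transpose, e, flipC_affine hN _ _ hL]

lemma posDef_conj {ι : Type*} [Fintype ι] [DecidableEq ι] {L S : Matrix ι ι ℝ} (hL : IsUnit L) (hS : S.PosDef) :
    (L * S * Lᵀ).PosDef := by
  have := (Matrix.IsUnit.posDef_star_right_conjugate_iff (x := S) hL).2 hS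
  simpa [Matrix.star_eq_conjTranspose, Matrix.conjTranspose_eq_transpose_of_trivial] using this

/-- Needed in both directions: forward it transports existence to the original sample, and with the
inverse map it pulls an arbitrary estimate back to the whitened one. -/
lemma IsFlipFlopMLE.affine (hN : 0 < N) (M : Matrix (Fin c) (Fin c) ℝ)
    {L R : Matrix (Fin c) (Fin c) ℝ} (hL : IsUnit L) (hR : IsUnit R)
    {Z : Fin N → Matrix (Fin c) (Fin c) ℝ} {Sc Sr : Matrix (Fin c) (Fin c) ℝ}
    (h : IsFlipFlopMLE Z Sc Sr) :
    IsFlipFlopMLE (fun m ↦ M + L * Z m * Rᵀ) (L * Sc * Lᵀ) (R * Sr * Rᵀ) where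
  posDef_c := posDef_conj hL h.posDef_c
  posDef_r := posDef_conj hR h.posDef_r
  eq_c := by rw [flipC_affine hN _ _ hR, ← h.eq_c]
  eq_r := by rw [flipR_affine hN _ _ hL, ← h.eq_r]

end Equivariance

-- Reduction to a standard Gaussian sample.

section Whitening

open scoped MatrixOrder

/-- By uniqueness of the positive square root, `K` is the one in the definition of
`multivariateGaussian`, and the map inverts the affine map used there. -/
lemma hasLaw_whitening {ι : Type*} [Fintype ι] [DecidableEq ι] {K S : Matrix ι ι ℝ}
    (hK : K.PosDef) (hS : K * K = S) (μ : EuclideanSpace ℝ ι) :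
    HasLaw (fun x ↦ Matrix.toEuclideanCLM (𝕜 := ℝ) K⁻¹ (x - μ))
      (stdGaussian (EuclideanSpace ℝ ι)) (multivariateGaussian μ S) := by
  have hsqrt : CFC.sqrt S = K := CFC.sqrt_unique hS hK.posSemidef.nonneg
  refine ⟨by fun_prop, ?_⟩
  rw [multivariateGaussian, hsqrt, Measure.map_map (by fun_prop) (by fun_prop)]
  have : (fun x ↦ Matrix.toEuclideanCLM (𝕜 := ℝ) K⁻¹ (x - μ)) ∘
      (fun x ↦ μ + Matrix.toEuclideanCLM (𝕜 := ℝ) K x) = id := by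
    ext1 x
    simp only [Function.comp_apply, add_sub_cancel_left, id]
    rw [← mul_apply_eq_comp, ← map_mul,
      Matrix.nonsing_inv_mul _ ((Matrix.isUnit_iff_isUnit_det _).1 hK.isUnit), map_one]
    rfl
  rw [this, Measure.map_id]

lemma exists_posDef_sq_eq {c : ℕ} {S : Matrix (Fin c) (Fin c) ℝ} (hS : S.PosDef) :
    ∃ L : Matrix (Fin c) (Fin c) ℝ, L.PosDef ∧ L * L = S := by
  have h : CFC.sqrt S * CFC.sqrt S = S := CFC.sqrt_mul_sqrt_self S hS.posSemidef.nonneg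
  refine ⟨CFC.sqrt S, ?_, h⟩
  rw [(Matrix.nonneg_iff_posSemidef.1 (CFC.sqrt_nonneg S)).posDef_iff_isUnit]
  have hu := hS.isUnit
  rw [← h] at hu
  exact isUnit_of_mul_isUnit_left hu

lemma transpose_eq_of_posDef {ι : Type*} [Fintype ι] {L : Matrix ι ι ℝ} (hL : L.PosDef) :
    Lᵀ = L := by
  have := hL.isHermitian
  rwa [Matrix.IsHermitian, Matrix.conjTranspose_eq_transpose_of_trivial] at this

/-- A matrix-variate normal sample is an affine image of a standard Gaussian sample. -/
theorem IsSample.exists_whitening {Ω : Type*} [MeasurableSpace Ω] {P : Measure Ω}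
    {c N : ℕ} {X : Fin N → Ω → Matrix (Fin c) (Fin c) ℝ} {M Sc Sr : Matrix (Fin c) (Fin c) ℝ}
    (h : IsSample P X M Sc Sr) (hSc : Sc.PosDef) (hSr : Sr.PosDef) :
    ∃ (L R : Matrix (Fin c) (Fin c) ℝ) (Z : Fin N → Ω → Matrix (Fin c) (Fin c) ℝ),
      IsUnit L ∧ IsUnit R ∧ L * Lᵀ = Sc ∧ R * Rᵀ = Sr ∧
      (∀ m ω, X m ω = M + L * Z m ω * Rᵀ) ∧
      (∀ m, HasLaw (fun ω ↦ WithLp.toLp 2 (Z m ω).vec)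
        (stdGaussian (EuclideanSpace ℝ (Fin c × Fin c))) P) ∧
      iIndepFun (fun m ω ↦ (WithLp.toLp 2 (Z m ω).vec : EuclideanSpace ℝ (Fin c × Fin c))) P := by
  obtain ⟨L, hL, hLS⟩ := exists_posDef_sq_eq hSc
  obtain ⟨R, hR, hRS⟩ := exists_posDef_sq_eq hSr
  have hLt := transpose_eq_of_posDef hL
  have hRt := transpose_eq_of_posDef hR
  have hLi := Matrix.mul_nonsing_inv _ ((Matrix.isUnit_iff_isUnit_det _).1 hL.isUnit)
  have hRi := Matrix.nonsing_inv_mul _ ((Matrix.isUnit_iff_isUnit_det _).1 hR.isUnit)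
  -- The square root of `Sr ⊗ₖ Sc` is again a Kronecker product, so whitening the vectorization is
  -- `X ↦ L⁻¹ * (X - M) * R⁻¹` on matrices.
  have hK : (R ⊗ₖ L).PosDef := hR.kronecker hL
  have hKS : (R ⊗ₖ L) * (R ⊗ₖ L) = Sr ⊗ₖ Sc := by
    rw [← Matrix.mul_kronecker_mul, hLS, hRS]
  set Z : Fin N → Ω → Matrix (Fin c) (Fin c) ℝ := fun m ω ↦ L⁻¹ * (X m ω - M) * R⁻¹ with hZ
  set f : EuclideanSpace ℝ (Fin c × Fin c) → EuclideanSpace ℝ (Fin c × Fin c) := fun x ↦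
    Matrix.toEuclideanCLM (𝕜 := ℝ) (R ⊗ₖ L)⁻¹ (x - WithLp.toLp 2 M.vec) with hf
  have hZf : ∀ m, (fun ω ↦ (WithLp.toLp 2 (Z m ω).vec : EuclideanSpace ℝ (Fin c × Fin c)))
      = f ∘ fun ω ↦ WithLp.toLp 2 (X m ω).vec := by
    intro m
    ext1 ω
    simp only [hf, Function.comp_apply, ← WithLp.toLp_sub, Matrix.toEuclideanCLM_toLp,
      ← Matrix.vec_sub, Matrix.inv_kronecker, Matrix.kronecker_mulVec_vec]
    rw [Matrix.transpose_nonsing_inv, hRt]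
  have hfm : Measurable f := by
    simp only [hf]
    fun_prop
  refine ⟨L, R, Z, hL.isUnit, hR.isUnit, by rw [hLt, hLS], by rw [hRt, hRS], fun m ω ↦ ?_,
    fun m ↦ ?_, ?_⟩
  · rw [hRt]
    have : L * (L⁻¹ * (X m ω - M) * R⁻¹) * R = (L * L⁻¹) * (X m ω - M) * (R⁻¹ * R) := by
      simp only [mul_assoc]
    simp only [hZ]
    rw [this, hLi, hRi, one_mul, mul_one]
    abel
  · rw [hZf m]
    exact (hasLaw_whitening hK hKS _).comp (h.hasLaw m)
  · have e : (fun m ω ↦ (WithLp.toLp 2 (Z m ω).vec : EuclideanSpace ℝ (Fin c × Fin c)))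
        = fun m ↦ f ∘ fun ω ↦ WithLp.toLp 2 (X m ω).vec := funext hZf
    rw [e]
    exact h.indep.comp (fun _ ↦ f) fun _ ↦ hfm

end Whitening

-- The two bounds for a standard Gaussian sample.

section Main

lemma exists_vec_bound {ε : ℝ} (hε : 0 < ε) (c : ℕ) [NeZero c] :
    ∃ N₀ : ℕ, ∀ N, N₀ ≤ N → ∀ {Ω : Type*} [MeasurableSpace Ω] (P : Measure Ω)
      [IsProbabilityMeasure P] (Z : Fin N → Ω → Matrix (Fin c) (Fin c) ℝ),
      (∀ m, HasLaw (fun ω ↦ WithLp.toLp 2 (Z m ω).vec)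
        (stdGaussian (EuclideanSpace ℝ (Fin c × Fin c))) P) →
      iIndepFun (fun m ω ↦ (WithLp.toLp 2 (Z m ω).vec : EuclideanSpace ℝ (Fin c × Fin c))) P →
      ∀ n : Fin N,
      P {ω | ¬ ((vecCov fun m ↦ (Z m ω).vec).PosDef ∧
        |vecMSD (Z n ω).vec (vecMean fun m ↦ (Z m ω).vec) (vecCov fun m ↦ (Z m ω).vec)
          - (Z n ω).vec ⬝ᵥ (Z n ω).vec|
          ≤ (8 * √(6 / ε) + 1) * ((c : ℝ) ^ 2 / √N))} ≤ ENNReal.ofReal ε := by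
  have hc1 : (1 : ℝ) ≤ c := by exact_mod_cast Nat.pos_of_ne_zero (NeZero.ne c)
  have hcc : (c : ℝ) ≤ (c : ℝ) ^ 2 := by nlinarith
  obtain ⟨N₀, h⟩ := exists_forall_measure_not_le (ι := Fin c × Fin c)
    (fun N z n B ↦ (vecCov z).PosDef ∧ |vecMSD (z n) (vecMean z) (vecCov z) - z n ⬝ᵥ z n| ≤ B)
    (q := fun a x ↦ x a.1 * x a.2) (fun a ↦ by fun_prop) (fun a ↦ memLp_coord_mul a.1 a.2)
    -- The coefficients have mean squared norm at most `3 c⁴ ≤ (2 c²)²`, and the dimension is `c²`.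
    (fun i j x ↦ mul_comm _ _) (b := 2 * (c : ℝ) ^ 2) (b' := c) (by positivity) (by positivity)
    (sum_integral_coord_mul_sq_le.trans (by
      rw [Fintype.card_prod, Fintype.card_fin]; push_cast; nlinarith [sq_nonneg ((c : ℝ) ^ 2)]))
    (by rw [Fintype.card_prod, Fintype.card_fin]; push_cast; nlinarith)
    (fun t ht ↦ by
      obtain ⟨C, N₀, hC, hexp⟩ := exists_vecMSD_expansion (Fin c × Fin c) ht
      refine ⟨C, N₀, hC, fun N hN z n hz B hB ↦ ?_⟩
      obtain ⟨h1, h2⟩ := hexp N hN z n hz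
      refine ⟨h1, ?_⟩
      have g1 := abs_le.1 h2
      have g2 := neg_abs_le (∑ a : (Fin c × Fin c) × (Fin c × Fin c),
        z n a.1 * z n a.2 * secondDev z a.1 a.2)
      have g3 := le_abs_self (∑ a : (Fin c × Fin c) × (Fin c × Fin c),
        z n a.1 * z n a.2 * secondDev z a.1 a.2)
      have g4 := neg_abs_le (∑ i, z n i * vecMean z i)
      have g5 := le_abs_self (∑ i, z n i * vecMean z i)
      rw [abs_le]
      constructor <;> linarith [g1.1, g1.2]) hε
  refine ⟨N₀, fun N hN Ω _ P _ Z hZ hind n ↦ (measure_mono ?_).trans (h N hN P _ hZ hind n)⟩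
  intro ω hω hgood
  refine hω ⟨hgood.1, hgood.2.trans ?_⟩
  rw [← mul_div_assoc]
  have : 0 ≤ √(6 / ε) := Real.sqrt_nonneg _
  gcongr
  nlinarith

lemma exists_mat_bound {ε : ℝ} (hε : 0 < ε) (c : ℕ) [NeZero c] :
    ∃ N₀ : ℕ, ∀ N, N₀ ≤ N → ∀ {Ω : Type*} [MeasurableSpace Ω] (P : Measure Ω)
      [IsProbabilityMeasure P] (Z : Fin N → Ω → Matrix (Fin c) (Fin c) ℝ),
      (∀ m, HasLaw (fun ω ↦ WithLp.toLp 2 (Z m ω).vec)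
        (stdGaussian (EuclideanSpace ℝ (Fin c × Fin c))) P) →
      iIndepFun (fun m ω ↦ (WithLp.toLp 2 (Z m ω).vec : EuclideanSpace ℝ (Fin c × Fin c))) P →
      ∀ n : Fin N,
      P {ω | ¬ ((∃ Sc Sr, IsFlipFlopMLE (fun m ↦ Z m ω) Sc Sr) ∧
        ∀ Sc Sr, IsFlipFlopMLE (fun m ↦ Z m ω) Sc Sr →
        |matMSD (Z n ω) (matMean fun m ↦ Z m ω) Sc Sr - (Z n ω * (Z n ω)ᵀ).trace|
          ≤ (8 * √(6 / ε) + 1) * ((c : ℝ) / √N))} ≤ ENNReal.ofReal ε := by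
  have hc1 : (1 : ℝ) ≤ c := by exact_mod_cast Nat.pos_of_ne_zero (NeZero.ne c)
  -- The inverse of `vec`: `(mat x).vec` unfolds to `x`, which the `change` below relies on.
  let mat : (Fin c × Fin c → ℝ) → Matrix (Fin c) (Fin c) ℝ := fun x ↦ Matrix.of fun i j ↦ x (j, i)
  obtain ⟨N₀, h⟩ := exists_forall_measure_not_le (ι := Fin c × Fin c)
    (fun N z n B ↦ (∃ Sc Sr, IsFlipFlopMLE (fun m ↦ mat (z m)) Sc Sr) ∧
        ∀ Sc Sr, IsFlipFlopMLE (fun m ↦ mat (z m)) Sc Sr →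
        |matMSD (mat (z n)) (matMean fun m ↦ mat (z m)) Sc Sr
          - (mat (z n) * (mat (z n))ᵀ).trace| ≤ B)
    (q := fun a x ↦ matWeight x a) continuous_matWeight memLp_matWeight
    -- Here `27 c² ≤ (6 c)²`; together with twice `b' = c` this gives the factor `8` of the final
    -- constant.
    (fun i j x ↦ matWeight_swap x i j) (b := 6 * (c : ℝ)) (b' := c) (by positivity)
    (by positivity)
    (sum_integral_matWeight_sq_le.trans (by nlinarith))
    (by rw [Fintype.card_prod, Fintype.card_fin]; push_cast; nlinarith)
    (fun t ht ↦ by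
      obtain ⟨C, N₀, hC, hexp⟩ := exists_matMSD_expansion c ht
      refine ⟨C, N₀, hC, fun N hN z n hz B hB ↦ ?_⟩
      obtain ⟨h1, h2⟩ := hexp N hN (fun m ↦ mat (z m)) n hz
      refine ⟨h1, fun Sc Sr hS ↦ ?_⟩
      have g1 := abs_le.1 (h2 Sc Sr hS)
      change _ ≤ _ - (_ - (∑ a, matWeight (z n) a * secondDev z a.1 a.2)
        - 2 * ∑ i, z n i * vecMean z i) ∧ _ - (_ - (∑ a, matWeight (z n) a * secondDev z a.1 a.2)
        - 2 * ∑ i, z n i * vecMean z i) ≤ _ at g1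
      have g2 := neg_abs_le (∑ a, matWeight (z n) a * secondDev z a.1 a.2)
      have g3 := le_abs_self (∑ a, matWeight (z n) a * secondDev z a.1 a.2)
      have g4 := neg_abs_le (∑ i, z n i * vecMean z i)
      have g5 := le_abs_self (∑ i, z n i * vecMean z i)
      rw [abs_le]
      constructor <;> linarith [g1.1, g1.2]) hε
  refine ⟨N₀, fun N hN Ω _ P _ Z hZ hind n ↦ (measure_mono ?_).trans (h N hN P _ hZ hind n)⟩
  intro ω hω hgood
  refine hω ⟨hgood.1, fun Sc Sr hS ↦ (hgood.2 Sc Sr hS).trans ?_⟩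
  rw [← mul_div_assoc]
  have : 0 ≤ √(6 / ε) := Real.sqrt_nonneg _
  gcongr
  nlinarith

end Main

end MatrixNormal

end

/-- The two `O_p` bounds as `N → ∞`, with a constant `K` that depends on the tolerance `ε` only: not
on the dimension `c = r`, the parameters, the observation index or the probability space. The
threshold `N₀` depends on `ε` and `c` only. -/
theorem proposition1 (ε : ℝ) (hε : 0 < ε) :
    ∃ K : ℝ, 0 < K ∧ ∀ c : ℕ, 0 < c → ∃ N₀ : ℕ, ∀ N : ℕ, N₀ ≤ N →
      ∀ (M Sc Sr : Matrix (Fin c) (Fin c) ℝ), Sc.PosDef → Sr.PosDef →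
      ∀ (Ω : Type*) [MeasurableSpace Ω] (P : Measure Ω) [IsProbabilityMeasure P]
        (X : Fin N → Ω → Matrix (Fin c) (Fin c) ℝ), MatrixNormal.IsSample P X M Sc Sr →
      ∀ n : Fin N,
        -- vector-based distance at the sample mean and the sample covariance
        P {ω | ¬ ((MatrixNormal.vecCov fun m => (X m ω).vec).PosDef ∧
            |MatrixNormal.vecMSD (X n ω).vec (MatrixNormal.vecMean fun m => (X m ω).vec)
                (MatrixNormal.vecCov fun m => (X m ω).vec)
              - MatrixNormal.vecMSD (X n ω).vec M.vec (Sr ⊗ₖ Sc)|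
            ≤ K * ((c : ℝ) ^ 2 / √(N : ℝ)))} ≤ ENNReal.ofReal ε ∧
        -- matrix-based distance at the sample mean and the flip-flop estimates
        P {ω | ¬ ((∃ Sc' Sr', MatrixNormal.IsFlipFlopMLE (fun m => X m ω) Sc' Sr') ∧
            ∀ Sc' Sr', MatrixNormal.IsFlipFlopMLE (fun m => X m ω) Sc' Sr' →
              |MatrixNormal.matMSD (X n ω) (MatrixNormal.matMean fun m => X m ω) Sc' Sr'
                - MatrixNormal.matMSD (X n ω) M Sc Sr|
              ≤ K * ((c : ℝ) / √(N : ℝ)))} ≤ ENNReal.ofReal ε := by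
  refine ⟨8 * √(6 / ε) + 1, by positivity, fun c hc ↦ ?_⟩
  have : NeZero c := ⟨hc.ne'⟩
  obtain ⟨N₁, h₁⟩ := MatrixNormal.exists_vec_bound hε c
  obtain ⟨N₂, h₂⟩ := MatrixNormal.exists_mat_bound hε c
  refine ⟨max N₁ N₂, fun N hN M Sc Sr hSc hSr Ω _ P _ X hX n ↦ ?_⟩
  have hNpos : 0 < N := n.pos
  obtain ⟨L, R, Z, hL, hR, hLS, hRS, hXZ, hZ, hind⟩ := hX.exists_whitening hSc hSr
  have hLi := Matrix.nonsing_inv_mul _ ((Matrix.isUnit_iff_isUnit_det _).1 hL)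
  have hLi' := Matrix.mul_nonsing_inv _ ((Matrix.isUnit_iff_isUnit_det _).1 hL)
  have hRi := Matrix.nonsing_inv_mul _ ((Matrix.isUnit_iff_isUnit_det _).1 hR)
  have hRi' := Matrix.mul_nonsing_inv _ ((Matrix.isUnit_iff_isUnit_det _).1 hR)
  refine ⟨(measure_mono ?_).trans (h₁ N ((le_max_left _ _).trans hN) P Z hZ hind n),
    (measure_mono ?_).trans (h₂ N ((le_max_right _ _).trans hN) P Z hZ hind n)⟩
  · intro ω hω hgood
    have hK : IsUnit (R ⊗ₖ L) := by
      rw [Matrix.isUnit_iff_isUnit_det, Matrix.det_kronecker]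
      exact (((Matrix.isUnit_iff_isUnit_det _).1 hR).pow _).mul
        (((Matrix.isUnit_iff_isUnit_det _).1 hL).pow _)
    have hx : ∀ m, (X m ω).vec = M.vec + (R ⊗ₖ L) *ᵥ (Z m ω).vec := fun m ↦ by
      rw [hXZ, Matrix.vec_add, Matrix.kronecker_mulVec_vec]
    have hS : Sr ⊗ₖ Sc = (R ⊗ₖ L) * 1 * (R ⊗ₖ L)ᵀ := by
      rw [mul_one, ← Matrix.kroneckerMap_transpose, ← Matrix.mul_kronecker_mul, hLS, hRS]
    have hM : M.vec = M.vec + (R ⊗ₖ L) *ᵥ 0 := by rw [Matrix.mulVec_zero, add_zero]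
    refine hω ?_
    simp only [hx]
    rw [MatrixNormal.vecCov_add_mulVec hNpos, MatrixNormal.vecMean_add_mulVec hNpos,
      MatrixNormal.vecMSD_add_mulVec _ hK, hS]
    have e : MatrixNormal.vecMSD (M.vec + (R ⊗ₖ L) *ᵥ (Z n ω).vec) M.vec
        ((R ⊗ₖ L) * 1 * (R ⊗ₖ L)ᵀ) = (Z n ω).vec ⬝ᵥ (Z n ω).vec := by
      conv_lhs => arg 2; rw [hM]
      rw [MatrixNormal.vecMSD_add_mulVec _ hK, MatrixNormal.vecMSD, sub_zero, inv_one,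
        Matrix.one_mulVec]
    rw [e]
    exact ⟨MatrixNormal.posDef_conj hK hgood.1, hgood.2⟩
  · intro ω hω hgood
    have hx : (fun m ↦ X m ω) = fun m ↦ M + L * Z m ω * Rᵀ := funext fun m ↦ hXZ m ω
    refine hω ?_
    obtain ⟨⟨Sc₀, Sr₀, h₀⟩, hall⟩ := hgood
    rw [hx]
    refine ⟨⟨_, _, h₀.affine hNpos M hL hR⟩, fun Sc' Sr' h' ↦ ?_⟩
    have hLu : IsUnit L⁻¹ := Matrix.isUnit_nonsing_inv_iff.2 hL
    have hRu : IsUnit R⁻¹ := Matrix.isUnit_nonsing_inv_iff.2 hR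
    have hLt : Lᵀ * L⁻¹ᵀ = 1 := MatrixNormal.transpose_mul_transpose_inv hL
    have hRt : Rᵀ * R⁻¹ᵀ = 1 := MatrixNormal.transpose_mul_transpose_inv hR
    have hLt' : L⁻¹ᵀ * Lᵀ = 1 := by rw [← Matrix.transpose_mul, hLi', Matrix.transpose_one]
    have hRt' : R⁻¹ᵀ * Rᵀ = 1 := by rw [← Matrix.transpose_mul, hRi', Matrix.transpose_one]
    -- The inverse affine map carries the given estimate to one for the whitened sample, to which
    -- the bound for all estimates applies.
    have hback := h'.affine hNpos (-(L⁻¹ * M * R⁻¹ᵀ)) hLu hRu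
    have hZeq : (fun m ↦ -(L⁻¹ * M * R⁻¹ᵀ) + L⁻¹ * (M + L * Z m ω * Rᵀ) * R⁻¹ᵀ)
        = fun m ↦ Z m ω := by
      ext1 m
      have : L⁻¹ * (M + L * Z m ω * Rᵀ) * R⁻¹ᵀ
          = L⁻¹ * M * R⁻¹ᵀ + (L⁻¹ * L) * Z m ω * (Rᵀ * R⁻¹ᵀ) := by
        simp only [mul_add, add_mul, mul_assoc]
      rw [this, hLi, hRt, one_mul, mul_one, neg_add_cancel_left]
    rw [hZeq] at hback
    have hb := hall _ _ hback
    have hSc' : L * (L⁻¹ * Sc' * L⁻¹ᵀ) * Lᵀ = Sc' := by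
      have : L * (L⁻¹ * Sc' * L⁻¹ᵀ) * Lᵀ = (L * L⁻¹) * Sc' * (L⁻¹ᵀ * Lᵀ) := by
        simp only [mul_assoc]
      rw [this, hLi', hLt', one_mul, mul_one]
    have hSr' : R * (R⁻¹ * Sr' * R⁻¹ᵀ) * Rᵀ = Sr' := by
      have : R * (R⁻¹ * Sr' * R⁻¹ᵀ) * Rᵀ = (R * R⁻¹) * Sr' * (R⁻¹ᵀ * Rᵀ) := by
        simp only [mul_assoc]
      rw [this, hRi', hRt', one_mul, mul_one]
    have e1 : MatrixNormal.matMSD (X n ω) (MatrixNormal.matMean fun m ↦ M + L * Z m ω * Rᵀ) Sc' Sr'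
        = MatrixNormal.matMSD (Z n ω) (MatrixNormal.matMean fun m ↦ Z m ω)
          (L⁻¹ * Sc' * L⁻¹ᵀ) (R⁻¹ * Sr' * R⁻¹ᵀ) := by
      have := MatrixNormal.matMSD_affine M hL hR (Z n ω) (MatrixNormal.matMean fun m ↦ Z m ω)
        (L⁻¹ * Sc' * L⁻¹ᵀ) (R⁻¹ * Sr' * R⁻¹ᵀ)
      rwa [hSc', hSr', ← hXZ, ← MatrixNormal.matMean_affine hNpos] at this
    -- The true parameters are the images of mean `0` and identity covariances.
    have e2 : MatrixNormal.matMSD (X n ω) M Sc Sr = (Z n ω * (Z n ω)ᵀ).trace := by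
      have := MatrixNormal.matMSD_affine M hL hR (Z n ω) 0 1 1
      rw [mul_zero, zero_mul, add_zero, mul_one, mul_one, hLS, hRS, ← hXZ] at this
      rw [this, MatrixNormal.matMSD, inv_one, sub_zero, one_mul, mul_one]
    rw [e1, e2]
    exact hb
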